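/- Let $n>1$. Consider the equations of adiabatic gas dynamics for velocity $\mathbf u(t,\mathbf x)\in\mathbb R^n$, density $\rho(t,\mathbf x)>0$ and pressure $p(t,\mathbf x)$, $\mathbf x\in\mathbb R^n$, $$\mathbf u_t+\mathbf u\cdot\nabla\mathbf u+\tfrac1\rho\nabla p=0,\qquad \rho_t+\nabla\cdot(\rho\mathbf u)=0,\qquad p_t+\mathbf u\cdot\nabla p+F(p,\rho)\nabla\cdot\mathbf u=0,$$ where the state function $F$ is smooth on a nonempty connected open set $\Omega$ of states $(p,\rho)$ with $\rho>0$ and does not vanish identically on any nonempty open subset of $\Omega$. A smooth function $T(t,\mathbf x,\mathbf u,\rho,p)$, defined for all $t,\mathbf x,\mathbf u$ and all $(p,\rho)\in\Omega$, is called a kinematic conserved density if there is a smooth spatial flux $\mathbf X$, a function of $t,\mathbf x,\mathbf u,\rho,p$ and finitely many $\mathbf x$-derivatives of $\mathbf u,\rho,p$, such that $D_tT+D_{\mathbf x}\cdot\mathbf X=0$ holds formally on all solutions (that is, identically in the spatial jets of $\mathbf u,\rho,p$, once the time derivatives are eliminated by the equations). Every smooth function $c(t,\mathbf x)$ is such a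 density; it is called trivial. (i) For every such $F$ the following are kinematic conserved densities: mass $\rho$, momentum $\rho u^i$, angular momentum $\rho(u^ix^j-u^jx^i)$, Galilean momentum $\rho(tu^i-x^i)$, energy $\rho(\tfrac12|\mathbf u|^2+e)$, where $e(p,\rho)$ is any solution of $\rho e_\rho+F e_p=p/\rho$ on $\Omega$, and volumetric entropy $\rho S$, where $S(p,\rho)$ is any solution of $\rho S_\rho+F S_p=0$ on $\Omega$; likewise their linear combinations. For general $F$, namely whenever $F$ is not of the form in (ii), every kinematic conserved density is, up to a trivial one, a linear combination of these, in which for $e$ one may take any given solution (the energy term occurring only if a solution $e$ exists on $\Omega$). (ii) Additional kinematic conserved densities exist if and only if, modulo a constant shift of the pressure, $F$ is the polytropic state function with dimension-dependent coefficient, i.e. $F=\gamma(p-p_0)$ on $\Omega$ with $\gamma=1+2/n$ and some constant $p_0$. In this case the kinematic conserved densities are exactly the linear combinations of those in (i), of the similarity energy $tE-\tfrac12\rho\,\mathbf u\cdot\mathbf x$ and of the dilational energy $t^2E-t\rho\,\mathbf u\cdot\mathbf x+\tfrac12\rho|\mathbf x|^2$, up to trivial ones, where $E=\tfrac12\rho|\mathbf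 u|^2+\tfrac n2(p-p_0)$ is the polytropic energy density. -/

import Mathlib

open scoped ContDiff

noncomputable section

namespace GasDynamics

/-- The flow domain `ℝⁿ` with its Euclidean structure (also the space of velocities). -/
abbrev Space (n : ℕ) := EuclideanSpace ℝ (Fin n)

/-- Spatial divergence of a vector field on `ℝⁿ`. -/
def divergence {n : ℕ} (v : Space n → Space n) (x : Space n) : ℝ :=
  ∑ i : Fin n, (fderiv ℝ v x (EuclideanSpace.single i 1)) i

/-- Smooth fluid variables `(u, ρ, p)` on space, at a fixed time, with thermodynamic state
`(p, ρ)` in the region `Ω`. Their spatial Taylor coefficients at a point are arbitrary, so an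
identity which holds for all of them is an identity in the spatial jet variables. -/
structure FluidField (n : ℕ) (Ω : Set (ℝ × ℝ)) where
  u : Space n → Space n
  ρ : Space n → ℝ
  p : Space n → ℝ
  smooth_u : ContDiff ℝ ∞ u
  smooth_ρ : ContDiff ℝ ∞ ρ
  smooth_p : ContDiff ℝ ∞ p
  mem : ∀ x, (p x, ρ x) ∈ Ω

namespace FluidField

variable {n : ℕ} {Ω : Set (ℝ × ℝ)}

/-- The value of `∂ₜu` given by `∂ₜu + u·∇u + (1/ρ)∇p = 0`. -/
def uDot (φ : FluidField n Ω) (x : Space n) : Space n :=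
  -(fderiv ℝ φ.u x (φ.u x)) - (1 / φ.ρ x) • gradient φ.p x

/-- The value of `∂ₜρ` given by `∂ₜρ + ∇·(ρu) = 0`. -/
def ρDot (φ : FluidField n Ω) (x : Space n) : ℝ :=
  -divergence (fun y => φ.ρ y • φ.u y) x

/-- The value of `∂ₜp` given by `∂ₜp + u·∇p + F(p,ρ) ∇·u = 0`. -/
def pDot (F : ℝ × ℝ → ℝ) (φ : FluidField n Ω) (x : Space n) : ℝ :=
  -(inner ℝ (φ.u x) (gradient φ.p x)) - F (φ.p x, φ.ρ x) * divergence φ.u x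

end FluidField

/-- Spatial jets of order at most `k` of the fluid variables `(u, ρ, p)`. -/
abbrev Jet (n k : ℕ) :=
  (j : Fin (k + 1)) → (Space n) [×(j : ℕ)]→L[ℝ] (Space n × ℝ × ℝ)

/-- The `k`-jet at `x` of fluid variables. -/
def FluidField.jet {n : ℕ} {Ω : Set (ℝ × ℝ)} (k : ℕ) (φ : FluidField n Ω) (x : Space n) :
    Jet n k :=
  fun j => iteratedFDeriv ℝ (j : ℕ) (fun y => (φ.u y, φ.ρ y, φ.p y)) x

/-- The order-zero part `(u, ρ, p)` of a jet. -/
def Jet.base {n k : ℕ} (J : Jet n k) : Space n × ℝ × ℝ := J 0 (fun _ => 0)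

/-- Arguments `(t, x, jet)` whose thermodynamic state `(p, ρ)` lies in `Ω`. -/
def jetDomain (n k : ℕ) (Ω : Set (ℝ × ℝ)) : Set (ℝ × Space n × Jet n k) :=
  {q | ((Jet.base q.2.2).2.2, (Jet.base q.2.2).2.1) ∈ Ω}

/-- Functions `T(t, x, u, ρ, p)` of kinematic form. -/
abbrev KinematicFunction (n : ℕ) := ℝ → Space n → Space n → ℝ → ℝ → ℝ

/-- `T(t, x, u, ρ, p)` is smooth for all `t, x, u` and all `(p, ρ) ∈ Ω`. -/
def KinematicFunction.IsSmooth {n : ℕ} (Ω : Set (ℝ × ℝ)) (T : KinematicFunction n) : Prop :=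
  ContDiffOn ℝ ∞
    (fun q : ℝ × Space n × Space n × ℝ × ℝ => T q.1 q.2.1 q.2.2.1 q.2.2.2.1 q.2.2.2.2)
    {q | (q.2.2.2.2, q.2.2.2.1) ∈ Ω}

/-- The total time derivative of `T` evaluated on solutions: time derivatives of the fluid
variables are eliminated by means of the gas dynamics equations. -/
def totalTimeDeriv {n : ℕ} {Ω : Set (ℝ × ℝ)} (F : ℝ × ℝ → ℝ) (T : KinematicFunction n)
    (φ : FluidField n Ω) (t : ℝ) (x : Space n) : ℝ :=
  deriv (fun s => T s x (φ.u x) (φ.ρ x) (φ.p x)) t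
    + fderiv ℝ (fun v => T t x v (φ.ρ x) (φ.p x)) (φ.u x) (φ.uDot x)
    + deriv (fun r => T t x (φ.u x) r (φ.p x)) (φ.ρ x) * φ.ρDot x
    + deriv (fun q => T t x (φ.u x) (φ.ρ x) q) (φ.p x) * φ.pDot F x

/-- `T(t, x, u, ρ, p)` is a kinematic conserved density of the gas dynamics equations with
state function `F` on `Ω`: for some smooth spatial flux `X`, depending on `t`, `x` and on
`u, ρ, p` with their spatial derivatives up to a finite order, `D_t T + D_x · X = 0` holds
formally on all solutions. -/
def IsConservedDensity {n : ℕ} (F : ℝ × ℝ → ℝ) (Ω : Set (ℝ × ℝ)) (T : KinematicFunction n) :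
    Prop :=
  T.IsSmooth Ω ∧
    ∃ (k : ℕ) (X : ℝ × Space n × Jet n k → Space n),
      ContDiffOn ℝ ∞ X (jetDomain n k Ω) ∧
      ∀ (φ : FluidField n Ω) (t : ℝ) (x : Space n),
        totalTimeDeriv F T φ t x + divergence (fun y => X (t, y, φ.jet k y)) x = 0

/-- `S(p, ρ)` is a solution on `Ω` of `ρ S_ρ + F S_p = 0`. -/
def IsEntropy (F : ℝ × ℝ → ℝ) (Ω : Set (ℝ × ℝ)) (S : ℝ × ℝ → ℝ) : Prop :=
  ContDiffOn ℝ ∞ S Ω ∧ ∀ p ρ : ℝ, (p, ρ) ∈ Ω →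
    ρ * deriv (fun r => S (p, r)) ρ + F (p, ρ) * deriv (fun q => S (q, ρ)) p = 0

/-- `e(p, ρ)` is a solution on `Ω` of `ρ e_ρ + F e_p = p / ρ`. -/
def IsInternalEnergy (F : ℝ × ℝ → ℝ) (Ω : Set (ℝ × ℝ)) (e : ℝ × ℝ → ℝ) : Prop :=
  ContDiffOn ℝ ∞ e Ω ∧ ∀ p ρ : ℝ, (p, ρ) ∈ Ω →
    ρ * deriv (fun r => e (p, r)) ρ + F (p, ρ) * deriv (fun q => e (q, ρ)) p = p / ρ

section Densities

variable {n : ℕ}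

def mass : KinematicFunction n := fun _ _ _ ρ _ => ρ

def momentum (i : Fin n) : KinematicFunction n := fun _ _ u ρ _ => ρ * u i

def angularMomentum (i j : Fin n) : KinematicFunction n :=
  fun _ x u ρ _ => ρ * (u i * x j - u j * x i)

def galileanMomentum (i : Fin n) : KinematicFunction n :=
  fun t x u ρ _ => ρ * (t * u i - x i)

def energy (e : ℝ × ℝ → ℝ) : KinematicFunction n :=
  fun _ _ u ρ p => ρ * (1 / 2 * ‖u‖ ^ 2 + e (p, ρ))

def volumetricEntropy (S : ℝ × ℝ → ℝ) : KinematicFunction n :=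
  fun _ _ _ ρ p => ρ * S (p, ρ)

/-- The polytropic energy density `E = ½ρ|u|² + (n/2)(p - p₀)`, the pressure being counted
from `p₀`. -/
def polytropicEnergy (p₀ : ℝ) : KinematicFunction n :=
  fun _ _ u ρ p => 1 / 2 * ρ * ‖u‖ ^ 2 + (n : ℝ) / 2 * (p - p₀)

/-- `t E - ½ρ u·x`. -/
def similarityEnergy (p₀ : ℝ) : KinematicFunction n :=
  fun t x u ρ p => t * polytropicEnergy p₀ t x u ρ p - 1 / 2 * ρ * inner ℝ u x

/-- `t² E - t ρ u·x + ½ρ|x|²`. -/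
def dilationalEnergy (p₀ : ℝ) : KinematicFunction n :=
  fun t x u ρ p => t ^ 2 * polytropicEnergy p₀ t x u ρ p - t * ρ * inner ℝ u x
    + 1 / 2 * ρ * ‖x‖ ^ 2

end Densities

/-- On `Ω`, `T` is a linear combination of mass, momentum, angular momentum, Galilean momentum,
energy (formed with `e`) and volumetric entropy (formed with some solution `S` of the entropy
equation), up to a trivial density `c(t, x)`, which does not involve the fluid variables.
If the energy occurs, then `e` has to solve the thermodynamic energy equation. -/
def IsBasicCombination {n : ℕ} (F : ℝ × ℝ → ℝ) (Ω : Set (ℝ × ℝ)) (e : ℝ × ℝ → ℝ)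
    (T : KinematicFunction n) : Prop :=
  ∃ (m : ℝ) (a : Fin n → ℝ) (A : Fin n → Fin n → ℝ) (g : Fin n → ℝ) (b : ℝ)
    (S : ℝ × ℝ → ℝ) (c : ℝ × Space n → ℝ),
    (b ≠ 0 → IsInternalEnergy F Ω e) ∧ IsEntropy F Ω S ∧ ContDiff ℝ ∞ c ∧
    ∀ (t : ℝ) (x u : Space n) (ρ p : ℝ), (p, ρ) ∈ Ω →
      T t x u ρ p =
        m * mass t x u ρ p
        + ∑ i, a i * momentum i t x u ρ p
        + ∑ i, ∑ j, A i j * angularMomentum i j t x u ρ p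
        + ∑ i, g i * galileanMomentum i t x u ρ p
        + b * energy e t x u ρ p
        + volumetricEntropy S t x u ρ p
        + c (t, x)

/-- On `Ω`, `F = γ(p - p₀)` with `γ = 1 + 2/n`. -/
def IsSpecialPolytropic (n : ℕ) (F : ℝ × ℝ → ℝ) (Ω : Set (ℝ × ℝ)) (p₀ : ℝ) : Prop :=
  ∀ p ρ : ℝ, (p, ρ) ∈ Ω → F (p, ρ) = (1 + 2 / (n : ℝ)) * (p - p₀)

end GasDynamics

end

/-! Write `z = (u, ρ, p)` and let `T` be a conserved density. On solutions `D_t T = B(t,x,z) + Σ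
a_i^A(t,x,z) ∂_i z^A` is affine in the spatial gradient. Being minus a divergence, it has the same
integral for any two fields that agree off a compact set, whatever the order of the flux
(`integral_totalTimeDeriv_sub_eq_zero`). It is thus a null Lagrangian, and its Euler–Lagrange
equations `∂_A a_i^B = ∂_B a_i^A` and `∂_A B = Σ ∂_{x_i} a_i^A` hold identically (`null_lagrangian`,
`IsConservedDensity.isNull`).

These determining equations are solved as identities in an algebra with commuting derivations. Those
in the fluid variables make `ρ T_ρ + F T_p - T` a function of `t, x, p`, and the specific momentum
`ν = T_u / ρ` equal to `β u + μ` with `β, μ` functions of `(t, x)`. This uses `n > 1` and the fact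
that `F` is not a zero divisor. The remaining equations give `∇β = 0`, the conformal Killing
equation `∂_k ν_j + ∂_j ν_k = -β_t δ_jk`, `ν_xx = 0`, `μ_tt = 0` and `β_ttt = 0`. The trace of the
Killing equation yields `2 T_pt = n β_t`. Differentiating `∂_t (ρ T_ρ + F T_p - T)` in `ρ` and `p`
then gives `β_t F_ρ = 0` and `n β_t F_p = (n + 2) β_t`. So either `β_t = 0` or `F = (1 + 2/n)(p -
p₀)` (`exists_isSpecialPolytropic`).

If `β_t = 0`, then `ν` is affine in `(t, x, u)` with antisymmetric `x`-gradient. Its coefficients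
are those of energy, momentum, angular momentum and Galilean momentum, and what is left of `T`
separates into a function of `(p, ρ)` and one of `(t, x)` (`IsConservedDensity.hasNormalForm`). For
the special `F`, `β` is quadratic in `t`, and subtracting multiples of the similarity and dilational
energies reduces to this case.

Conversely, a density with specific momentum `β u + μ` has the explicit flux `(T + β π) u + π μ`,
where `π` is the pressure up to a constant (`StateRing.isFlux_of_momentum`). A trivial density is
conserved because `c_t` has a primitive in one space coordinate. -/

noncomputable section

namespace GasDynamics

/-! ### The differential algebra of smooth functions on an open set -/

section SmoothAlgebra

/-- Extension by zero of a function on a subset. -/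
def extendZero {Z : Type*} {D : Set Z} (f : D → ℝ) (q : Z) : ℝ :=
  open Classical in if h : q ∈ D then f ⟨q, h⟩ else 0

lemma extendZero_of_mem {Z : Type*} {D : Set Z} (f : D → ℝ) {q : Z} (h : q ∈ D) :
    extendZero f q = f ⟨q, h⟩ := by
  simp [extendZero, h]

variable {Z : Type*} [NormedAddCommGroup Z] [NormedSpace ℝ Z]

/-- The smooth functions on a subset `D`, as a subalgebra of all functions on `D`. -/
def smoothAlgebra (D : Set Z) : Subalgebra ℝ (D → ℝ) where
  -- Elements are functions on the subtype, so equality in the algebra is equality on `D` alone. The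
  -- extension by zero only gives `fderiv` something to act on; its values off `D` do not matter
  -- once `D` is open.
  carrier := {f | ContDiffOn ℝ ∞ (extendZero f) D}
  mul_mem' {f g} hf hg := (ContDiffOn.mul hf hg).congr fun q hq => by
    simp [extendZero_of_mem _ hq]
  add_mem' {f g} hf hg := (ContDiffOn.add hf hg).congr fun q hq => by
    simp [extendZero_of_mem _ hq]
  algebraMap_mem' r := (contDiffOn_const (c := r)).congr fun q hq => by
    simp [extendZero_of_mem _ hq]

variable {D : Set Z}

/-- The restriction to `D` of a function which is smooth on `D`. -/
def restrictSmooth (f : Z → ℝ) (hf : ContDiffOn ℝ ∞ f D) : smoothAlgebra D :=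
  ⟨fun q => f q, hf.congr fun q hq => by simp [extendZero_of_mem _ hq]⟩

@[simp] lemma restrictSmooth_apply (f : Z → ℝ) (hf : ContDiffOn ℝ ∞ f D) (q : D) :
    (restrictSmooth f hf).1 q = f q := rfl

lemma smoothAlgebra_contDiffOn (f : smoothAlgebra D) : ContDiffOn ℝ ∞ (extendZero f.1) D := f.2

lemma smoothAlgebra_differentiableAt (hD : IsOpen D) (f : smoothAlgebra D) (q : D) :
    DifferentiableAt ℝ (extendZero f.1) q :=
  (f.2.contDiffAt (hD.mem_nhds q.2)).differentiableAt (by simp)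

lemma contDiffOn_fderiv_apply (hD : IsOpen D) {f : Z → ℝ} (hf : ContDiffOn ℝ ∞ f D) (v : Z) :
    ContDiffOn ℝ ∞ (fun q => fderiv ℝ f q v) D :=
  (hf.fderiv_of_isOpen hD (by simp)).clm_apply contDiffOn_const

/-- The derivative of a smooth function in a constant direction. -/
def smoothDeriv (hD : IsOpen D) (v : Z) : Derivation ℝ (smoothAlgebra D) (smoothAlgebra D) where
  toFun f := restrictSmooth (fun q => fderiv ℝ (extendZero f.1) q v)
    (contDiffOn_fderiv_apply hD f.2 v)
  map_add' f g := by
    ext q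
    have : extendZero (f + g).1 =ᶠ[nhds q.1] extendZero f.1 + extendZero g.1 := by
      filter_upwards [hD.mem_nhds q.2] with y hy
      simp [extendZero_of_mem _ hy]
    simp only [restrictSmooth_apply, Subalgebra.coe_add, Pi.add_apply]
    rw [← Subalgebra.coe_add, this.fderiv_eq, fderiv_add (smoothAlgebra_differentiableAt hD f q)
      (smoothAlgebra_differentiableAt hD g q)]
    rfl
  map_smul' c f := by
    ext q
    have : extendZero (c • f).1 =ᶠ[nhds q.1] c • extendZero f.1 := by
      filter_upwards [hD.mem_nhds q.2] with y hy
      simp [extendZero_of_mem _ hy]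
    simp only [restrictSmooth_apply, RingHom.id_apply]
    rw [this.fderiv_eq, fderiv_const_smul (smoothAlgebra_differentiableAt hD f q)]
    rfl
  map_one_eq_zero' := by
    ext q
    have : extendZero (1 : smoothAlgebra D).1 =ᶠ[nhds q.1] fun _ => (1 : ℝ) := by
      filter_upwards [hD.mem_nhds q.2] with y hy
      simp [extendZero_of_mem _ hy]
    simp only [LinearMap.coe_mk, AddHom.coe_mk, restrictSmooth_apply]
    rw [this.fderiv_eq]
    simp
  leibniz' f g := by
    ext q
    have : extendZero (f * g).1 =ᶠ[nhds q.1] extendZero f.1 * extendZero g.1 := by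
      filter_upwards [hD.mem_nhds q.2] with y hy
      simp [extendZero_of_mem _ hy]
    simp only [LinearMap.coe_mk, AddHom.coe_mk, restrictSmooth_apply]
    rw [this.fderiv_eq, fderiv_mul (smoothAlgebra_differentiableAt hD f q)
      (smoothAlgebra_differentiableAt hD g q)]
    simp [extendZero_of_mem _ q.2]

lemma smoothDeriv_apply (hD : IsOpen D) (v : Z) (f : smoothAlgebra D) (q : D) :
    (smoothDeriv hD v f).1 q = fderiv ℝ (extendZero f.1) q v := rfl

lemma smoothDeriv_restrictSmooth (hD : IsOpen D) (v : Z) {f : Z → ℝ} (hf : ContDiffOn ℝ ∞ f D) :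
    smoothDeriv hD v (restrictSmooth f hf) =
      restrictSmooth (fun q => fderiv ℝ f q v) (contDiffOn_fderiv_apply hD hf v) := by
  ext q
  have : extendZero (restrictSmooth f hf).1 =ᶠ[nhds q.1] f := by
    filter_upwards [hD.mem_nhds q.2] with y hy
    simp [extendZero_of_mem _ hy]
  rw [smoothDeriv_apply, this.fderiv_eq, restrictSmooth_apply]

lemma restrictSmooth_extendZero (f : smoothAlgebra D) : 
    restrictSmooth (extendZero f.1) (smoothAlgebra_contDiffOn f) = f := by
  ext q
  simp [extendZero_of_mem _ q.2]

lemma smoothDeriv_comm (hD : IsOpen D) (v w : Z) (f : smoothAlgebra D) :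
    smoothDeriv hD v (smoothDeriv hD w f) = smoothDeriv hD w (smoothDeriv hD v f) := by
  ext q
  rw [← restrictSmooth_extendZero f, smoothDeriv_restrictSmooth, smoothDeriv_restrictSmooth,
    smoothDeriv_restrictSmooth, smoothDeriv_restrictSmooth, restrictSmooth_apply,
    restrictSmooth_apply]
  have h2 : ContDiffAt ℝ 2 (extendZero f.1) q :=
    ((smoothAlgebra_contDiffOn f).contDiffAt (hD.mem_nhds q.2)).of_le ENat.LEInfty.out
  have hd : DifferentiableAt ℝ (fderiv ℝ (extendZero f.1)) q :=
    (h2.fderiv_right (m := 1) (by norm_num)).differentiableAt (by simp)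
  rw [fderiv_clm_apply hd (by fun_prop), fderiv_clm_apply hd (by fun_prop)]
  have hs := h2.isSymmSndFDerivAt (by simp)
  simpa using hs v w

/-- On a connected open set, a smooth function all of whose derivatives vanish is constant. -/
lemma smoothAlgebra_const (hD : IsOpen D) (hc : IsPreconnected D) (f : smoothAlgebra D)
    (h : ∀ v, smoothDeriv hD v f = 0) (q q' : D) : f.1 q = f.1 q' := by
  have := hD.is_const_of_fderiv_eq_zero hc (f.2.differentiableOn (by simp))
    (fun x hx => by
      ext v
      have := congrArg (fun g : smoothAlgebra D => g.1 ⟨x, hx⟩) (h v)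
      simpa [smoothDeriv_apply] using this) q.2 q'.2
  simpa [extendZero_of_mem _ q.2, extendZero_of_mem _ q'.2] using this

end SmoothAlgebra

/-! ### The determining equations as identities in a differential ring -/

/-- The coordinate directions of the space of `(t, x, u, ρ, p)`. -/
inductive Direction (n : ℕ) : Type
  | t : Direction n
  | x (i : Fin n) : Direction n
  | u (i : Fin n) : Direction n
  | r : Direction n
  | p : Direction n

/-- A ring with commuting derivations modelled on the smooth functions of `(t, x, u, ρ, p)`,
containing the velocity components, an invertible density and a state function of `(ρ, p)`. -/
structure StateRing (n : ℕ) (A : Type*) [CommRing A] [Algebra ℝ A] where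
  D : Direction n → Derivation ℝ A A
  comm : ∀ a b f, D a (D b f) = D b (D a f)
  u : Fin n → A
  r : A
  rinv : A
  F : A
  r_mul_rinv : r * rinv = 1
  D_t_u : ∀ j, D .t (u j) = 0
  D_x_u : ∀ i j, D (.x i) (u j) = 0
  D_u_u : ∀ i j, D (.u i) (u j) = if i = j then 1 else 0
  D_r_u : ∀ j, D .r (u j) = 0
  D_p_u : ∀ j, D .p (u j) = 0
  D_t_r : D .t r = 0
  D_x_r : ∀ i, D (.x i) r = 0
  D_u_r : ∀ i, D (.u i) r = 0
  D_r_r : D .r r = 1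
  D_p_r : D .p r = 0
  D_t_F : D .t F = 0
  D_x_F : ∀ i, D (.x i) F = 0
  D_u_F : ∀ i, D (.u i) F = 0
  -- `F` may vanish at points and need not be invertible. Not vanishing identically on any open set,
  -- it is still a non-zero-divisor.
  F_mul : ∀ f, F * f = 0 → f = 0

namespace StateRing

variable {n : ℕ} {A : Type*} [CommRing A] [Algebra ℝ A] (S : StateRing n A)

attribute [simp] D_t_u D_x_u D_u_u D_r_u D_p_u D_t_r D_x_r D_u_r D_r_r D_p_r D_t_F D_x_F D_u_F

lemma D_rinv (a : Direction n) : S.D a S.rinv = -S.rinv ^ 2 * S.D a S.r := by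
  have h := congrArg (S.D a) S.r_mul_rinv
  simp only [Derivation.leibniz, smul_eq_mul, Derivation.map_one_eq_zero] at h
  linear_combination S.rinv * h - S.D a S.rinv * S.r_mul_rinv

lemma r_mul_cancel {f : A} (h : S.r * f = 0) : f = 0 := by
  linear_combination S.rinv * h - f * S.r_mul_rinv

/-- `ρ G_ρ + F G_p`. -/
def thermal (G : A) : A := S.r * S.D .r G + S.F * S.D .p G

/-- The coefficient of `∂ᵢuʲ` in the total time derivative of `G`. -/
def coeffU (G : A) (i j : Fin n) : A :=
  -(S.u i * S.D (.u j) G) - if i = j then S.thermal G else 0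

/-- The coefficient of `∂ᵢρ` in the total time derivative of `G`. -/
def coeffR (G : A) (i : Fin n) : A := -(S.u i * S.D .r G)

/-- The coefficient of `∂ᵢp` in the total time derivative of `G`. -/
def coeffP (G : A) (i : Fin n) : A := -(S.u i * S.D .p G) - S.rinv * S.D (.u i) G

/-- The Euler–Lagrange equations of the total time derivative of `G`. -/
structure IsNull (G : A) : Prop where
  rp : ∀ i, S.D .p (S.coeffR G i) = S.D .r (S.coeffP G i)
  ur : ∀ i j, S.D .r (S.coeffU G i j) = S.D (.u j) (S.coeffR G i)
  up : ∀ i j, S.D .p (S.coeffU G i j) = S.D (.u j) (S.coeffP G i)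
  uu : ∀ i j k, S.D (.u k) (S.coeffU G i j) = S.D (.u j) (S.coeffU G i k)
  tr : S.D .r (S.D .t G) = ∑ i, S.D (.x i) (S.coeffR G i)
  tu : ∀ j, S.D (.u j) (S.D .t G) = ∑ i, S.D (.x i) (S.coeffU G i j)
  tp : S.D .p (S.D .t G) = ∑ i, S.D (.x i) (S.coeffP G i)

/-- `ρ G_ρ + F G_p - G`. -/
def legendre (G : A) : A := S.thermal G - G

/-- The coefficient of `½ρ|u|²`. -/
def energyCoeff (G : A) : A := S.D .p (S.legendre G)

/-- The specific momentum `G_u / ρ`. -/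
def specificMomentum (G : A) (j : Fin n) : A := S.rinv * S.D (.u j) G

lemma eq_zero_of_two_mul {f : A} (h : 2 * f = 0) : f = 0 := by
  have : f = (1 / 2 : ℝ) • (2 * f) := by rw [two_mul]; module
  rw [this, h, smul_zero]

lemma eq_zero_of_three_mul {f : A} (h : 3 * f = 0) : f = 0 := by
  have : f = (1 / 3 : ℝ) • (3 * f) := by
    rw [show (3 : A) * f = f + f + f by ring]; module
  rw [this, h, smul_zero]

/-! ### Dependence on velocity, density and pressure -/

variable {S} {G : A} (h : S.IsNull G)
include h

/-- In the `ρ`–`p` equation the transport terms `uⁱ G_{ρp}` cancel. What remains is that the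
pressure-force coefficient `G_u / ρ` is independent of `ρ`. -/
lemma IsNull.r_mul_D_r_u (i : Fin n) : S.r * S.D .r (S.D (.u i) G) = S.D (.u i) G := by
  have := h.rp i
  simp only [coeffR, coeffP, map_neg, map_sub, Derivation.leibniz, smul_eq_mul, D_rinv,
    D_p_u, D_r_u, D_r_r] at this
  rw [S.comm .p .r] at this
  linear_combination S.r ^ 2 * this + (S.D (.u i) G * (S.r * S.rinv + 1)
    - S.r * S.D .r (S.D (.u i) G)) * S.r_mul_rinv

/-- Compare the coefficients of `∂ₖuʲ` and `∂ₖuᵏ` for `k ≠ j`: only the second contains the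
divergence, and with it `thermal G`. The existence of such a `k` is where a second space dimension
is used. -/
lemma IsNull.thermal_u (hn : 1 < n) (j : Fin n) : S.D (.u j) (S.thermal G) = S.D (.u j) G := by
  have : Nontrivial (Fin n) := Fin.nontrivial_iff_two_le.2 hn
  obtain ⟨k, hk⟩ := exists_ne j
  have := h.uu k j k
  simp only [coeffU, map_neg, map_sub, Derivation.leibniz, smul_eq_mul, D_u_u, if_neg hk,
    if_neg hk.symm, if_true, map_zero] at this
  rw [S.comm (.u k) (.u j)] at this
  linear_combination this

/-- The diagonal `u`–`ρ` equation. Together with `IsNull.thermal_u` it leaves `legendre G` no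
dependence on `u` and `ρ`. -/
lemma IsNull.thermal_r (hn : 1 < n) : S.D .r (S.thermal G) = S.D .r G := by
  have := h.ur ⟨0, by omega⟩ ⟨0, by omega⟩
  simp only [coeffU, coeffR, map_neg, map_sub, Derivation.leibniz, smul_eq_mul, D_u_u, if_true,
    D_r_u] at this
  rw [S.comm .r (.u _)] at this
  linear_combination -this

/-- The transport terms of the `u`–`p` equation cancel, and the diagonal retains `∂_p (thermal G) -
G_p`, which is `energyCoeff G`, called `β` below. -/
lemma IsNull.D_u_u (i j : Fin n) :
    S.D (.u j) (S.D (.u i) G) = if i = j then S.r * S.energyCoeff G else 0 := by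
  have := h.up i j
  simp only [coeffU, coeffP, map_neg, map_sub, Derivation.leibniz, smul_eq_mul, StateRing.D_u_u,
    D_p_u, D_rinv, D_u_r] at this
  rw [S.comm .p (.u j)] at this
  simp only [energyCoeff, legendre, map_sub]
  by_cases hij : i = j
  · subst hij
    simp only [if_true] at this ⊢
    linear_combination S.r * this - S.D (.u i) (S.D (.u i) G) * S.r_mul_rinv
  · simp only [if_neg hij, if_neg (Ne.symm hij), map_zero] at this ⊢
    linear_combination S.r * this - S.D (.u j) (S.D (.u i) G) * S.r_mul_rinv

lemma IsNull.legendre_u (hn : 1 < n) (j : Fin n) : S.D (.u j) (S.legendre G) = 0 := by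
  simp [legendre, h.thermal_u hn]

lemma IsNull.legendre_r (hn : 1 < n) : S.D .r (S.legendre G) = 0 := by
  simp [legendre, h.thermal_r hn]

/-- Subtracting `IsNull.r_mul_D_r_u` from `IsNull.thermal_u` leaves `F G_{pu} = 0`, and `F` is not a
zero divisor. -/
lemma IsNull.D_p_u (hn : 1 < n) (j : Fin n) : S.D .p (S.D (.u j) G) = 0 := by
  apply S.F_mul
  have := h.thermal_u hn j
  simp only [thermal, map_add, Derivation.leibniz, smul_eq_mul, D_u_r, D_u_F] at this
  rw [S.comm (.u j) .r, S.comm (.u j) .p] at this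
  linear_combination this - h.r_mul_D_r_u j

lemma IsNull.energyCoeff_u (hn : 1 < n) (j : Fin n) : S.D (.u j) (S.energyCoeff G) = 0 := by
  rw [energyCoeff, S.comm, h.legendre_u hn, map_zero]

lemma IsNull.energyCoeff_r (hn : 1 < n) : S.D .r (S.energyCoeff G) = 0 := by
  rw [energyCoeff, S.comm, h.legendre_r hn, map_zero]

/-- The diagonal Hessian in `u` is `ρ β`, while `G_u` is independent of `p`. -/
lemma IsNull.energyCoeff_p (hn : 1 < n) : S.D .p (S.energyCoeff G) = 0 := by
  apply S.r_mul_cancel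
  have := congrArg (S.D .p) (h.D_u_u ⟨0, by omega⟩ ⟨0, by omega⟩)
  rw [S.comm .p (.u _), h.D_p_u hn] at this
  simp only [if_true, Derivation.leibniz, smul_eq_mul, D_p_r, map_zero] at this
  linear_combination -this

lemma IsNull.momentum_r (j : Fin n) : S.D .r (S.specificMomentum G j) = 0 := by
  simp only [specificMomentum, Derivation.leibniz, smul_eq_mul, D_rinv, D_r_r]
  linear_combination S.rinv ^ 2 * h.r_mul_D_r_u j
    - S.rinv * S.D .r (S.D (.u j) G) * S.r_mul_rinv

lemma IsNull.momentum_p (hn : 1 < n) (j : Fin n) : S.D .p (S.specificMomentum G j) = 0 := by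
  simp [specificMomentum, D_rinv, h.D_p_u hn]

/-- With the independence of `ρ` and `p`, this is the structure `ν = β u + μ` of the specific
momentum, where `β` and `μ` do not involve the fluid variables. -/
lemma IsNull.momentum_u (i j : Fin n) : S.D (.u i) (S.specificMomentum G j) =
    if j = i then S.energyCoeff G else 0 := by
  simp only [specificMomentum, Derivation.leibniz, smul_eq_mul, D_rinv, D_u_r, h.D_u_u]
  split_ifs
  · linear_combination S.energyCoeff G * S.r_mul_rinv
  · simp

omit h in
lemma D_u_eq (j : Fin n) : S.D (.u j) G = S.r * S.specificMomentum G j := by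
  rw [specificMomentum]
  linear_combination -S.D (.u j) G * S.r_mul_rinv

/-! ### Dependence on time and space -/

lemma IsNull.D_r_t : S.D .r (S.D .t G) = -∑ i, S.u i * S.D .r (S.D (.x i) G) := by
  rw [h.tr, ← Finset.sum_neg_distrib]
  refine Finset.sum_congr rfl fun i _ => ?_
  simp only [coeffR, map_neg, Derivation.leibniz, smul_eq_mul, D_x_u, S.comm (.x i) .r]
  ring

/-- The `u`-derivative of the density equation. -/
lemma IsNull.D_r_x (j : Fin n) : S.D .r (S.D (.x j) G) =
    -S.D .t (S.specificMomentum G j)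
      - ∑ i, S.u i * S.D (.x i) (S.specificMomentum G j) := by
  have := congrArg (S.D (.u j)) h.D_r_t
  simp only [map_neg, map_sum, Derivation.leibniz, smul_eq_mul, StateRing.D_u_u,
    Finset.sum_add_distrib, mul_ite, mul_one, mul_zero, Finset.sum_ite_eq,
    Finset.mem_univ, if_true] at this
  have e : ∀ a, S.D (.u j) (S.D .r (S.D a G)) = S.D a (S.specificMomentum G j) := by
    intro a
    rw [S.comm (.u j) .r, S.comm (.u j) a, S.comm .r a, D_u_eq (S := S) (G := G) j]
    simp [h.momentum_r]
  simp only [e] at this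
  linear_combination this

/-- The conformal Killing equation together with the vanishing of `∇β`. -/
lemma IsNull.momentum_x_symm_aux (j k : Fin n) :
    S.D (.x k) (S.specificMomentum G j) + S.D (.x j) (S.specificMomentum G k) =
      if j = k then -S.D .t (S.energyCoeff G) - ∑ i, S.u i * S.D (.x i) (S.energyCoeff G)
      else 0 := by
  have := congrArg (S.D (.u k)) (h.D_r_x j)
  rw [S.comm (.u k) .r, S.comm (.u k) (.x j), S.comm .r (.x j), D_u_eq (S := S) (G := G) k] at this
  simp only [map_neg, map_sub, map_sum, Derivation.leibniz, smul_eq_mul, StateRing.D_u_u,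
    Finset.sum_add_distrib, mul_ite, mul_one, mul_zero, Finset.sum_ite_eq,
    Finset.mem_univ, if_true, h.momentum_r, D_r_r, zero_add,
    S.comm (.u k) .t, S.comm (.u k) (.x _), h.momentum_u] at this
  by_cases hjk : j = k
  · simp only [if_pos hjk] at this ⊢
    linear_combination this
  · simp only [if_neg hjk, map_zero, mul_zero, Finset.sum_const_zero] at this ⊢
    linear_combination this

/-- Differentiating the diagonal Killing equation in `uʲ` gives `2 β_{x_j}` on the left and
`-β_{x_j}` on the right. -/
lemma IsNull.energyCoeff_x (hn : 1 < n) (j : Fin n) : S.D (.x j) (S.energyCoeff G) = 0 := by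
  apply eq_zero_of_three_mul
  have := congrArg (S.D (.u j)) (h.momentum_x_symm_aux j j)
  simp only [map_add, map_neg, map_sub, map_sum, Derivation.leibniz, smul_eq_mul,
    StateRing.D_u_u, Finset.sum_add_distrib, mul_ite, mul_one, mul_zero, Finset.sum_ite_eq,
    Finset.mem_univ, if_true, S.comm (.u j) .t, S.comm (.u j) (.x _), h.momentum_u,
    h.energyCoeff_u hn, map_zero, Finset.sum_const_zero] at this
  linear_combination this

lemma IsNull.momentum_x_symm (hn : 1 < n) (j k : Fin n) :
    S.D (.x k) (S.specificMomentum G j) + S.D (.x j) (S.specificMomentum G k) =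
      if j = k then -S.D .t (S.energyCoeff G) else 0 := by
  simp [h.momentum_x_symm_aux, h.energyCoeff_x hn]

/-- The classical Killing argument: since `∇β = 0`, these second derivatives are antisymmetric in
the component and a derivative index but symmetric in the two derivative indices. -/
lemma IsNull.momentum_x_x (hn : 1 < n) (j k l : Fin n) :
    S.D (.x l) (S.D (.x k) (S.specificMomentum G j)) = 0 := by
  have key : ∀ a b c : Fin n, S.D (.x c) (S.D (.x b) (S.specificMomentum G a))
      + S.D (.x c) (S.D (.x a) (S.specificMomentum G b)) = 0 := by
    intro a b c
    rw [← map_add, h.momentum_x_symm hn]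
    split_ifs
    · rw [map_neg, S.comm, h.energyCoeff_x hn, map_zero, neg_zero]
    · simp
  apply eq_zero_of_two_mul
  have h1 := key j k l
  have h2 := key k l j
  have h3 := key l j k
  rw [S.comm (.x j) (.x l), S.comm (.x j) (.x k)] at h2
  rw [S.comm (.x k) (.x l)] at h3
  linear_combination h1 - h2 + h3

/-- Symmetry of `G_{ρ x_j x_k}` makes `ν_t` curl-free, and the time derivative of the Killing
equation supplies the symmetric part of its gradient. -/
lemma IsNull.momentum_t_x (hn : 1 < n) (j k : Fin n) :
    2 * S.D (.x k) (S.D .t (S.specificMomentum G j)) =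
      if j = k then -S.D .t (S.D .t (S.energyCoeff G)) else 0 := by
  have e : ∀ a b : Fin n, S.D (.x a) (S.D .r (S.D (.x b) G)) =
      -S.D (.x a) (S.D .t (S.specificMomentum G b)) := by
    intro a b
    simp [h.D_r_x, h.momentum_x_x hn]
  have s : S.D (.x k) (S.D .t (S.specificMomentum G j)) =
      S.D (.x j) (S.D .t (S.specificMomentum G k)) := by
    have h1 := e k j
    have h2 := e j k
    rw [S.comm (.x k) .r, S.comm (.x k) (.x j), S.comm .r (.x j)] at h1
    linear_combination h1 - h2
  have h3 := congrArg (S.D .t) (h.momentum_x_symm hn j k)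
  rw [map_add, S.comm .t, S.comm .t] at h3
  rw [two_mul]
  nth_rewrite 2 [s]
  rw [h3]
  split_ifs <;> simp

/-- Inserting `G_{ρx}` into `G_{ρt}` produces the quadratic form `Σ uⁱ uʲ ∂ᵢνⱼ`, which sees only the
symmetric part of the gradient and so equals `-½ β_t |u|²`. -/
lemma IsNull.D_r_t_eq (hn : 1 < n) : 2 * S.D .r (S.D .t G) =
    2 * ∑ j, S.u j * S.D .t (S.specificMomentum G j)
      - S.D .t (S.energyCoeff G) * ∑ j, S.u j ^ 2 := by
  have e : ∑ j, S.u j * ∑ i, S.u i * S.D (.x i) (S.specificMomentum G j)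
      + ∑ j, S.u j * ∑ i, S.u i * S.D (.x i) (S.specificMomentum G j) =
      -S.D .t (S.energyCoeff G) * ∑ j, S.u j ^ 2 := by
    simp only [Finset.mul_sum]
    nth_rewrite 2 [Finset.sum_comm]
    simp only [← Finset.sum_add_distrib]
    refine Finset.sum_congr rfl fun j _ => ?_
    have : ∀ i, S.u j * (S.u i * S.D (.x i) (S.specificMomentum G j))
        + S.u i * (S.u j * S.D (.x j) (S.specificMomentum G i)) =
        if j = i then -S.D .t (S.energyCoeff G) * S.u i ^ 2 else 0 := by
      intro i
      have := h.momentum_x_symm hn j i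
      by_cases hij : j = i
      · subst hij
        simp only [if_true] at this ⊢
        linear_combination S.u j ^ 2 * this
      · simp only [if_neg hij] at this ⊢
        linear_combination S.u i * S.u j * this
    simp [this]
  rw [h.D_r_t]
  simp only [h.D_r_x, mul_sub, mul_neg, Finset.sum_sub_distrib, Finset.sum_neg_distrib]
  linear_combination e

/-- Two evaluations of `G_{ρ t x_j}` are compared, one from `IsNull.D_r_x` and one from
`IsNull.D_r_t_eq`. For `ν = β u + μ` the outcome is `μ_tt = 0`. -/
lemma IsNull.momentum_t_t (hn : 1 < n) (j : Fin n) :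
    S.D .t (S.D .t (S.specificMomentum G j)) =
      S.D .t (S.D .t (S.energyCoeff G)) * S.u j := by
  apply sub_eq_zero.1
  apply eq_zero_of_two_mul
  have h1 := congrArg (S.D .t) (h.D_r_x j)
  have h2 := congrArg (S.D (.x j)) (h.D_r_t_eq hn)
  rw [S.comm .t .r, S.comm .t (.x j)] at h1
  have e2 := fun i => h.momentum_t_x hn i j
  have e1 : ∀ i, 2 * S.D .t (S.D (.x i) (S.specificMomentum G j)) =
      if j = i then -S.D .t (S.D .t (S.energyCoeff G)) else 0 :=
    fun i => by rw [S.comm .t]; exact h.momentum_t_x hn j i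
  have z : S.D (.x j) (2 : A) = 0 := by exact_mod_cast (S.D (.x j)).map_natCast 2
  simp only [map_sub, map_neg, map_sum, Derivation.leibniz, smul_eq_mul, D_t_u, D_x_u, z,
    mul_zero, add_zero, Finset.sum_const_zero, S.comm (.x j) .t (S.energyCoeff G),
    h.energyCoeff_x hn, map_zero, Derivation.leibniz_pow, smul_zero, S.comm (.x j) .r] at h1 h2
  have h1' := congrArg (2 * ·) h1
  simp only [mul_sub, Finset.mul_sum, mul_neg, mul_left_comm (2 : A), e1, e2, mul_ite, mul_zero,
    Finset.sum_ite_eq, Finset.sum_ite_eq', Finset.mem_univ, if_true] at h1' h2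
  linear_combination h1' - h2

/-- `ν_tt` is independent of `x`, whereas the diagonal of the `x`-gradient of `ν_t` is `-½ β_tt`. -/
lemma IsNull.energyCoeff_t_t_t (hn : 1 < n) :
    S.D .t (S.D .t (S.D .t (S.energyCoeff G))) = 0 := by
  set j : Fin n := ⟨0, by omega⟩
  have h1 := congrArg (S.D .t) (h.momentum_t_x hn j j)
  have h2 := congrArg (S.D (.x j)) (h.momentum_t_t hn j)
  have z : S.D .t (2 : A) = 0 := by exact_mod_cast (S.D .t).map_natCast 2
  simp only [if_true, map_neg, Derivation.leibniz, smul_eq_mul, D_x_u, z, mul_zero,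
    add_zero, S.comm (.x j) .t, h.energyCoeff_x hn, map_zero] at h1 h2
  linear_combination h1 - 2 * h2

/-- The trace of the conformal Killing equation, `div ν = -(n/2) β_t`, enters here. It is the source
of the dimension in the exponent `1 + 2/n`. -/
lemma IsNull.D_p_t_aux (hn : 1 < n) : 2 * S.D .p (S.D .t G) =
    n * S.D .t (S.energyCoeff G) - 2 * ∑ i, S.u i * S.D .p (S.D (.x i) G) := by
  have e : ∀ i : Fin n, 2 * S.D (.x i) (S.specificMomentum G i) = -S.D .t (S.energyCoeff G) := by
    intro i
    have := h.momentum_x_symm hn i i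
    simp only [if_true] at this
    linear_combination this
  have e' : ∀ i, S.D (.x i) (S.coeffP G i) = -(S.u i * S.D .p (S.D (.x i) G))
      - S.D (.x i) (S.specificMomentum G i) := by
    intro i
    rw [coeffP, ← specificMomentum]
    simp only [map_neg, map_sub, Derivation.leibniz, smul_eq_mul, D_x_u, S.comm (.x i) .p]
    ring
  rw [h.tp]
  simp only [e', Finset.sum_sub_distrib, Finset.sum_neg_distrib, mul_sub, mul_neg]
  nth_rewrite 2 [Finset.mul_sum]
  simp only [e, Finset.sum_const, Finset.card_univ, Fintype.card_fin, nsmul_eq_mul]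
  ring

/-- A `uʲ`-derivative of `IsNull.D_p_t_aux` isolates this term, because `G_{pu} = 0` and `β` does
not depend on `u`. -/
lemma IsNull.D_p_x (hn : 1 < n) (j : Fin n) : S.D .p (S.D (.x j) G) = 0 := by
  apply eq_zero_of_two_mul
  have := congrArg (S.D (.u j)) (h.D_p_t_aux hn)
  have z : S.D (.u j) (2 : A) = 0 := by exact_mod_cast (S.D (.u j)).map_natCast 2
  have e : ∀ a, S.D (.u j) (S.D .p (S.D a G)) = 0 := by
    intro a
    rw [S.comm (.u j) .p, S.comm (.u j) a, S.comm .p a, h.D_p_u hn, map_zero]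
  simp only [map_sub, map_sum, Derivation.leibniz, smul_eq_mul, z, e, mul_zero, add_zero, zero_add,
    Derivation.map_natCast, S.comm (.u j) .t, h.energyCoeff_u hn, map_zero, StateRing.D_u_u,
    mul_ite, mul_one, Finset.sum_ite_eq, Finset.mem_univ, if_true] at this
  linear_combination this

lemma IsNull.D_p_t (hn : 1 < n) : 2 * S.D .p (S.D .t G) = n * S.D .t (S.energyCoeff G) := by
  simp [h.D_p_t_aux hn, h.D_p_x hn]

lemma IsNull.D_r_D_r_t (hn : 1 < n) : S.D .r (S.D .r (S.D .t G)) = 0 := by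
  apply eq_zero_of_two_mul
  have := congrArg (S.D .r) (h.D_r_t_eq hn)
  have z : S.D .r (2 : A) = 0 := by exact_mod_cast (S.D .r).map_natCast 2
  simp only [map_sub, map_sum, Derivation.leibniz, smul_eq_mul, z, mul_zero, add_zero,
    S.comm .r .t, h.momentum_r, h.energyCoeff_r hn, map_zero, D_r_u, Derivation.leibniz_pow,
    smul_zero, Finset.sum_const_zero, sub_zero] at this
  simp only [S.comm .r .t]
  exact this

/-! ### Constraints on the state function -/

omit h in
lemma legendre_t : S.D .t (S.legendre G) =
    S.r * S.D .r (S.D .t G) + S.F * S.D .p (S.D .t G) - S.D .t G := by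
  simp only [legendre, thermal, map_sub, map_add, Derivation.leibniz, smul_eq_mul, D_t_r, D_t_F,
    S.comm .t .r, S.comm .t .p]
  ring

/-- `legendre G` does not depend on `ρ`, so the `ρ`-derivative of `legendre_t` reduces to `F_ρ
G_{pt} = 0`, where `2 G_{pt} = n β_t`. -/
lemma IsNull.stateFunction_r (hn : 1 < n) : S.D .t (S.energyCoeff G) * S.D .r S.F = 0 := by
  have e := congrArg (S.D .r) (legendre_t (S := S) (G := G))
  have z : S.D .r (S.D .p (S.D .t G)) = 0 := by
    apply eq_zero_of_two_mul
    have := congrArg (S.D .r) (h.D_p_t hn)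
    have z : S.D .r (2 : A) = 0 := by exact_mod_cast (S.D .r).map_natCast 2
    simp only [Derivation.leibniz, smul_eq_mul, z, mul_zero, add_zero, Derivation.map_natCast,
      S.comm .r .t, h.energyCoeff_r hn, map_zero] at this
    exact this
  rw [S.comm .r .t, h.legendre_r hn] at e
  simp only [map_sub, map_add, Derivation.leibniz, smul_eq_mul, D_r_r, z, h.D_r_D_r_t hn,
    map_zero] at e
  have hn0 : ∀ f : A, (n : A) * f = 0 → f = 0 := by
    intro f hf
    have : f = (1 / n : ℝ) • ((n : A) * f) := by
      rw [← nsmul_eq_mul, ← Nat.cast_smul_eq_nsmul ℝ, smul_smul, one_div_mul_cancel, one_smul]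
      exact_mod_cast (by omega : n ≠ 0)
    rw [this, hf, smul_zero]
  apply hn0
  linear_combination -2 * e - S.D .r S.F * h.D_p_t hn

/-- The `p`-derivative of `legendre_t` reads `β_t = (F_p - 1) G_{pt}` with `2 G_{pt} = n β_t`. Where
`β_t ≠ 0` this means `F_p = 1 + 2/n`. -/
lemma IsNull.stateFunction_p (hn : 1 < n) : n * S.D .t (S.energyCoeff G) * S.D .p S.F =
    (n + 2) * S.D .t (S.energyCoeff G) := by
  have e := congrArg (S.D .p) (legendre_t (S := S) (G := G))
  have z : ∀ a, S.D a (S.energyCoeff G) = 0 → S.D a (S.D .p (S.D .t G)) = 0 := by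
    intro a ha
    apply eq_zero_of_two_mul
    have := congrArg (S.D a) (h.D_p_t hn)
    have z : S.D a (2 : A) = 0 := by exact_mod_cast (S.D a).map_natCast 2
    simp only [Derivation.leibniz, smul_eq_mul, z, mul_zero, add_zero, Derivation.map_natCast,
      S.comm a .t (S.energyCoeff G), ha, map_zero] at this
    exact this
  rw [S.comm .p .t] at e
  simp only [map_sub, map_add, Derivation.leibniz, smul_eq_mul, D_p_r, S.comm .p .r,
    z _ (h.energyCoeff_r hn), z _ (h.energyCoeff_p hn)] at e
  rw [← energyCoeff] at e
  linear_combination -2 * e + (1 - S.D .p S.F) * h.D_p_t hn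

end StateRing

/-! ### Null Lagrangians linear in the gradient -/

section NullLagrangian

open MeasureTheory Filter Topology

lemma integral_fderiv_apply_eq_zero {n : ℕ} {f : Space n → ℝ} (hf : ContDiff ℝ 1 f)
    (hc : HasCompactSupport f) (v : Space n) : ∫ x, fderiv ℝ f x v = 0 := by
  have hd : Continuous fun x => fderiv ℝ f x v :=
    (hf.continuous_fderiv (by simp)).clm_apply continuous_const
  have hdc : HasCompactSupport fun x => fderiv ℝ f x v := hc.fderiv_apply ℝ v
  have := integral_mul_fderiv_eq_neg_fderiv_mul_of_integrable (μ := (volume : Measure (Space n)))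
    (f := f) (g := fun _ => (1 : ℝ)) (v := v)
    (by simpa using hd.integrable_of_hasCompactSupport hdc) (by simp)
    (by simpa using hf.continuous.integrable_of_hasCompactSupport hc)
    (fun x _ => hf.differentiable (by simp) x) (fun x _ => by fun_prop)
  simpa using this

lemma integral_mul_fderiv_eq_neg {n : ℕ} {f g : Space n → ℝ} (hf : ContDiff ℝ 1 f)
    (hg : ContDiff ℝ 1 g) (hc : HasCompactSupport g) (v : Space n) :
    ∫ x, f x * fderiv ℝ g x v = -∫ x, fderiv ℝ f x v * g x := by
  have hdf : Continuous fun x => fderiv ℝ f x v :=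
    (hf.continuous_fderiv (by simp)).clm_apply continuous_const
  have hdg : Continuous fun x => fderiv ℝ g x v :=
    (hg.continuous_fderiv (by simp)).clm_apply continuous_const
  have hdc : HasCompactSupport fun x => fderiv ℝ g x v := hc.fderiv_apply ℝ v
  exact integral_mul_fderiv_eq_neg_fderiv_mul_of_integrable
    ((hdf.mul hg.continuous).integrable_of_hasCompactSupport hc.mul_left)
    ((hf.continuous.mul hdg).integrable_of_hasCompactSupport hdc.mul_left)
    ((hf.continuous.mul hg.continuous).integrable_of_hasCompactSupport hc.mul_left)
    (fun x _ => hf.differentiable (by simp) x) (fun x _ => hg.differentiable (by simp) x)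

variable {Z : Type*} [NormedAddCommGroup Z] [NormedSpace ℝ Z]

lemma continuous_comp_add_smul_mul {n : ℕ} {D : Set Z} {h : Z → ℝ} (hh : ContDiffOn ℝ ∞ h D)
    {q : Z} {w : Space n → Z} (hw : Continuous w) {φ : Space n → ℝ} (hφ : Continuous φ) {ε : ℝ}
    (hε : ∀ y, q + ε • w y ∈ D) : Continuous fun y => h (q + ε • w y) * φ y :=
  (hh.continuousOn.comp_continuous (by fun_prop) hε).mul hφ

/-- Differentiation under the integral sign. On the support of `φ` the function `w` is bounded, so
for small `ε` only values of `h` near `q` matter. There `h` is Lipschitz, which gives the dominating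
function `K |M| |φ|`. -/
lemma hasDerivAt_integral_comp_smul {n : ℕ} {D : Set Z} (hD : IsOpen D) {h : Z → ℝ}
    (hh : ContDiffOn ℝ ∞ h D) {q : Z} (hq : q ∈ D) {w : Space n → Z} (hw : Continuous w)
    {φ : Space n → ℝ} (hφ : Continuous φ) (hc : HasCompactSupport φ)
    (hev : ∀ᶠ ε : ℝ in 𝓝 0, ∀ y, q + ε • w y ∈ D) :
    HasDerivAt (fun ε : ℝ => ∫ y, h (q + ε • w y) * φ y) (∫ y, fderiv ℝ h q (w y) * φ y) 0 := by
  have hat : ContDiffAt ℝ 1 h q := (hh.contDiffAt (hD.mem_nhds hq)).of_le (by simp)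
  obtain ⟨K, t, ht, hK⟩ := hat.exists_lipschitzOnWith
  obtain ⟨M, hM⟩ := (hc.isCompact.image hw).isBounded.exists_norm_le
  have hM' : ∀ y, φ y ≠ 0 → ‖w y‖ ≤ |M| := fun y hy =>
    (hM _ ⟨y, subset_tsupport _ hy, rfl⟩).trans (le_abs_self M)
  obtain ⟨δ, hδ, hδt⟩ := Metric.mem_nhds_iff.1 ht
  have hdiff := hat.differentiableAt (by simp)
  refine (hasDerivAt_integral_of_dominated_loc_of_lip
    (s := Metric.ball 0 (δ / (|M| + 1))) (bound := fun y => K * |M| * |φ y|)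
    (Metric.ball_mem_nhds _ (by positivity)) ?_ ?_ ?_ ?_ ?_ ?_).2
  · filter_upwards [hev] with ε hε
    exact (continuous_comp_add_smul_mul hh hw hφ hε).aestronglyMeasurable
  · exact (continuous_comp_add_smul_mul hh hw hφ hev.self_of_nhds).integrable_of_hasCompactSupport
      hc.mul_left
  · exact (((fderiv ℝ h q).continuous.comp hw).mul hφ).aestronglyMeasurable
  · refine ae_of_all _ fun y => ?_
    by_cases hy : φ y = 0
    · simp [hy, LipschitzOnWith]
    · have hmem : ∀ ε ∈ Metric.ball (0 : ℝ) (δ / (|M| + 1)), q + ε • w y ∈ t := by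
        intro ε hε
        apply hδt
        rw [mem_ball_zero_iff, lt_div_iff₀ (by positivity)] at hε
        simp only [Metric.mem_ball, dist_self_add_left, norm_smul]
        calc ‖ε‖ * ‖w y‖ ≤ ‖ε‖ * (|M| + 1) := by
              gcongr
              exact (hM' y hy).trans (by linarith)
          _ < δ := hε
      refine LipschitzOnWith.of_dist_le_mul fun ε hε ε' hε' => ?_
      have h1 := hK.dist_le_mul _ (hmem ε hε) _ (hmem ε' hε')
      have h2 : dist (q + ε • w y) (q + ε' • w y) = dist ε ε' * ‖w y‖ := by
        rw [dist_add_left, dist_eq_norm, ← sub_smul, norm_smul, dist_eq_norm]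
      rw [h2] at h1
      have e : dist (h (q + ε • w y) * φ y) (h (q + ε' • w y) * φ y)
          = dist (h (q + ε • w y)) (h (q + ε' • w y)) * |φ y| := by
        rw [Real.dist_eq, Real.dist_eq, ← sub_mul, abs_mul]
      rw [e, Real.coe_nnabs, abs_of_nonneg (a := K * |M| * |φ y|) (by positivity)]
      calc dist (h (q + ε • w y)) (h (q + ε' • w y)) * |φ y|
          ≤ (K * (dist ε ε' * |M|)) * |φ y| := by
            gcongr
            exact h1.trans (by gcongr; exact hM' y hy)
        _ = _ := by ring
  · exact (continuous_const.mul hφ.abs).integrable_of_hasCompactSupport hc.norm.mul_left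
  · refine ae_of_all _ fun y => ?_
    refine HasDerivAt.mul_const ?_ _
    have h0 : HasFDerivAt h (fderiv ℝ h q) (q + (0 : ℝ) • w y) := by
      simpa using hdiff.hasFDerivAt
    have h1 : HasDerivAt (fun ε : ℝ => q + ε • w y) (w y) 0 := by
      simpa using ((hasDerivAt_id (0 : ℝ)).smul_const (w y)).const_add q
    exact h0.comp_hasDerivAt 0 h1

/-- A cutoff that allows the two zeroth-order terms of the action, which are not compactly supported
one by one, to be integrated and differentiated separately. -/
lemma exists_continuous_eq_one {n : ℕ} {f g : Space n → ℝ} (hf : HasCompactSupport f)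
    (hg : HasCompactSupport g) : ∃ χ : Space n → ℝ, Continuous χ ∧ HasCompactSupport χ ∧
      ∀ x, f x ≠ 0 ∨ g x ≠ 0 → χ x = 1 := by
  obtain ⟨R, hR⟩ := (hf.isCompact.union hg.isCompact).isBounded.subset_closedBall (0 : Space n)
  let χ : ContDiffBump (0 : Space n) := ⟨|R| + 1, |R| + 2, by positivity, by linarith⟩
  refine ⟨χ, χ.continuous, χ.hasCompactSupport, fun x hx => ?_⟩
  apply χ.one_of_mem_closedBall
  have : x ∈ tsupport f ∪ tsupport g :=
    hx.imp (fun h => subset_tsupport _ h) (fun h => subset_tsupport _ h)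
  exact Metric.closedBall_subset_closedBall (by linarith [le_abs_self R]) (hR this)

/-- The first order expansion of a vanishing action of a Lagrangian linear in the gradient, for
compactly supported two-component variations of a constant state. -/
lemma null_lagrangian_expansion {n : ℕ} {D : Set Z} (hD : IsOpen D) {q : Z} (hq : q ∈ D)
    (ι : Space n →L[ℝ] Z) (hι : ∀ z ∈ D, ∀ x, z + ι x ∈ D) (v v' : Z)
    {B : Z → ℝ} {a b : Fin n → Z → ℝ} (hB : ContDiffOn ℝ ∞ B D)
    (ha : ∀ i, ContDiffOn ℝ ∞ (a i) D) (hb : ∀ i, ContDiffOn ℝ ∞ (b i) D)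
    (H : ∀ f g : Space n → ℝ, ContDiff ℝ ∞ f → ContDiff ℝ ∞ g → HasCompactSupport f →
      HasCompactSupport g → (∀ x, q + ι x + f x • v + g x • v' ∈ D) →
      ∫ x, (B (q + ι x + f x • v + g x • v') - B (q + ι x)
        + ∑ i, (a i (q + ι x + f x • v + g x • v') * fderiv ℝ f x (EuclideanSpace.single i 1)
          + b i (q + ι x + f x • v + g x • v') * fderiv ℝ g x (EuclideanSpace.single i 1))) = 0)
    {f g : Space n → ℝ} (hf : ContDiff ℝ ∞ f) (hg : ContDiff ℝ ∞ g) (hfc : HasCompactSupport f)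
    (hgc : HasCompactSupport g) :
    (fderiv ℝ B q v - ∑ i, fderiv ℝ (a i) q (ι (EuclideanSpace.single i 1))) * (∫ x, f x)
    + (fderiv ℝ B q v' - ∑ i, fderiv ℝ (b i) q (ι (EuclideanSpace.single i 1))) * (∫ x, g x)
    + ∑ i, (fderiv ℝ (b i) q v - fderiv ℝ (a i) q v') *
        ∫ x, f x * fderiv ℝ g x (EuclideanSpace.single i 1) = 0 := by
  set e : Fin n → Space n := fun i => EuclideanSpace.single i 1 with he
  obtain ⟨χ, hχ, hχc, hχ1⟩ := exists_continuous_eq_one hfc hgc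
  -- The variations are replaced by `ε f(·/ε)` and `ε g(·/ε)`. In the variable `y = x/ε` the state
  -- becomes `q + ε • w y`, while the gradients are still those of `f` and `g`.
  set w : Space n → Z := fun y => ι y + f y • v + g y • v' with hw
  have hfco := hf.continuous
  have hgco := hg.continuous
  have hwc : Continuous w := by fun_prop
  obtain ⟨Cf, hCf⟩ := hfc.exists_bound_of_continuous hfco
  obtain ⟨Cg, hCg⟩ := hgc.exists_bound_of_continuous hgco
  have hdf : ∀ i, Continuous fun x => fderiv ℝ f x (e i) := fun i =>
    (hf.continuous_fderiv (by simp)).clm_apply continuous_const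
  have hdg : ∀ i, Continuous fun x => fderiv ℝ g x (e i) := fun i =>
    (hg.continuous_fderiv (by simp)).clm_apply continuous_const
  have hdfc : ∀ i, HasCompactSupport fun x => fderiv ℝ f x (e i) := fun i => hfc.fderiv_apply ℝ _
  have hdgc : ∀ i, HasCompactSupport fun x => fderiv ℝ g x (e i) := fun i => hgc.fderiv_apply ℝ _
  have hev : ∀ᶠ ε : ℝ in 𝓝 0, ∀ y, q + ε • w y ∈ D := by
    obtain ⟨δ, hδ, hδD⟩ := Metric.mem_nhds_iff.1 (hD.mem_nhds hq)
    set M := |Cf| * ‖v‖ + |Cg| * ‖v'‖ + 1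
    have hM : 0 < M := by positivity
    filter_upwards [Metric.ball_mem_nhds (0 : ℝ) (show 0 < δ / M by positivity)] with ε hε y
    rw [mem_ball_zero_iff, lt_div_iff₀ hM] at hε
    have : q + ε • w y = (q + ε • (f y • v + g y • v')) + ι (ε • y) := by
      simp only [hw, smul_add, map_smul]; abel
    rw [this]
    apply hι
    apply hδD
    simp only [Metric.mem_ball, dist_self_add_left, norm_smul]
    calc ‖ε‖ * ‖f y • v + g y • v'‖ ≤ ‖ε‖ * M := by
          gcongr
          calc _ ≤ ‖f y‖ * ‖v‖ + ‖g y‖ * ‖v'‖ :=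
                (norm_add_le _ _).trans (by rw [norm_smul, norm_smul])
            _ ≤ |Cf| * ‖v‖ + |Cg| * ‖v'‖ := by
                gcongr
                · exact (hCf y).trans (le_abs_self _)
                · exact (hCg y).trans (le_abs_self _)
            _ ≤ M := by simp [M]
      _ < δ := hε
  have hev0 : ∀ ε : ℝ, ∀ y, q + ε • ι y ∈ D := fun ε y => by
    rw [← map_smul]; exact hι q hq _
  -- the rescaled action
  set I : ℝ → ℝ := fun ε => ((∫ y, B (q + ε • w y) * χ y) - ∫ y, B (q + ε • ι y) * χ y)
    + ∑ i, ((∫ y, a i (q + ε • w y) * fderiv ℝ f y (e i))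
      + ∫ y, b i (q + ε • w y) * fderiv ℝ g y (e i)) with hI
  have hd : HasDerivAt I (((∫ y, fderiv ℝ B q (w y) * χ y) - ∫ y, fderiv ℝ B q (ι y) * χ y)
      + ∑ i, ((∫ y, fderiv ℝ (a i) q (w y) * fderiv ℝ f y (e i))
        + ∫ y, fderiv ℝ (b i) q (w y) * fderiv ℝ g y (e i))) 0 :=
    ((hasDerivAt_integral_comp_smul hD hB hq hwc hχ hχc hev).sub
      (hasDerivAt_integral_comp_smul hD hB hq ι.continuous hχ hχc
        (Eventually.of_forall hev0))).add
    (HasDerivAt.fun_sum fun i _ =>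
      (hasDerivAt_integral_comp_smul hD (ha i) hq hwc (hdf i) (hdfc i) hev).add
      (hasDerivAt_integral_comp_smul hD (hb i) hq hwc (hdg i) (hdgc i) hev))
  -- For `ε ≠ 0` the substitution `x = ε y` identifies `I ε` with a multiple of the vanishing action
  -- of the rescaled variation. At `ε = 0` only integrals of derivatives of compactly supported
  -- functions remain.
  have hIz : I =ᶠ[𝓝 0] fun _ => 0 := by
    filter_upwards [hev] with ε hε
    by_cases hε0 : ε = 0
    · simp only [hI, hε0, zero_smul, add_zero, sub_self, zero_add]
      refine Finset.sum_eq_zero fun i _ => ?_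
      rw [integral_const_mul, integral_const_mul,
        integral_fderiv_apply_eq_zero (hf.of_le (by simp)) hfc,
        integral_fderiv_apply_eq_zero (hg.of_le (by simp)) hgc]
      simp
    · have hscale : ∀ {k : Space n → ℝ}, ContDiff ℝ ∞ k → HasCompactSupport k →
          ContDiff ℝ ∞ (fun x => ε * k (ε⁻¹ • x)) ∧ HasCompactSupport (fun x => ε * k (ε⁻¹ • x)) ∧
          ∀ y z, fderiv ℝ (fun x => ε * k (ε⁻¹ • x)) (ε • y) z = fderiv ℝ k y z := by
        intro k hk hkc
        refine ⟨by fun_prop, ?_, fun y z => ?_⟩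
        · exact (hkc.comp_smul (inv_ne_zero hε0)).mul_left
        · have h1 : HasFDerivAt k (fderiv ℝ k y) (ε⁻¹ • (ε • y)) := by
            rw [inv_smul_smul₀ hε0]
            exact (hk.differentiable (by simp) y).hasFDerivAt
          have h2 : HasFDerivAt (fun x : Space n => ε⁻¹ • x)
              (ε⁻¹ • ContinuousLinearMap.id ℝ (Space n)) (ε • y) :=
            (ε⁻¹ • ContinuousLinearMap.id ℝ (Space n)).hasFDerivAt
          have h3 := (h1.comp (ε • y) h2).const_mul ε
          have h4 : fderiv ℝ (fun x => ε * k (ε⁻¹ • x)) (ε • y) = _ := h3.fderiv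
          rw [h4]
          simp [hε0]
      obtain ⟨f1, f2, f3⟩ := hscale hf hfc
      obtain ⟨g1, g2, g3⟩ := hscale hg hgc
      have arg : ∀ y, q + ε • ι y + (ε * f (ε⁻¹ • ε • y)) • v + (ε * g (ε⁻¹ • ε • y)) • v'
          = q + ε • w y := by
        intro y
        rw [inv_smul_smul₀ hε0]
        simp only [hw, smul_add, mul_smul]; abel
      have hH := H _ _ f1 g1 f2 g2 (fun x => by
        have := arg (ε⁻¹ • x)
        rw [smul_inv_smul₀ hε0, ← map_smul, smul_inv_smul₀ hε0] at this
        rw [this]; exact hε _)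
      have hH' := (Measure.integral_comp_smul (volume : Measure (Space n)) _ ε).trans
        (by rw [hH, smul_zero])
      simp only [f3, g3, map_smul, arg] at hH'
      rw [← hH', hI]
      have iB := (continuous_comp_add_smul_mul hB hwc hχ hε).integrable_of_hasCompactSupport
        (μ := volume) hχc.mul_left
      have iB0 := (continuous_comp_add_smul_mul hB ι.continuous hχ
        (hev0 ε)).integrable_of_hasCompactSupport (μ := volume) hχc.mul_left
      have ia := fun i => (continuous_comp_add_smul_mul (ha i) hwc (hdf i)
        hε).integrable_of_hasCompactSupport (μ := volume) (hdfc i).mul_left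
      have ib := fun i => (continuous_comp_add_smul_mul (hb i) hwc (hdg i)
        hε).integrable_of_hasCompactSupport (μ := volume) (hdgc i).mul_left
      simp only
      rw [← integral_sub iB iB0]
      simp only [← integral_add (ia _) (ib _)]
      have iab : ∀ i ∈ Finset.univ, Integrable (fun y => a i (q + ε • w y) * fderiv ℝ f y (e i)
          + b i (q + ε • w y) * fderiv ℝ g y (e i)) volume := fun i _ => (ia i).add (ib i)
      have iBB : Integrable (fun y => B (q + ε • w y) * χ y - B (q + ε • ι y) * χ y) volume :=
        iB.sub iB0
      rw [← integral_finsetSum _ iab, ← integral_add iBB (integrable_finsetSum _ iab)]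
      congr 1
      ext y
      congr 1
      by_cases hy : f y ≠ 0 ∨ g y ≠ 0
      · rw [hχ1 y hy, mul_one, mul_one]
      · push Not at hy
        simp [hw, hy.1, hy.2]
  have h0 := hd.unique ((hasDerivAt_const (0 : ℝ) (0 : ℝ)).congr_of_eventuallyEq hIz)
  -- evaluation of the derivative
  have tB : (∫ y, fderiv ℝ B q (w y) * χ y) - ∫ y, fderiv ℝ B q (ι y) * χ y =
      fderiv ℝ B q v * (∫ y, f y) + fderiv ℝ B q v' * ∫ y, g y := by
    rw [← integral_sub, ← integral_const_mul, ← integral_const_mul, ← integral_add]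
    · congr 1
      ext y
      by_cases hy : f y ≠ 0 ∨ g y ≠ 0
      · rw [hχ1 y hy]; simp [hw]; ring
      · push Not at hy
        simp [hw, hy.1, hy.2]
    · exact (hfco.integrable_of_hasCompactSupport hfc).const_mul _
    · exact (hgco.integrable_of_hasCompactSupport hgc).const_mul _
    · exact (((fderiv ℝ B q).continuous.comp hwc).mul hχ).integrable_of_hasCompactSupport
        hχc.mul_left
    · exact (((fderiv ℝ B q).continuous.comp ι.continuous).mul hχ).integrable_of_hasCompactSupport
        hχc.mul_left
  -- Integrating the part `ι y` of `w` by parts is what produces the explicit `x`-derivatives of the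
  -- coefficients.
  have tl : ∀ (l : Z →L[ℝ] ℝ) {k : Space n → ℝ} (hk : ContDiff ℝ ∞ k) (hkc : HasCompactSupport k)
      (i : Fin n), ∫ y, l (w y) * fderiv ℝ k y (e i) = -l (ι (e i)) * (∫ y, k y)
        + l v * (∫ y, f y * fderiv ℝ k y (e i)) + l v' * ∫ y, g y * fderiv ℝ k y (e i) := by
    intro l k hk hkc i
    have hdk : Continuous fun x => fderiv ℝ k x (e i) :=
      (hk.continuous_fderiv (by simp)).clm_apply continuous_const
    have hdkc : HasCompactSupport fun x => fderiv ℝ k x (e i) := hkc.fderiv_apply ℝ _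
    have h1 := integral_mul_fderiv_eq_neg (f := fun y => l (ι y)) (g := k)
      ((l.comp ι).contDiff) (hk.of_le (by simp)) hkc (e i)
    have h2 : ∀ y, fderiv ℝ (fun y => l (ι y)) y (e i) = l (ι (e i)) := fun y => by
      rw [show (fun y => l (ι y)) = (l.comp ι : Space n →L[ℝ] ℝ) from rfl,
        ContinuousLinearMap.fderiv]
      rfl
    simp only [h2, integral_const_mul] at h1
    rw [neg_mul, ← h1, ← integral_const_mul, ← integral_const_mul, ← integral_add, ← integral_add]
    · congr 1
      ext y
      simp [hw]; ring
    · refine Integrable.add ?_ ?_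
      · exact (((l.continuous.comp ι.continuous)).mul hdk).integrable_of_hasCompactSupport
          hdkc.mul_left
      · exact ((hfco.mul hdk).integrable_of_hasCompactSupport hdkc.mul_left).const_mul _
    · exact ((hgco.mul hdk).integrable_of_hasCompactSupport hdkc.mul_left).const_mul _
    · exact (((l.continuous.comp ι.continuous)).mul hdk).integrable_of_hasCompactSupport
          hdkc.mul_left
    · exact ((hfco.mul hdk).integrable_of_hasCompactSupport hdkc.mul_left).const_mul _
  have parts : ∀ {k m : Space n → ℝ}, ContDiff ℝ ∞ k → ContDiff ℝ ∞ m → HasCompactSupport m →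
      ∀ i, ∫ y, k y * fderiv ℝ m y (e i) = -∫ y, m y * fderiv ℝ k y (e i) := by
    intro k m hk hm hmc i
    rw [integral_mul_fderiv_eq_neg (hk.of_le (by simp)) (hm.of_le (by simp)) hmc]
    simp only [mul_comm]
  have hff : ∀ i, ∫ y, f y * fderiv ℝ f y (e i) = 0 := fun i => by
    linarith [parts hf hf hfc i]
  have hgg : ∀ i, ∫ y, g y * fderiv ℝ g y (e i) = 0 := fun i => by
    linarith [parts hg hg hgc i]
  rw [tB] at h0
  simp only [tl _ hf hfc, tl _ hg hgc, hff, hgg, mul_zero, add_zero,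
    parts hg hf hfc] at h0
  rw [← h0]
  simp only [sub_mul, Finset.sum_mul, Finset.sum_add_distrib, Finset.sum_sub_distrib,
    Finset.sum_neg_distrib, neg_mul, mul_neg]
  ring

/-- The Euler–Lagrange equations of a null Lagrangian linear in the gradient. -/
lemma null_lagrangian {n : ℕ} {D : Set Z} (hD : IsOpen D) {q : Z} (hq : q ∈ D)
    (ι : Space n →L[ℝ] Z) (hι : ∀ z ∈ D, ∀ x, z + ι x ∈ D) (v v' : Z)
    {B : Z → ℝ} {a b : Fin n → Z → ℝ} (hB : ContDiffOn ℝ ∞ B D)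
    (ha : ∀ i, ContDiffOn ℝ ∞ (a i) D) (hb : ∀ i, ContDiffOn ℝ ∞ (b i) D)
    (H : ∀ f g : Space n → ℝ, ContDiff ℝ ∞ f → ContDiff ℝ ∞ g → HasCompactSupport f →
      HasCompactSupport g → (∀ x, q + ι x + f x • v + g x • v' ∈ D) →
      ∫ x, (B (q + ι x + f x • v + g x • v') - B (q + ι x)
        + ∑ i, (a i (q + ι x + f x • v + g x • v') * fderiv ℝ f x (EuclideanSpace.single i 1)
          + b i (q + ι x + f x • v + g x • v') * fderiv ℝ g x (EuclideanSpace.single i 1))) = 0) :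
    fderiv ℝ B q v = ∑ i, fderiv ℝ (a i) q (ι (EuclideanSpace.single i 1)) ∧
    ∀ i, fderiv ℝ (b i) q v = fderiv ℝ (a i) q v' := by
  let χ : ContDiffBump (0 : Space n) := ⟨1, 2, one_pos, one_lt_two⟩
  have hχ : ContDiff ℝ ∞ χ := χ.contDiff
  have hχc := χ.hasCompactSupport
  have hχ0 : χ 0 = 1 := χ.one_of_mem_closedBall (by simp [χ])
  have hpos : 0 < ∫ x, χ x := χ.continuous.integral_pos_of_hasCompactSupport_nonneg_nonzero hχc
    (fun x => χ.nonneg) (x := 0) (by simp [hχ0])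
  have hpos2 : 0 < ∫ x, χ x * χ x :=
    (χ.continuous.mul χ.continuous).integral_pos_of_hasCompactSupport_nonneg_nonzero hχc.mul_left
    (fun x => mul_self_nonneg _) (x := 0) (by simp [hχ0])
  have key := fun {f g : Space n → ℝ} => null_lagrangian_expansion (f := f) (g := g)
    hD hq ι hι v v' hB ha hb H
  have z : HasCompactSupport (fun _ : Space n => (0 : ℝ)) := HasCompactSupport.zero
  -- Varying in one direction only isolates the zeroth-order coefficient of that direction, since `∫
  -- χ > 0`.
  have h1 := key hχ contDiff_const hχc z
  have h2 := key contDiff_const hχ z hχc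
  simp only [integral_zero, mul_zero, add_zero, zero_mul, Finset.sum_const_zero, zero_add,
    mul_eq_zero, hpos.ne', or_false, fderiv_fun_const, Pi.zero_apply,
    _root_.zero_apply] at h1 h2
  refine ⟨sub_eq_zero.1 h1, fun k => sub_eq_zero.1 ?_⟩
  have hy : ContDiff ℝ ∞ (fun y : Space n => y k) := by fun_prop
  -- `∫ y_k χ ∂ᵢχ = -½ δ_ik ∫ χ²`, so this pair of variations picks out the coefficient with index
  -- `k`.
  have h3 := key (f := fun y => y k * χ y) (hy.mul hχ) hχ hχc.mul_left hχc
  rw [h1, h2, zero_mul, zero_mul, zero_add, zero_add] at h3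
  have h4 : ∀ i, 2 * ∫ y : Space n, y k * χ y * fderiv ℝ χ y (EuclideanSpace.single i 1)
      = if i = k then -∫ x, χ x * χ x else 0 := by
    intro i
    have h5 := integral_mul_fderiv_eq_neg (f := fun y : Space n => y k) (g := fun y => χ y * χ y)
      (hy.of_le (by simp)) ((hχ.mul hχ).of_le (by simp)) hχc.mul_left (EuclideanSpace.single i 1)
    have h6 : ∀ y, fderiv ℝ (fun y : Space n => y k) y (EuclideanSpace.single i 1)
        = if i = k then 1 else 0 := by
      intro y
      rw [show (fun y : Space n => y k) = (EuclideanSpace.proj k : Space n →L[ℝ] ℝ) from rfl,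
        ContinuousLinearMap.fderiv]
      simp [eq_comm]
    have h7 : ∀ y, fderiv ℝ (fun y => χ y * χ y) y (EuclideanSpace.single i 1)
        = 2 * (χ y * fderiv ℝ χ y (EuclideanSpace.single i 1)) := by
      intro y
      have hd := hχ.differentiable (by simp) y
      rw [fderiv_fun_mul hd hd]
      simp; ring
    simp only [h6, h7] at h5
    rw [← integral_const_mul]
    trans ∫ y : Space n, y k * (2 * (χ y * fderiv ℝ χ y (EuclideanSpace.single i 1)))
    · congr 1
      ext y
      ring
    · rw [h5]
      split_ifs <;> simp
  have h8 := congrArg (2 * ·) h3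
  simp only [Finset.mul_sum, mul_left_comm (2 : ℝ), h4, mul_ite, mul_zero, Finset.sum_ite_eq',
    Finset.mem_univ, if_true, mul_eq_zero, neg_eq_zero, hpos2.ne', or_false] at h8
  exact h8

end NullLagrangian

/-! ### The space of states and its differential ring -/

section States

variable {n : ℕ}

/-- The space of `(t, x, u, ρ, p)`. -/
abbrev State (n : ℕ) := ℝ × Space n × Space n × ℝ × ℝ

/-- The arguments `(t, x, u, ρ, p)` whose thermodynamic state `(p, ρ)` lies in `Ω`. -/
def stateDomain (n : ℕ) (Ω : Set (ℝ × ℝ)) : Set (State n) := {q | (q.2.2.2.2, q.2.2.2.1) ∈ Ω}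

/-- A function of kinematic form as a function on the space of states. -/
def KinematicFunction.onState (T : KinematicFunction n) : State n → ℝ :=
  fun q => T q.1 q.2.1 q.2.2.1 q.2.2.2.1 q.2.2.2.2

/-- The projection `(t, x, u, ρ, p) ↦ (p, ρ)`. -/
def thermoProj (n : ℕ) : State n →L[ℝ] ℝ × ℝ :=
  let tail := ContinuousLinearMap.snd ℝ (Space n) (ℝ × ℝ) ∘L
    ContinuousLinearMap.snd ℝ (Space n) (Space n × ℝ × ℝ) ∘L
    ContinuousLinearMap.snd ℝ ℝ (Space n × Space n × ℝ × ℝ)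
  (ContinuousLinearMap.snd ℝ ℝ ℝ ∘L tail).prod (ContinuousLinearMap.fst ℝ ℝ ℝ ∘L tail)

@[simp] lemma thermoProj_apply (q : State n) : thermoProj n q = (q.2.2.2.2, q.2.2.2.1) := rfl

lemma isOpen_stateDomain {Ω : Set (ℝ × ℝ)} (hΩ : IsOpen Ω) : IsOpen (stateDomain n Ω) :=
  hΩ.preimage (thermoProj n).continuous

lemma isPreconnected_stateDomain {Ω : Set (ℝ × ℝ)} (hΩ : IsPreconnected Ω) :
    IsPreconnected (stateDomain n Ω) := by
  have h1 : IsPreconnected ((Set.univ : Set ℝ) ×ˢ (Set.univ : Set (Space n)) ×ˢ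
      (Set.univ : Set (Space n)) ×ˢ Ω) :=
    isPreconnected_univ.prod (isPreconnected_univ.prod (isPreconnected_univ.prod hΩ))
  -- States list `ρ` before `p`, whereas points of `Ω` are `(p, ρ)`; hence the swap.
  have h2 := h1.image (fun q : ℝ × Space n × Space n × ℝ × ℝ =>
    ((q.1, q.2.1, q.2.2.1, q.2.2.2.2, q.2.2.2.1) : State n))
    (by fun_prop)
  convert h2
  ext ⟨t, x, u, ρ, p⟩
  simp [stateDomain]

/-- The unit vector in a coordinate direction. -/
def Direction.vec : Direction n → State n
  | .t => (1, 0, 0, 0, 0)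
  | .x i => (0, EuclideanSpace.single i 1, 0, 0, 0)
  | .u i => (0, 0, EuclideanSpace.single i 1, 0, 0)
  | .r => (0, 0, 0, 1, 0)
  | .p => (0, 0, 0, 0, 1)

section Partial

variable {G : State n → ℝ} {t : ℝ} {x u : Space n} {ρ p : ℝ}
  (hG : DifferentiableAt ℝ G (t, x, u, ρ, p))
include hG

lemma hasDerivAt_state_t :
    HasDerivAt (fun s => G (s, x, u, ρ, p)) (fderiv ℝ G (t, x, u, ρ, p) Direction.t.vec) t :=
  hG.hasFDerivAt.comp_hasDerivAt t
    ((hasDerivAt_id t).prodMk (hasDerivAt_const t ((x, u, ρ, p) : Space n × Space n × ℝ × ℝ)))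

lemma hasFDerivAt_state_u (v : Space n) :
    fderiv ℝ (fun w => G (t, x, w, ρ, p)) u v = fderiv ℝ G (t, x, u, ρ, p) (0, 0, v, 0, 0) := by
  have h3 := (hasFDerivAt_id (𝕜 := ℝ) u).prodMk (hasFDerivAt_const ((ρ, p) : ℝ × ℝ) u)
  have h := (hasFDerivAt_const (𝕜 := ℝ) t u).prodMk ((hasFDerivAt_const (𝕜 := ℝ) x u).prodMk h3)
  have h2 : fderiv ℝ (fun w => G (t, x, w, ρ, p)) u = _ := (hG.hasFDerivAt.comp u h).fderiv
  rw [h2]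
  rfl

lemma hasDerivAt_state_r :
    HasDerivAt (fun s => G (t, x, u, s, p)) (fderiv ℝ G (t, x, u, ρ, p) Direction.r.vec) ρ :=
  hG.hasFDerivAt.comp_hasDerivAt ρ ((hasDerivAt_const ρ t).prodMk ((hasDerivAt_const ρ x).prodMk
    ((hasDerivAt_const ρ u).prodMk ((hasDerivAt_id ρ).prodMk (hasDerivAt_const ρ p)))))

lemma hasDerivAt_state_p :
    HasDerivAt (fun s => G (t, x, u, ρ, s)) (fderiv ℝ G (t, x, u, ρ, p) Direction.p.vec) p :=
  hG.hasFDerivAt.comp_hasDerivAt p ((hasDerivAt_const p t).prodMk ((hasDerivAt_const p x).prodMk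
    ((hasDerivAt_const p u).prodMk ((hasDerivAt_const p ρ).prodMk (hasDerivAt_id p)))))

end Partial

variable {Ω : Set (ℝ × ℝ)}

lemma smoothDeriv_clm (hD : IsOpen (stateDomain n Ω)) (l : State n →L[ℝ] ℝ) (v : State n) :
    smoothDeriv hD v (restrictSmooth l l.contDiff.contDiffOn) =
      algebraMap ℝ (smoothAlgebra (stateDomain n Ω)) (l v) := by
  rw [smoothDeriv_restrictSmooth]
  ext q
  rw [restrictSmooth_apply, ContinuousLinearMap.fderiv]
  rfl

/-- A function of the thermodynamic state in the ring of smooth functions of all variables. -/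
def thermoFun (F : ℝ × ℝ → ℝ) (hF : ContDiffOn ℝ ∞ F Ω) : smoothAlgebra (stateDomain n Ω) :=
  restrictSmooth (fun q => F (thermoProj n q))
    (hF.comp (thermoProj n).contDiff.contDiffOn fun _ hq => hq)

lemma smoothDeriv_thermoFun (hΩ : IsOpen Ω) (F : ℝ × ℝ → ℝ) (hF : ContDiffOn ℝ ∞ F Ω)
    (v : State n) (q : stateDomain n Ω) :
    (smoothDeriv (isOpen_stateDomain hΩ) v (thermoFun F hF)).1 q =
      fderiv ℝ F (thermoProj n q) (thermoProj n v) := by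
  rw [thermoFun, smoothDeriv_restrictSmooth, restrictSmooth_apply]
  have h := ((hF.contDiffAt (hΩ.mem_nhds q.2)).differentiableAt (by simp)).hasFDerivAt.comp q.1
    (thermoProj n).hasFDerivAt
  have h2 : fderiv ℝ (fun q => F (thermoProj n q)) q.1 = _ := h.fderiv
  rw [h2]
  rfl

/-- The velocity component `uʲ` as a linear function on the space of states. -/
def velocityProj (j : Fin n) : State n →L[ℝ] ℝ :=
  EuclideanSpace.proj j ∘L ContinuousLinearMap.fst ℝ (Space n) (ℝ × ℝ) ∘L
    ContinuousLinearMap.snd ℝ (Space n) (Space n × ℝ × ℝ) ∘L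
    ContinuousLinearMap.snd ℝ ℝ (Space n × Space n × ℝ × ℝ)

@[simp] lemma velocityProj_apply (j : Fin n) (q : State n) : velocityProj j q = q.2.2.1 j := rfl

/-- The density as a linear function on the space of states. -/
def densityProj (n : ℕ) : State n →L[ℝ] ℝ := ContinuousLinearMap.snd ℝ ℝ ℝ ∘L thermoProj n

@[simp] lemma densityProj_apply (q : State n) : densityProj n q = q.2.2.2.1 := rfl

/-- The differential ring of smooth functions of `(t, x, u, ρ, p)`. -/
def stateRing (n : ℕ) (hΩ : IsOpen Ω) (hpos : ∀ p ρ : ℝ, (p, ρ) ∈ Ω → 0 < ρ)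
    (F : ℝ × ℝ → ℝ) (hF : ContDiffOn ℝ ∞ F Ω)
    (hF_ne : ∀ W : Set (ℝ × ℝ), W ⊆ Ω → IsOpen W → W.Nonempty → ∃ q ∈ W, F q ≠ 0) :
    StateRing n (smoothAlgebra (stateDomain n Ω)) where
  D a := smoothDeriv (isOpen_stateDomain hΩ) a.vec
  comm a b f := smoothDeriv_comm _ _ _ f
  u j := restrictSmooth (velocityProj j) (velocityProj j).contDiff.contDiffOn
  r := restrictSmooth (densityProj n) (densityProj n).contDiff.contDiffOn
  rinv := restrictSmooth (fun q => (densityProj n q)⁻¹)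
    ((densityProj n).contDiff.contDiffOn.inv fun q hq => (hpos _ _ hq).ne')
  F := thermoFun F hF
  r_mul_rinv := by
    ext q
    exact mul_inv_cancel₀ (hpos _ _ q.2).ne'
  D_t_u j := by rw [smoothDeriv_clm]; simp [Direction.vec]
  D_x_u i j := by rw [smoothDeriv_clm]; simp [Direction.vec]
  D_u_u i j := by
    rw [smoothDeriv_clm]
    by_cases h : i = j
    · subst h; simp [Direction.vec]
    · simp [Direction.vec, h, Ne.symm h]
  D_r_u j := by rw [smoothDeriv_clm]; simp [Direction.vec]
  D_p_u j := by rw [smoothDeriv_clm]; simp [Direction.vec]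
  D_t_r := by rw [smoothDeriv_clm]; simp [Direction.vec]
  D_x_r i := by rw [smoothDeriv_clm]; simp [Direction.vec]
  D_u_r i := by rw [smoothDeriv_clm]; simp [Direction.vec]
  D_r_r := by rw [smoothDeriv_clm]; simp [Direction.vec]
  D_p_r := by rw [smoothDeriv_clm]; simp [Direction.vec]
  D_t_F := by ext q; rw [smoothDeriv_thermoFun hΩ]; simp [Direction.vec, Prod.mk_zero_zero]
  D_x_F i := by ext q; rw [smoothDeriv_thermoFun hΩ]; simp [Direction.vec, Prod.mk_zero_zero]
  D_u_F i := by ext q; rw [smoothDeriv_thermoFun hΩ]; simp [Direction.vec, Prod.mk_zero_zero]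
  F_mul f hf := by
    ext ⟨⟨t, x, u, ρ, p⟩, hq⟩
    by_contra hne
    have hc : ContinuousOn (fun s : ℝ × ℝ => extendZero f.1 (t, x, u, s.2, s.1)) Ω :=
      (smoothAlgebra_contDiffOn f).continuousOn.comp (by fun_prop) fun s hs => hs
    -- At fixed `(t, x, u)` the thermodynamic states with `f ≠ 0` form a nonempty open set, so `F`
    -- is nonzero somewhere on it.
    obtain ⟨s, hs, hFs⟩ := hF_ne (Ω ∩ (fun s : ℝ × ℝ => extendZero f.1 (t, x, u, s.2, s.1)) ⁻¹' {0}ᶜ)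
      Set.inter_subset_left (hc.isOpen_inter_preimage hΩ isOpen_compl_singleton)
      ⟨(p, ρ), hq, by simpa [extendZero_of_mem f.1 (q := (t, x, u, ρ, p)) hq] using hne⟩
    have h1 := congrArg (fun g : smoothAlgebra (stateDomain n Ω) => g.1 ⟨(t, x, u, s.2, s.1), hs.1⟩)
      hf
    have h2 : F s * f.1 ⟨(t, x, u, s.2, s.1), hs.1⟩ = 0 := h1
    have h3 := hs.2
    simp only [Set.mem_preimage, Set.mem_compl_iff, Set.mem_singleton_iff] at h3
    rw [extendZero_of_mem f.1 (q := (t, x, u, s.2, s.1)) hs.1] at h3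
    exact (mul_ne_zero hFs h3) h2

end States

/-! ### Conserved densities have null total time derivative -/

section Conserved

open MeasureTheory Filter Topology

variable {n : ℕ} {Ω : Set (ℝ × ℝ)}

lemma sum_smul_single (w : Space n) : ∑ i, w i • EuclideanSpace.single i (1 : ℝ) = w := by
  simpa using (EuclideanSpace.basisFun (Fin n) ℝ).sum_repr w

lemma clm_apply_eq_sum {E : Type*} [NormedAddCommGroup E] [NormedSpace ℝ E]
    (l : Space n →L[ℝ] E) (w : Space n) :
    l w = ∑ i, w i • l (EuclideanSpace.single i 1) := by
  conv_lhs => rw [← sum_smul_single w]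
  simp

lemma gradient_apply_eq (f : Space n → ℝ) (x : Space n) (i : Fin n) :
    gradient f x i = fderiv ℝ f x (EuclideanSpace.single i 1) := by
  have h : inner ℝ (gradient f x) (EuclideanSpace.single i (1 : ℝ)) = gradient f x i := by
    rw [EuclideanSpace.inner_single_right]
    simp
  rw [← h, inner_gradient_left]

/-- The coefficients of the total time derivative of `G` as a linear function of the spatial
derivatives of the fluid variables. -/
def gradCoeff (F : ℝ × ℝ → ℝ) (G : State n → ℝ) (v : Space n × ℝ × ℝ) (i : Fin n) : State n → ℝ :=
  fun q => -(q.2.2.1 i * fderiv ℝ G q (0, 0, v))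
    - (q.2.2.2.1 * fderiv ℝ G q Direction.r.vec
      + F (thermoProj n q) * fderiv ℝ G q Direction.p.vec) * v.1 i
    - (q.2.2.2.1)⁻¹ * fderiv ℝ G q (Direction.u i).vec * v.2.2

/-- Linearity in the gradient splits the Lagrangian of a two-component variation into the `∂f` and
`∂g` parts that `null_lagrangian` expects. -/
lemma gradCoeff_add_smul (F : ℝ × ℝ → ℝ) (G : State n → ℝ) (v w : Space n × ℝ × ℝ) (a b : ℝ)
    (i : Fin n) (q : State n) : gradCoeff F G (a • v + b • w) i q =
      gradCoeff F G v i q * a + gradCoeff F G w i q * b := by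
  have : ((0, 0, a • v + b • w) : State n) = a • ((0, 0, v) : State n) + b • ((0, 0, w) : State n) := by
    simp
  simp only [gradCoeff, this, map_add, map_smul, smul_eq_mul]
  simp
  ring

lemma contDiffOn_gradCoeff (hΩ : IsOpen Ω) (hpos : ∀ p ρ : ℝ, (p, ρ) ∈ Ω → 0 < ρ)
    {F : ℝ × ℝ → ℝ} (hF : ContDiffOn ℝ ∞ F Ω) {G : State n → ℝ}
    (hG : ContDiffOn ℝ ∞ G (stateDomain n Ω)) (v : Space n × ℝ × ℝ) (i : Fin n) :
    ContDiffOn ℝ ∞ (gradCoeff F G v i) (stateDomain n Ω) := by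
  have hd := contDiffOn_fderiv_apply (isOpen_stateDomain hΩ) hG
  have hu : ContDiffOn ℝ ∞ (fun q : State n => q.2.2.1 i) (stateDomain n Ω) :=
    (velocityProj i).contDiff.contDiffOn
  have hr : ContDiffOn ℝ ∞ (fun q : State n => q.2.2.2.1) (stateDomain n Ω) :=
    (densityProj n).contDiff.contDiffOn
  have hF' : ContDiffOn ℝ ∞ (fun q => F (thermoProj n q)) (stateDomain n Ω) :=
    hF.comp (thermoProj n).contDiff.contDiffOn fun _ hq => hq
  exact (((hu.mul (hd _)).neg.sub (((hr.mul (hd _)).add (hF'.mul (hd _))).mul contDiffOn_const)).sub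
    (((hr.inv fun q hq => (hpos _ _ hq).ne').mul (hd _)).mul contDiffOn_const))

/-- The state of fluid variables at a point of space-time. -/
def FluidField.state (φ : FluidField n Ω) (t : ℝ) (x : Space n) : State n :=
  (t, x, φ.u x, φ.ρ x, φ.p x)

lemma FluidField.state_mem (φ : FluidField n Ω) (t : ℝ) (x : Space n) :
    φ.state t x ∈ stateDomain n Ω := φ.mem x

/-- The total time derivative is affine in the spatial derivatives of the fluid variables. -/
lemma totalTimeDeriv_eq (hpos : ∀ p ρ : ℝ, (p, ρ) ∈ Ω → 0 < ρ)
    (F : ℝ × ℝ → ℝ) (T : KinematicFunction n) (φ : FluidField n Ω) (t : ℝ) (x : Space n)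
    (hT : DifferentiableAt ℝ T.onState (φ.state t x)) :
    totalTimeDeriv F T φ t x = fderiv ℝ T.onState (φ.state t x) Direction.t.vec
      + ∑ i, gradCoeff F T.onState (fderiv ℝ φ.u x (EuclideanSpace.single i 1),
          fderiv ℝ φ.ρ x (EuclideanSpace.single i 1), fderiv ℝ φ.p x (EuclideanSpace.single i 1)) i
          (φ.state t x) := by
  have ht : deriv (fun s => T s x (φ.u x) (φ.ρ x) (φ.p x)) t = _ := (hasDerivAt_state_t hT).deriv
  have hr : deriv (fun r => T t x (φ.u x) r (φ.p x)) (φ.ρ x) = _ := (hasDerivAt_state_r hT).deriv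
  have hp : deriv (fun r => T t x (φ.u x) (φ.ρ x) r) (φ.p x) = _ := (hasDerivAt_state_p hT).deriv
  have hu : fderiv ℝ (fun v => T t x v (φ.ρ x) (φ.p x)) (φ.u x) (φ.uDot x) = _ :=
    hasFDerivAt_state_u hT (φ.uDot x)
  have hρ := (φ.mem x)
  have hρ0 := (hpos _ _ hρ).ne'
  set q := φ.state t x with hq
  have hq' : (t, x, φ.u x, φ.ρ x, φ.p x) = q := rfl
  rw [hq'] at ht hr hp hu
  rw [totalTimeDeriv, ht, hu, hr, hp]
  have e1 : fderiv ℝ T.onState q (0, 0, φ.uDot x, 0, 0) =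
      -∑ i, (φ.u x i * fderiv ℝ T.onState q (0, 0, fderiv ℝ φ.u x (EuclideanSpace.single i 1), 0, 0)
        + (φ.ρ x)⁻¹ * fderiv ℝ T.onState q (Direction.u i).vec *
          fderiv ℝ φ.p x (EuclideanSpace.single i 1)) := by
    let l : Space n →L[ℝ] ℝ := fderiv ℝ T.onState q ∘L
      ContinuousLinearMap.inr ℝ ℝ (Space n × Space n × ℝ × ℝ) ∘L
      ContinuousLinearMap.inr ℝ (Space n) (Space n × ℝ × ℝ) ∘L
      ContinuousLinearMap.inl ℝ (Space n) (ℝ × ℝ)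
    have hl : ∀ w, fderiv ℝ T.onState q (0, 0, w, 0, 0) = l w := fun w => rfl
    have hl' : ∀ i, fderiv ℝ T.onState q (Direction.u i).vec = l (EuclideanSpace.single i 1) :=
      fun i => rfl
    simp only [hl, hl', FluidField.uDot]
    rw [map_sub, map_neg, clm_apply_eq_sum (fderiv ℝ φ.u x) (φ.u x), map_smul,
      clm_apply_eq_sum l (gradient φ.p x)]
    simp only [gradient_apply_eq, map_sum, map_smul, smul_eq_mul, Finset.sum_add_distrib,
      Finset.mul_sum, one_div]
    rw [neg_add, sub_eq_add_neg]
    congr 2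
    refine Finset.sum_congr rfl fun i _ => by ring
  have e2 : φ.ρDot x = -∑ i, (φ.ρ x * fderiv ℝ φ.u x (EuclideanSpace.single i 1) i
      + φ.u x i * fderiv ℝ φ.ρ x (EuclideanSpace.single i 1)) := by
    rw [FluidField.ρDot, divergence,
      fderiv_fun_smul (φ.smooth_ρ.differentiable (by simp) x) (φ.smooth_u.differentiable (by simp) x)]
    congr 1
    refine Finset.sum_congr rfl fun i _ => ?_
    simp
    ring
  have e3 : φ.pDot F x = -∑ i, (φ.u x i * fderiv ℝ φ.p x (EuclideanSpace.single i 1)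
      + F (φ.p x, φ.ρ x) * fderiv ℝ φ.u x (EuclideanSpace.single i 1) i) := by
    rw [FluidField.pDot, inner_gradient_right, clm_apply_eq_sum (fderiv ℝ φ.p x) (φ.u x),
      divergence, Finset.mul_sum]
    simp [Finset.sum_add_distrib]
    ring
  rw [e1, e2, e3]
  simp only [← Finset.sum_neg_distrib, Finset.mul_sum, add_assoc, ← Finset.sum_add_distrib]
  congr 1
  refine Finset.sum_congr rfl fun i _ => ?_
  have split : ((0, 0, fderiv ℝ φ.u x (EuclideanSpace.single i 1),
      fderiv ℝ φ.ρ x (EuclideanSpace.single i 1), fderiv ℝ φ.p x (EuclideanSpace.single i 1)) : State n)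
      = (0, 0, fderiv ℝ φ.u x (EuclideanSpace.single i 1), 0, 0)
        + fderiv ℝ φ.ρ x (EuclideanSpace.single i 1) • (Direction.r.vec : State n)
        + fderiv ℝ φ.p x (EuclideanSpace.single i 1) • (Direction.p.vec : State n) := by
    simp [Direction.vec]
  simp only [gradCoeff, split, map_add, map_smul, smul_eq_mul]
  simp only [hq, FluidField.state, thermoProj_apply]
  ring

lemma IsConservedDensity.contDiffOn {F : ℝ × ℝ → ℝ} {T : KinematicFunction n}
    (hT : IsConservedDensity F Ω T) : ContDiffOn ℝ ∞ T.onState (stateDomain n Ω) := hT.1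

lemma FluidField.contDiff_jet (k : ℕ) (φ : FluidField n Ω) : ContDiff ℝ ∞ (φ.jet k) := by
  rw [contDiff_pi]
  intro j
  exact (φ.smooth_u.prodMk (φ.smooth_ρ.prodMk φ.smooth_p)).iteratedFDeriv_right (by
    exact_mod_cast le_top)

lemma FluidField.jet_base (k : ℕ) (φ : FluidField n Ω) (x : Space n) :
    (φ.jet k x).base = (φ.u x, φ.ρ x, φ.p x) := by
  rw [Jet.base, FluidField.jet]
  exact iteratedFDeriv_zero_apply _

lemma contDiff_flux_jet {k : ℕ} {X : ℝ × Space n × Jet n k → Space n}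
    (hX : ContDiffOn ℝ ∞ X (jetDomain n k Ω)) (φ : FluidField n Ω) (t : ℝ) :
    ContDiff ℝ ∞ fun y => X (t, y, φ.jet k y) := by
  refine hX.comp_contDiff (contDiff_const.prodMk (contDiff_id.prodMk (φ.contDiff_jet k)))
    fun y => ?_
  simp only [jetDomain, Set.mem_ofPred_eq, FluidField.jet_base]
  exact φ.mem y

/-- Off `K` the fields agree on an open set, so their jets and therefore their fluxes agree. The
difference of the fluxes has compact support and its divergence integrates to zero. -/
lemma integral_totalTimeDeriv_sub_eq_zero {F : ℝ × ℝ → ℝ} {T : KinematicFunction n}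
    (hT : IsConservedDensity F Ω T) (φ ψ : FluidField n Ω) {K : Set (Space n)} (hK : IsCompact K)
    (h : ∀ y ∉ K, φ.u y = ψ.u y ∧ φ.ρ y = ψ.ρ y ∧ φ.p y = ψ.p y) (t : ℝ) :
    ∫ y, (totalTimeDeriv F T φ t y - totalTimeDeriv F T ψ t y) = 0 := by
  obtain ⟨-, k, X, hX, hdiv⟩ := hT
  have h1 := contDiff_flux_jet hX φ t
  have h2 := contDiff_flux_jet hX ψ t
  have hj : ∀ y ∉ K, φ.jet k y = ψ.jet k y := by
    intro y hy
    have : (fun y => (φ.u y, φ.ρ y, φ.p y)) =ᶠ[𝓝 y] fun y => (ψ.u y, ψ.ρ y, ψ.p y) := by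
      filter_upwards [hK.isClosed.isOpen_compl.mem_nhds hy] with z hz
      obtain ⟨a, b, c⟩ := h z hz
      rw [a, b, c]
    funext j
    exact (this.iteratedFDeriv ℝ j).self_of_nhds
  have hc : ∀ i : Fin n, HasCompactSupport fun y =>
      X (t, y, φ.jet k y) i - X (t, y, ψ.jet k y) i := fun i =>
    HasCompactSupport.intro hK fun y hy => by rw [hj y hy, sub_self]
  have hs : ∀ i : Fin n, ContDiff ℝ 1 fun y => X (t, y, φ.jet k y) i - X (t, y, ψ.jet k y) i := by
    intro i
    have h1' := h1.of_le (m := 1) (by simp)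
    have h2' := h2.of_le (m := 1) (by simp)
    exact ((EuclideanSpace.proj i : Space n →L[ℝ] ℝ).contDiff.comp h1').sub
      ((EuclideanSpace.proj i : Space n →L[ℝ] ℝ).contDiff.comp h2')
  have e : ∀ y, totalTimeDeriv F T φ t y - totalTimeDeriv F T ψ t y =
      -∑ i : Fin n, fderiv ℝ (fun y => X (t, y, φ.jet k y) i - X (t, y, ψ.jet k y) i) y
        (EuclideanSpace.single i 1) := by
    intro y
    have d1 : DifferentiableAt ℝ (fun y => X (t, y, φ.jet k y)) y := h1.differentiable (by simp) y
    have d2 : DifferentiableAt ℝ (fun y => X (t, y, ψ.jet k y)) y := h2.differentiable (by simp) y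
    have hi : ∀ i : Fin n, fderiv ℝ (fun y => X (t, y, φ.jet k y) i - X (t, y, ψ.jet k y) i) y
        (EuclideanSpace.single i 1) =
        fderiv ℝ (fun y => X (t, y, φ.jet k y)) y (EuclideanSpace.single i 1) i -
        fderiv ℝ (fun y => X (t, y, ψ.jet k y)) y (EuclideanSpace.single i 1) i := by
      intro i
      have a1 := (EuclideanSpace.proj i : Space n →L[ℝ] ℝ).hasFDerivAt.comp y d1.hasFDerivAt
      have a2 := (EuclideanSpace.proj i : Space n →L[ℝ] ℝ).hasFDerivAt.comp y d2.hasFDerivAt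
      have a3 : fderiv ℝ (fun y => X (t, y, φ.jet k y) i - X (t, y, ψ.jet k y) i) y = _ :=
        (a1.sub a2).fderiv
      rw [a3]
      rfl
    simp only [hi, Finset.sum_sub_distrib]
    have b1 := hdiv φ t y
    have b2 := hdiv ψ t y
    simp only [divergence] at b1 b2
    linarith
  simp only [e]
  rw [integral_neg, integral_finsetSum, neg_eq_zero]
  · exact Finset.sum_eq_zero fun i _ => integral_fderiv_apply_eq_zero (hs i) (hc i) _
  · intro i _
    exact (((hs i).continuous_fderiv (by simp)).clm_apply
      continuous_const).integrable_of_hasCompactSupport ((hc i).fderiv_apply ℝ _)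

/-- The embedding of space into the space of states. -/
def spaceIncl (n : ℕ) : Space n →L[ℝ] State n :=
  ContinuousLinearMap.inr ℝ ℝ (Space n × Space n × ℝ × ℝ) ∘L
    ContinuousLinearMap.inl ℝ (Space n) (Space n × ℝ × ℝ)

lemma spaceIncl_apply (x : Space n) : spaceIncl n x = (0, x, 0) := rfl

/-- The fluid variables `w₀ + f v + g v'`, translated by `x₀`. -/
def variedField (x₀ : Space n) (w₀ v v' : Space n × ℝ × ℝ) {f g : Space n → ℝ}
    (hf : ContDiff ℝ ∞ f) (hg : ContDiff ℝ ∞ g)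
    (hm : ∀ x, ((w₀ + f x • v + g x • v').2.2, (w₀ + f x • v + g x • v').2.1) ∈ Ω) :
    FluidField n Ω where
  u y := (w₀ + f (y - x₀) • v + g (y - x₀) • v').1
  ρ y := (w₀ + f (y - x₀) • v + g (y - x₀) • v').2.1
  p y := (w₀ + f (y - x₀) • v + g (y - x₀) • v').2.2
  smooth_u := by fun_prop
  smooth_ρ := by fun_prop
  smooth_p := by fun_prop
  mem y := hm (y - x₀)

/-- The Euler–Lagrange equations satisfied by a conserved density. -/
lemma IsConservedDensity.euler_lagrange (hΩ : IsOpen Ω) (hpos : ∀ p ρ : ℝ, (p, ρ) ∈ Ω → 0 < ρ)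
    {F : ℝ × ℝ → ℝ} (hF : ContDiffOn ℝ ∞ F Ω) {T : KinematicFunction n}
    (hT : IsConservedDensity F Ω T) {q : State n} (hq : q ∈ stateDomain n Ω)
    (v v' : Space n × ℝ × ℝ) :
    fderiv ℝ (fun z => fderiv ℝ T.onState z Direction.t.vec) q (0, 0, v) =
      ∑ i, fderiv ℝ (gradCoeff F T.onState v i) q (Direction.x i).vec ∧
    ∀ i, fderiv ℝ (gradCoeff F T.onState v' i) q (0, 0, v) =
      fderiv ℝ (gradCoeff F T.onState v i) q (0, 0, v') := by
  have hG : ContDiffOn ℝ ∞ T.onState (stateDomain n Ω) := hT.1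
  have hD := isOpen_stateDomain (n := n) hΩ
  have hd : ∀ z ∈ stateDomain n Ω, DifferentiableAt ℝ T.onState z := fun z hz =>
    (hG.contDiffAt (hD.mem_nhds hz)).differentiableAt (by simp)
  refine null_lagrangian hD hq (spaceIncl n) (fun z hz x => ?_) (0, 0, v) (0, 0, v')
    (contDiffOn_fderiv_apply hD hG _) (fun i => contDiffOn_gradCoeff hΩ hpos hF hG v i)
    (fun i => contDiffOn_gradCoeff hΩ hpos hF hG v' i) ?_
  · simpa [stateDomain, spaceIncl_apply] using hz
  intro f g hf hg hfc hgc hm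
  obtain ⟨t, x₀, w₀⟩ := q
  have hm' : ∀ x, ((w₀ + f x • v + g x • v').2.2, (w₀ + f x • v + g x • v').2.1) ∈ Ω := by
    intro x
    have := hm x
    simpa [stateDomain, spaceIncl_apply] using this
  have hm0 : ∀ x : Space n, ((w₀ + (0 : ℝ) • v + (0 : ℝ) • v').2.2,
      (w₀ + (0 : ℝ) • v + (0 : ℝ) • v').2.1) ∈ Ω := by
    intro x
    simpa [stateDomain] using hq
  -- The varied field is compared with the constant state `w₀`. Centring the variation at `x₀` makes
  -- the state at `x₀ + x` equal to `q + ι x + f x • v + g x • v'`.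
  set φ := variedField x₀ w₀ v v' hf hg hm' with hφ
  set ψ := variedField x₀ w₀ v v' (f := fun _ => 0) (g := fun _ => 0) contDiff_const contDiff_const
    hm0 with hψ
  have hK : IsCompact ((fun y => x₀ + y) '' (tsupport f ∪ tsupport g)) :=
    (hfc.isCompact.union hgc.isCompact).image (by fun_prop)
  have hI := integral_totalTimeDeriv_sub_eq_zero hT φ ψ hK (fun y hy => by
    have hy' : y - x₀ ∉ tsupport f ∪ tsupport g := fun hmem =>
      hy ⟨y - x₀, hmem, by simp⟩
    have hf0 : f (y - x₀) = 0 := image_eq_zero_of_notMem_tsupport fun h => hy' (Or.inl h)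
    have hg0 : g (y - x₀) = 0 := image_eq_zero_of_notMem_tsupport fun h => hy' (Or.inr h)
    simp [hφ, hψ, variedField, hf0, hg0]) t
  rw [← integral_add_left_eq_self _ x₀] at hI
  refine Eq.trans ?_ hI
  congr 1
  ext x
  have sφ : φ.state t (x₀ + x) = (t, x₀, w₀) + spaceIncl n x + f x • ((0, 0, v) : State n)
      + g x • ((0, 0, v') : State n) := by
    simp [FluidField.state, hφ, variedField, spaceIncl_apply]
    rfl
  have sψ : ψ.state t (x₀ + x) = (t, x₀, w₀) + spaceIncl n x := by
    simp [FluidField.state, hψ, variedField, spaceIncl_apply]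
  have hdf : HasFDerivAt (fun y => f (y - x₀)) (fderiv ℝ f x) (x₀ + x) := by
    have := (hf.differentiable (by simp) x).hasFDerivAt
    have h2 : HasFDerivAt f (fderiv ℝ f x) (x₀ + x - x₀) := by simpa using this
    have h3 := h2.comp (x₀ + x) ((hasFDerivAt_id (x₀ + x)).sub_const x₀)
    rwa [ContinuousLinearMap.comp_id] at h3
  have hdg : HasFDerivAt (fun y => g (y - x₀)) (fderiv ℝ g x) (x₀ + x) := by
    have := (hg.differentiable (by simp) x).hasFDerivAt
    have h2 : HasFDerivAt g (fderiv ℝ g x) (x₀ + x - x₀) := by simpa using this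
    have h3 := h2.comp (x₀ + x) ((hasFDerivAt_id (x₀ + x)).sub_const x₀)
    rwa [ContinuousLinearMap.comp_id] at h3
  have hw := ((hdf.smul_const v).const_add w₀).add (hdg.smul_const v')
  have dφ : ∀ z, (fderiv ℝ φ.u (x₀ + x) z, fderiv ℝ φ.ρ (x₀ + x) z, fderiv ℝ φ.p (x₀ + x) z) =
      fderiv ℝ f x z • v + fderiv ℝ g x z • v' := by
    intro z
    have a1 : fderiv ℝ φ.u (x₀ + x) = _ := hw.fst.fderiv
    have a2 : fderiv ℝ φ.ρ (x₀ + x) = _ := hw.snd.fst.fderiv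
    have a3 : fderiv ℝ φ.p (x₀ + x) = _ := hw.snd.snd.fderiv
    rw [a1, a2, a3]
    simp
    rfl
  have dψ : ∀ z, (fderiv ℝ ψ.u (x₀ + x) z, fderiv ℝ ψ.ρ (x₀ + x) z, fderiv ℝ ψ.p (x₀ + x) z) =
      (0 : ℝ) • v + (0 : ℝ) • v' := by
    intro z
    simp [hψ, variedField]
  rw [totalTimeDeriv_eq hpos F T φ t (x₀ + x) (hd _ (φ.state_mem _ _)),
    totalTimeDeriv_eq hpos F T ψ t (x₀ + x) (hd _ (ψ.state_mem _ _))]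
  simp only [dφ, dψ, gradCoeff_add_smul, sφ, sψ, mul_zero, add_zero, Finset.sum_const_zero]
  ring

/-- Each field of `IsNull` is `IsConservedDensity.euler_lagrange` for a pair of coordinate
directions. The time equations involve one direction only, and the other is set to zero. -/
lemma IsConservedDensity.isNull (hΩ : IsOpen Ω) (hpos : ∀ p ρ : ℝ, (p, ρ) ∈ Ω → 0 < ρ)
    {F : ℝ × ℝ → ℝ} (hF : ContDiffOn ℝ ∞ F Ω)
    (hF_ne : ∀ W : Set (ℝ × ℝ), W ⊆ Ω → IsOpen W → W.Nonempty → ∃ q ∈ W, F q ≠ 0)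
    {T : KinematicFunction n} (hT : IsConservedDensity F Ω T) :
    (stateRing n hΩ hpos F hF hF_ne).IsNull (restrictSmooth T.onState hT.contDiffOn) := by
  set S := stateRing n hΩ hpos F hF hF_ne with hS
  set G := restrictSmooth T.onState hT.contDiffOn with hG
  have hG' : ContDiffOn ℝ ∞ T.onState (stateDomain n Ω) := hT.1
  have hD := isOpen_stateDomain (n := n) hΩ
  have EL := fun q : stateDomain n Ω => hT.euler_lagrange hΩ hpos hF q.2
  have hSD : ∀ a f, S.D a f = smoothDeriv hD a.vec f := fun a f => rfl
  have hDG : ∀ a, S.D a G = restrictSmooth (fun q => fderiv ℝ T.onState q a.vec)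
      (contDiffOn_fderiv_apply hD hG' a.vec) := fun a => smoothDeriv_restrictSmooth hD _ _
  have cs := fun v i => contDiffOn_gradCoeff hΩ hpos hF hG' v i
  have hU : ∀ i j, S.coeffU G i j =
      restrictSmooth (gradCoeff F T.onState (EuclideanSpace.single j 1, 0, 0) i) (cs _ i) := by
    intro i j
    rw [StateRing.coeffU, StateRing.thermal, hDG, hDG, hDG]
    ext q
    by_cases hij : i = j
    · subst hij
      simp [hS, stateRing, gradCoeff, Direction.vec, thermoFun]
    · simp [hS, stateRing, gradCoeff, Direction.vec, hij, thermoFun]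
  have hR : ∀ i, S.coeffR G i = restrictSmooth (gradCoeff F T.onState (0, 1, 0) i) (cs _ i) := by
    intro i
    rw [StateRing.coeffR, hDG]
    ext q
    simp [hS, stateRing, gradCoeff, Direction.vec]
  have hP : ∀ i, S.coeffP G i = restrictSmooth (gradCoeff F T.onState (0, 0, 1) i) (cs _ i) := by
    intro i
    rw [StateRing.coeffP, hDG, hDG]
    ext q
    simp [hS, stateRing, gradCoeff, Direction.vec]
  constructor
  · intro i
    rw [hR, hP, hSD, hSD, smoothDeriv_restrictSmooth, smoothDeriv_restrictSmooth]
    ext q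
    exact (EL q (0, 0, 1) (0, 1, 0)).2 i
  · intro i j
    rw [hR, hU, hSD, hSD, smoothDeriv_restrictSmooth, smoothDeriv_restrictSmooth]
    ext q
    exact (EL q (0, 1, 0) (EuclideanSpace.single j 1, 0, 0)).2 i
  · intro i j
    rw [hP, hU, hSD, hSD, smoothDeriv_restrictSmooth, smoothDeriv_restrictSmooth]
    ext q
    exact (EL q (0, 0, 1) (EuclideanSpace.single j 1, 0, 0)).2 i
  · intro i j k
    rw [hU, hU, hSD, hSD, smoothDeriv_restrictSmooth, smoothDeriv_restrictSmooth]
    ext q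
    exact (EL q (EuclideanSpace.single k 1, 0, 0) (EuclideanSpace.single j 1, 0, 0)).2 i
  · rw [hDG]
    simp only [hR, hSD, smoothDeriv_restrictSmooth]
    ext q
    simp only [restrictSmooth_apply, AddSubmonoidClass.coe_finsetSum, Finset.sum_apply]
    exact (EL q (0, 1, 0) 0).1
  · intro j
    rw [hDG]
    simp only [hU, hSD, smoothDeriv_restrictSmooth]
    ext q
    simp only [restrictSmooth_apply, AddSubmonoidClass.coe_finsetSum, Finset.sum_apply]
    exact (EL q (EuclideanSpace.single j 1, 0, 0) 0).1
  · rw [hDG]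
    simp only [hP, hSD, smoothDeriv_restrictSmooth]
    ext q
    simp only [restrictSmooth_apply, AddSubmonoidClass.coe_finsetSum, Finset.sum_apply]
    exact (EL q (0, 0, 1) 0).1

end Conserved

/-! ### Solution of the determining equations -/

section Slices

variable {Z W : Type*} [NormedAddCommGroup Z] [NormedSpace ℝ Z] [NormedAddCommGroup W]
  [NormedSpace ℝ W] {D : Set Z}

lemma hasFDerivAt_extendZero_slice (hD : IsOpen D) (ι : W →L[ℝ] Z) (z : Z) (f : smoothAlgebra D)
    {w : W} (hw : z + ι w ∈ D) :
    HasFDerivAt (fun w => extendZero f.1 (z + ι w)) (fderiv ℝ (extendZero f.1) (z + ι w) ∘L ι) w :=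
  HasFDerivAt.comp (g := extendZero f.1) w (smoothAlgebra_differentiableAt hD f ⟨_, hw⟩).hasFDerivAt
    (ι.hasFDerivAt.const_add z)

/-- Two smooth functions with the same derivatives along two parallel connected slices differ by a
constant there. -/
lemma slice_sub_eq (hD : IsOpen D) (ι : W →L[ℝ] Z) (z z' : Z) (f g : smoothAlgebra D) {U : Set W}
    (hU : IsOpen U) (hc : IsPreconnected U) (h : ∀ w ∈ U, z + ι w ∈ D) (h' : ∀ w ∈ U, z' + ι w ∈ D)
    (hd : ∀ w (hw : w ∈ U) v, (smoothDeriv hD (ι v) f).1 ⟨_, h w hw⟩ =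
      (smoothDeriv hD (ι v) g).1 ⟨_, h' w hw⟩) {w w' : W} (hw : w ∈ U) (hw' : w' ∈ U) :
    f.1 ⟨_, h w hw⟩ - g.1 ⟨_, h' w hw⟩ = f.1 ⟨_, h w' hw'⟩ - g.1 ⟨_, h' w' hw'⟩ := by
  have h1 := fun w hw => hasFDerivAt_extendZero_slice hD ι z f (h w hw)
  have h2 := fun w hw => hasFDerivAt_extendZero_slice hD ι z' g (h' w hw)
  obtain ⟨a, ha⟩ := hU.exists_is_const_of_fderiv_eq_zero hc
    (f := fun w => extendZero f.1 (z + ι w) - extendZero g.1 (z' + ι w))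
    (fun w hw => ((h1 w hw).sub (h2 w hw)).differentiableAt.differentiableWithinAt)
    (fun w hw => by
      have h3 : fderiv ℝ (fun w => extendZero f.1 (z + ι w) - extendZero g.1 (z' + ι w)) w = _ :=
        ((h1 w hw).sub (h2 w hw)).fderiv
      rw [h3]
      ext v
      have := hd w hw v
      rw [smoothDeriv_apply, smoothDeriv_apply] at this
      simp [this])
  have e1 := ha w hw
  have e2 := ha w' hw'
  simp only [extendZero_of_mem _ (h _ hw), extendZero_of_mem _ (h _ hw'),
    extendZero_of_mem _ (h' _ hw), extendZero_of_mem _ (h' _ hw')] at e1 e2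
  rw [e1, e2]

lemma slice_eq (hD : IsOpen D) (ι : W →L[ℝ] Z) (z : Z) (f : smoothAlgebra D) {U : Set W}
    (hU : IsOpen U) (hc : IsPreconnected U) (h : ∀ w ∈ U, z + ι w ∈ D)
    (hd : ∀ w (hw : w ∈ U) v, (smoothDeriv hD (ι v) f).1 ⟨_, h w hw⟩ = 0)
    {w w' : W} (hw : w ∈ U) (hw' : w' ∈ U) : f.1 ⟨_, h w hw⟩ = f.1 ⟨_, h w' hw'⟩ := by
  have := slice_sub_eq hD ι z z f 0 hU hc h h (fun w hw v => by simp [hd w hw v]) hw hw'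
  simpa using this

end Slices

/-! ### Functions of some of the variables and separation of variables -/

section Classification

variable {n : ℕ} {Ω : Set (ℝ × ℝ)}

lemma clm_state_apply (L : State n →L[ℝ] ℝ) (t : ℝ) (x u : Space n) (ρ p : ℝ) :
    L (t, x, u, ρ, p) = t * L Direction.t.vec + ∑ i, x i * L (Direction.x i).vec
      + ∑ i, u i * L (Direction.u i).vec + ρ * L Direction.r.vec + p * L Direction.p.vec := by
  have hx := clm_apply_eq_sum (L ∘L spaceIncl n) x
  have hu := clm_apply_eq_sum (L ∘L ContinuousLinearMap.inr ℝ ℝ (Space n × Space n × ℝ × ℝ) ∘L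
      ContinuousLinearMap.inr ℝ (Space n) (Space n × ℝ × ℝ) ∘L
      ContinuousLinearMap.inl ℝ (Space n) (ℝ × ℝ)) u
  simp only [smul_eq_mul, ContinuousLinearMap.comp_apply, spaceIncl_apply,
    ContinuousLinearMap.inr_apply, ContinuousLinearMap.inl_apply] at hx hu
  have : ((t, x, u, ρ, p) : State n) = t • (Direction.t.vec : State n) + (0, x, 0)
      + (0, 0, u, 0) + ρ • (Direction.r.vec : State n) + p • (Direction.p.vec : State n) := by
    simp [Direction.vec]
  rw [this, map_add, map_add, map_add, map_add, map_smul, map_smul, map_smul, hx, hu]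
  rfl

variable (hΩ : IsOpen Ω)

/-- The position component `xʲ` as a linear function on the space of states. -/
def positionProj (j : Fin n) : State n →L[ℝ] ℝ :=
  EuclideanSpace.proj j ∘L ContinuousLinearMap.fst ℝ (Space n) (Space n × ℝ × ℝ) ∘L
    ContinuousLinearMap.snd ℝ ℝ (Space n × Space n × ℝ × ℝ)

@[simp] lemma positionProj_apply (j : Fin n) (q : State n) : positionProj j q = q.2.1 j := rfl

/-- The restriction of a linear function to the states. -/
def linearElt (Ω : Set (ℝ × ℝ)) (l : State n →L[ℝ] ℝ) : smoothAlgebra (stateDomain n Ω) :=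
  restrictSmooth l l.contDiff.contDiffOn

@[simp] lemma linearElt_apply (l : State n →L[ℝ] ℝ) (q : stateDomain n Ω) :
    (linearElt Ω l).1 q = l q := rfl

/-- The position component `xʲ` in the differential ring. -/
abbrev posElt (Ω : Set (ℝ × ℝ)) (j : Fin n) := linearElt Ω (positionProj j)

/-- The time `t` in the differential ring. -/
abbrev timeElt (n : ℕ) (Ω : Set (ℝ × ℝ)) :=
  linearElt Ω (ContinuousLinearMap.fst ℝ ℝ (Space n × Space n × ℝ × ℝ))

/-- The pressure `p` in the differential ring. -/
abbrev pressureElt (n : ℕ) (Ω : Set (ℝ × ℝ)) :=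
  linearElt Ω (ContinuousLinearMap.fst ℝ ℝ ℝ ∘L thermoProj n)

variable (hpos : ∀ p ρ : ℝ, (p, ρ) ∈ Ω → 0 < ρ) {F : ℝ × ℝ → ℝ} (hF : ContDiffOn ℝ ∞ F Ω)
  (hF_ne : ∀ W : Set (ℝ × ℝ), W ⊆ Ω → IsOpen W → W.Nonempty → ∃ q ∈ W, F q ≠ 0)

lemma D_linearElt (a : Direction n) (l : State n →L[ℝ] ℝ) :
    (stateRing n hΩ hpos F hF hF_ne).D a (linearElt Ω l) = algebraMap ℝ _ (l a.vec) :=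
  smoothDeriv_clm (isOpen_stateDomain hΩ) l _

lemma stateRing_D_expand (f : smoothAlgebra (stateDomain n Ω)) (q : stateDomain n Ω)
    (t : ℝ) (x u : Space n) (ρ p : ℝ) :
    (smoothDeriv (isOpen_stateDomain hΩ) (t, x, u, ρ, p) f).1 q =
      t * ((stateRing n hΩ hpos F hF hF_ne).D .t f).1 q
      + ∑ i, x i * ((stateRing n hΩ hpos F hF hF_ne).D (.x i) f).1 q
      + ∑ i, u i * ((stateRing n hΩ hpos F hF hF_ne).D (.u i) f).1 q
      + ρ * ((stateRing n hΩ hpos F hF hF_ne).D .r f).1 q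
      + p * ((stateRing n hΩ hpos F hF hF_ne).D .p f).1 q := by
  rw [smoothDeriv_apply, clm_state_apply]
  rfl

/-- An element of the differential ring with vanishing derivatives is a constant. -/
lemma eq_algebraMap_of_D_eq_zero (hc : IsPreconnected Ω) (f : smoothAlgebra (stateDomain n Ω))
    (h : ∀ a, (stateRing n hΩ hpos F hF hF_ne).D a f = 0) (q : stateDomain n Ω) :
    f = algebraMap ℝ _ (f.1 q) := by
  ext q'
  refine smoothAlgebra_const (isOpen_stateDomain hΩ) (isPreconnected_stateDomain hc) f
    (fun v => ?_) q' q
  obtain ⟨t, x, u, ρ, p⟩ := v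
  ext z
  rw [stateRing_D_expand hΩ hpos hF hF_ne]
  simp [h]

/-- The inclusion of the fluid variables `(u, ρ, p)`. -/
def fluidIncl (n : ℕ) : Space n × ℝ × ℝ →L[ℝ] State n :=
  ContinuousLinearMap.inr ℝ ℝ (Space n × Space n × ℝ × ℝ) ∘L
    ContinuousLinearMap.inr ℝ (Space n) (Space n × ℝ × ℝ)

/-- The inclusion of space-time. -/
def spacetimeIncl (n : ℕ) : ℝ × Space n →L[ℝ] State n :=
  (ContinuousLinearMap.fst ℝ ℝ (Space n)).prod
    (ContinuousLinearMap.inl ℝ (Space n) (Space n × ℝ × ℝ) ∘L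
      ContinuousLinearMap.snd ℝ ℝ (Space n))

lemma isOpen_fluidSet (hΩ : IsOpen Ω) :
    IsOpen {w : Space n × ℝ × ℝ | (w.2.2, w.2.1) ∈ Ω} := hΩ.preimage (by fun_prop)

lemma isPreconnected_fluidSet (hc : IsPreconnected Ω) :
    IsPreconnected {w : Space n × ℝ × ℝ | (w.2.2, w.2.1) ∈ Ω} := by
  have h2 := (isPreconnected_univ.prod hc).image (fun q : Space n × ℝ × ℝ =>
    (q.1, q.2.2, q.2.1)) (by fun_prop)
  convert h2
  ext ⟨u, ρ, p⟩
  simp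

include hpos hF hF_ne in
/-- A function which does not depend differentially on the fluid variables depends only on
`(t, x)`. -/
lemma eq_of_D_fluid_eq_zero (hc : IsPreconnected Ω) (f : smoothAlgebra (stateDomain n Ω))
    (hu : ∀ i, (stateRing n hΩ hpos F hF hF_ne).D (.u i) f = 0)
    (hr : (stateRing n hΩ hpos F hF hF_ne).D .r f = 0)
    (hp : (stateRing n hΩ hpos F hF hF_ne).D .p f = 0) (t : ℝ) (x : Space n)
    {w w' : Space n × ℝ × ℝ} (hw : (w.2.2, w.2.1) ∈ Ω) (hw' : (w'.2.2, w'.2.1) ∈ Ω) :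
    f.1 ⟨(t, x, w), hw⟩ = f.1 ⟨(t, x, w'), hw'⟩ := by
  have key : ∀ w : Space n × ℝ × ℝ, ((t, x, w) : State n) = (t, x, 0) + fluidIncl n w := by
    intro w; simp [fluidIncl]
  have hm : ∀ w ∈ {w : Space n × ℝ × ℝ | (w.2.2, w.2.1) ∈ Ω},
      (t, x, 0) + fluidIncl n w ∈ stateDomain n Ω := by
    intro w hw
    rw [← key]; exact hw
  have := slice_eq (isOpen_stateDomain hΩ) (fluidIncl n) (t, x, 0) f (isOpen_fluidSet hΩ)
    (isPreconnected_fluidSet hc) hm (fun w hw v => by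
      obtain ⟨u, ρ, p⟩ := v
      have := stateRing_D_expand hΩ hpos hF hF_ne f ⟨_, hm w hw⟩ 0 0 u ρ p
      simp only [hu, hr, hp] at this
      exact this.trans (by simp)) hw hw'
  simpa only [← key] using this

include hpos hF hF_ne in
/-- A function which does not depend differentially on `(t, x)` depends only on the fluid
variables. -/
lemma eq_of_D_spacetime_eq_zero (f : smoothAlgebra (stateDomain n Ω))
    (ht : (stateRing n hΩ hpos F hF hF_ne).D .t f = 0)
    (hx : ∀ i, (stateRing n hΩ hpos F hF hF_ne).D (.x i) f = 0) (t t' : ℝ) (x x' : Space n)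
    {w : Space n × ℝ × ℝ} (hw : (w.2.2, w.2.1) ∈ Ω) :
    f.1 ⟨(t, x, w), hw⟩ = f.1 ⟨(t', x', w), hw⟩ := by
  have key : ∀ y : ℝ × Space n, ((y.1, y.2, w) : State n) = (0, 0, w) + spacetimeIncl n y := by
    intro y; simp [spacetimeIncl]
  have hm : ∀ y ∈ (Set.univ : Set (ℝ × Space n)),
      (0, 0, w) + spacetimeIncl n y ∈ stateDomain n Ω := by
    intro y _
    rw [← key]; exact hw
  have := slice_eq (isOpen_stateDomain hΩ) (spacetimeIncl n) (0, 0, w) f isOpen_univ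
    isPreconnected_univ hm (fun y hy v => by
      obtain ⟨s, z⟩ := v
      have := stateRing_D_expand hΩ hpos hF hF_ne f ⟨_, hm y hy⟩ s z 0 0 0
      simp only [ht, hx] at this
      exact this.trans (by simp)) (w := (t, x)) (w' := (t', x')) trivial trivial
  simpa only [← key] using this

include hpos hF hF_ne in
/-- Separation of the variables `(t, x)` from the thermodynamic variables. -/
lemma separation_of_variables (hc : IsPreconnected Ω) (K : smoothAlgebra (stateDomain n Ω))
    (hu : ∀ i, (stateRing n hΩ hpos F hF hF_ne).D (.u i) K = 0)
    (hrt : (stateRing n hΩ hpos F hF hF_ne).D .r ((stateRing n hΩ hpos F hF hF_ne).D .t K) = 0)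
    (hpt : (stateRing n hΩ hpos F hF hF_ne).D .p ((stateRing n hΩ hpos F hF hF_ne).D .t K) = 0)
    (hrx : ∀ i, (stateRing n hΩ hpos F hF hF_ne).D .r
      ((stateRing n hΩ hpos F hF hF_ne).D (.x i) K) = 0)
    (hpx : ∀ i, (stateRing n hΩ hpos F hF hF_ne).D .p
      ((stateRing n hΩ hpos F hF hF_ne).D (.x i) K) = 0)
    {ρ p ρ₀ p₀ : ℝ} (h : (p, ρ) ∈ Ω) (h₀ : (p₀, ρ₀) ∈ Ω) (t : ℝ) (x u : Space n) :
    K.1 ⟨(t, x, u, ρ, p), h⟩ = K.1 ⟨(0, 0, 0, ρ, p), h⟩ + K.1 ⟨(t, x, 0, ρ₀, p₀), h₀⟩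
      - K.1 ⟨(0, 0, 0, ρ₀, p₀), h₀⟩ := by
  set S := stateRing n hΩ hpos F hF hF_ne with hS
  have key : ∀ (t : ℝ) (x : Space n) (w : Space n × ℝ × ℝ),
      ((t, x, w) : State n) = (t, x, 0) + fluidIncl n w := by
    intro t x w; simp [fluidIncl]
  have hm : ∀ (t : ℝ) (x : Space n), ∀ w ∈ {w : Space n × ℝ × ℝ | (w.2.2, w.2.1) ∈ Ω},
      (t, x, 0) + fluidIncl n w ∈ stateDomain n Ω := by
    intro t x w hw
    rw [← key]; exact hw
  have hr' : ∀ (w : Space n × ℝ × ℝ) (hw : (w.2.2, w.2.1) ∈ Ω),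
      (S.D .r K).1 ⟨(t, x, w), hw⟩ = (S.D .r K).1 ⟨(0, 0, w), hw⟩ := fun w hw =>
    eq_of_D_spacetime_eq_zero hΩ hpos hF hF_ne (S.D .r K) (by rw [← hS, S.comm, hrt])
      (fun i => by rw [← hS, S.comm, hrx]) _ _ _ _ hw
  have hp' : ∀ (w : Space n × ℝ × ℝ) (hw : (w.2.2, w.2.1) ∈ Ω),
      (S.D .p K).1 ⟨(t, x, w), hw⟩ = (S.D .p K).1 ⟨(0, 0, w), hw⟩ := fun w hw =>
    eq_of_D_spacetime_eq_zero hΩ hpos hF hF_ne (S.D .p K) (by rw [← hS, S.comm, hpt])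
      (fun i => by rw [← hS, S.comm, hpx]) _ _ _ _ hw
  -- The restrictions of `K` to the fluid slices over `(t, x)` and over `(0, 0)` have equal
  -- derivatives, so their difference is constant along the connected slice.
  have step : ∀ u : Space n, K.1 ⟨(t, x, u, ρ, p), h⟩ - K.1 ⟨(0, 0, u, ρ, p), h⟩ =
      K.1 ⟨(t, x, 0, ρ₀, p₀), h₀⟩ - K.1 ⟨(0, 0, 0, ρ₀, p₀), h₀⟩ := by
    intro u
    have := slice_sub_eq (isOpen_stateDomain hΩ) (fluidIncl n) (t, x, 0) (0, 0, 0) K K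
      (isOpen_fluidSet hΩ) (isPreconnected_fluidSet hc) (hm t x) (hm 0 0) (fun w hw v => by
        obtain ⟨v, r, s⟩ := v
        have e1 := stateRing_D_expand hΩ hpos hF hF_ne K ⟨_, hm t x w hw⟩ 0 0 v r s
        have e2 := stateRing_D_expand hΩ hpos hF hF_ne K ⟨_, hm 0 0 w hw⟩ 0 0 v r s
        have e3 := hr' w hw
        have e4 := hp' w hw
        simp only [key t x w, key 0 0 w] at e3 e4
        rw [← hS] at e1 e2
        simp only [hu, e3, e4, zero_mul, mul_zero, Finset.sum_const_zero, PiLp.zero_apply,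
          ZeroMemClass.coe_zero, Pi.zero_apply] at e1 e2
        exact e1.trans e2.symm) (w := (u, ρ, p)) (w' := (0, ρ₀, p₀)) h h₀
    simpa only [← key] using this
  have key2 : ∀ u : Space n, ((0, 0, u, ρ, p) : State n) = (0, 0, 0, ρ, p) +
      (fluidIncl n ∘L ContinuousLinearMap.inl ℝ (Space n) (ℝ × ℝ)) u := by
    intro u; simp [fluidIncl]
  have hm2 : ∀ u ∈ (Set.univ : Set (Space n)), (0, 0, 0, ρ, p) +
      (fluidIncl n ∘L ContinuousLinearMap.inl ℝ (Space n) (ℝ × ℝ)) u ∈ stateDomain n Ω := by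
    intro u _
    rw [← key2]; exact h
  have hu' := slice_eq (isOpen_stateDomain hΩ)
    (fluidIncl n ∘L ContinuousLinearMap.inl ℝ (Space n) (ℝ × ℝ)) (0, 0, 0, ρ, p) K isOpen_univ
    isPreconnected_univ hm2 (fun u hu0 v => by
      have := stateRing_D_expand hΩ hpos hF hF_ne K ⟨_, hm2 u hu0⟩ 0 0 v 0 0
      rw [← hS] at this
      simp only [hu] at this
      exact this.trans (by simp)) (w := u) (w' := 0) trivial trivial
  simp only [← key2] at hu'
  linarith [step u]

end Classification

/-! ### Normal form of densities with stationary energy coefficient -/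

section NormalForm

variable {n : ℕ} {Ω : Set (ℝ × ℝ)}

/-- The normal form of a density whose energy coefficient is constant; `s` combines mass, entropy
and internal energy. -/
def HasNormalForm (F : ℝ × ℝ → ℝ) (Ω : Set (ℝ × ℝ)) (T : KinematicFunction n) (b : ℝ) : Prop :=
  ∃ (a : Fin n → ℝ) (A : Fin n → Fin n → ℝ) (g : Fin n → ℝ) (s : ℝ × ℝ → ℝ) (c : ℝ × Space n → ℝ),
    ContDiffOn ℝ ∞ s Ω ∧
    (∀ p ρ : ℝ, (p, ρ) ∈ Ω → ρ * deriv (fun r => s (p, r)) ρ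
      + F (p, ρ) * deriv (fun q => s (q, ρ)) p = b * (p / ρ)) ∧
    ContDiff ℝ ∞ c ∧
    ∀ (t : ℝ) (x u : Space n) (ρ p : ℝ), (p, ρ) ∈ Ω →
      T t x u ρ p = ∑ i, a i * momentum i t x u ρ p
        + ∑ i, ∑ j, A i j * angularMomentum i j t x u ρ p
        + ∑ i, g i * galileanMomentum i t x u ρ p
        + ρ * (b * (1 / 2 * ‖u‖ ^ 2) + s (p, ρ)) + c (t, x)

variable (hΩ : IsOpen Ω) (hpos : ∀ p ρ : ℝ, (p, ρ) ∈ Ω → 0 < ρ) {F : ℝ × ℝ → ℝ}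
  (hF : ContDiffOn ℝ ∞ F Ω)
  (hF_ne : ∀ W : Set (ℝ × ℝ), W ⊆ Ω → IsOpen W → W.Nonempty → ∃ q ∈ W, F q ≠ 0)

lemma coe_sum_apply {ι : Type*} (D : Set (State n)) (I : Finset ι) (f : ι → smoothAlgebra D)
    (q : D) : (∑ i ∈ I, f i).1 q = ∑ i ∈ I, (f i).1 q := by
  simp [AddSubmonoidClass.coe_finsetSum]

lemma norm_sq_eq_sum (u : Space n) : ‖u‖ ^ 2 = ∑ i, u i ^ 2 := by
  simp [EuclideanSpace.norm_sq_eq]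

lemma sum_mul_neg {R : Type*} [CommRing R] (f g : Fin n → R) :
    ∑ i, f i * -g i = -∑ i, f i * g i := by
  simp

section Elements

variable (S : StateRing n (smoothAlgebra (stateDomain n Ω)))
  (hS : S = stateRing n hΩ hpos F hF hF_ne)
include hS

lemma D_posElt (a : Direction n) (k : Fin n) : S.D a (posElt Ω k) =
    match a with
    | .x i => if i = k then 1 else 0
    | _ => 0 := by
  subst hS
  rw [D_linearElt]
  cases a with
  | x i =>
    by_cases h : i = k
    · subst h; simp [Direction.vec]
    · simp [Direction.vec, h, Ne.symm h]
  | _ => simp [Direction.vec]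

lemma D_timeElt (a : Direction n) : S.D a (timeElt n Ω) =
    match a with
    | .t => 1
    | _ => 0 := by
  subst hS
  rw [D_linearElt]
  cases a <;> simp [Direction.vec]

lemma D_pressureElt (a : Direction n) : S.D a (pressureElt n Ω) =
    match a with
    | .p => 1
    | _ => 0 := by
  subst hS
  rw [D_linearElt]
  cases a <;> simp [Direction.vec]

end Elements

/-- The specific momentum part of a density in normal form. -/
def momentumPart (S : StateRing n (smoothAlgebra (stateDomain n Ω))) (b : ℝ) (a : Fin n → ℝ)
    (M : Fin n → Fin n → ℝ) (g : Fin n → ℝ) : smoothAlgebra (stateDomain n Ω) :=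
  algebraMap ℝ _ (b / 2) * ∑ j, S.u j ^ 2 + ∑ j, algebraMap ℝ _ (a j) * S.u j
    + ∑ j, ∑ k, algebraMap ℝ _ (M j k) * (S.u j * posElt Ω k)
    + ∑ j, algebraMap ℝ _ (g j) * (timeElt n Ω * S.u j - posElt Ω j)

section MomentumPart

variable {S : StateRing n (smoothAlgebra (stateDomain n Ω))}
  (hS : S = stateRing n hΩ hpos F hF hF_ne) (b : ℝ) (a : Fin n → ℝ)
    (M : Fin n → Fin n → ℝ) (g : Fin n → ℝ)
include hS

lemma momentumPart_r : S.D .r (momentumPart S b a M g) = 0 := by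
  simp [momentumPart, D_posElt hΩ hpos hF hF_ne S hS, D_timeElt hΩ hpos hF hF_ne S hS,
    Derivation.leibniz_pow, Derivation.leibniz]

lemma momentumPart_p : S.D .p (momentumPart S b a M g) = 0 := by
  simp [momentumPart, D_posElt hΩ hpos hF hF_ne S hS, D_timeElt hΩ hpos hF hF_ne S hS,
    Derivation.leibniz_pow, Derivation.leibniz]

lemma momentumPart_t : S.D .t (momentumPart S b a M g) =
    ∑ j, algebraMap ℝ _ (g j) * S.u j := by
  simp [momentumPart, D_posElt hΩ hpos hF hF_ne S hS, D_timeElt hΩ hpos hF hF_ne S hS,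
    Derivation.leibniz_pow, Derivation.leibniz]

lemma momentumPart_x (i : Fin n) : S.D (.x i) (momentumPart S b a M g) =
    ∑ j, algebraMap ℝ _ (M j i) * S.u j - algebraMap ℝ _ (g i) := by
  simp [momentumPart, D_posElt hΩ hpos hF hF_ne S hS, D_timeElt hΩ hpos hF hF_ne S hS,
    Derivation.leibniz_pow, Derivation.leibniz, sub_eq_add_neg]
  rw [sum_mul_neg]
  simp

lemma momentumPart_u (i : Fin n) : S.D (.u i) (momentumPart S b a M g) =
    algebraMap ℝ _ b * S.u i + algebraMap ℝ _ (a i)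
      + ∑ k, algebraMap ℝ _ (M i k) * posElt Ω k + algebraMap ℝ _ (g i) * timeElt n Ω := by
  have e : (algebraMap ℝ (smoothAlgebra (stateDomain n Ω)) (b / 2)) * (2 * S.u i) =
      algebraMap ℝ _ b * S.u i := by
    have : algebraMap ℝ (smoothAlgebra (stateDomain n Ω)) b = algebraMap ℝ _ (b / 2) * 2 := by
      rw [← map_ofNat (algebraMap ℝ (smoothAlgebra (stateDomain n Ω))) 2, ← map_mul]
      congr 1
      ring
    rw [this]; ring
  have hs : ∑ j, ∑ k, algebraMap ℝ (smoothAlgebra (stateDomain n Ω)) (M j k) *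
      (posElt Ω k * if i = j then 1 else 0) = ∑ k, algebraMap ℝ _ (M i k) * posElt Ω k := by
    rw [Finset.sum_comm]
    simp
  simp only [momentumPart, map_add, map_sub, map_sum, Derivation.leibniz, smul_eq_mul,
    Derivation.map_algebraMap, StateRing.D_u_u, D_posElt hΩ hpos hF hF_ne S hS,
    D_timeElt hΩ hpos hF hF_ne S hS, Derivation.leibniz_pow, mul_zero, add_zero, zero_add, sub_zero,
    hs]
  simp only [← e]
  simp

omit hS in
lemma momentumPart_apply (hu : ∀ j q, (S.u j).1 q = q.1.2.2.1 j) (t : ℝ) (x u : Space n) (ρ p : ℝ)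
    (h : (p, ρ) ∈ Ω) : (momentumPart S b a M g).1 ⟨(t, x, u, ρ, p), h⟩ =
      b * (1 / 2 * ‖u‖ ^ 2) + ∑ j, a j * u j + ∑ j, ∑ k, M j k * (u j * x k)
        + ∑ j, g j * (t * u j - x j) := by
  have hC : ∀ (c : ℝ) q, (algebraMap ℝ (smoothAlgebra (stateDomain n Ω)) c).1 q = c :=
    fun c q => rfl
  simp only [momentumPart, Subalgebra.coe_add, Pi.add_apply, coe_sum_apply, Subalgebra.coe_mul,
    Pi.mul_apply, hC, hu, Subalgebra.coe_sub, Pi.sub_apply, linearElt_apply, positionProj_apply,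
    norm_sq_eq_sum, Subalgebra.coe_pow, Pi.pow_apply, ContinuousLinearMap.coe_fst']
  ring

end MomentumPart

/-- A conserved density with stationary energy coefficient has the normal form. -/
lemma IsConservedDensity.hasNormalForm (hn : 1 < n) (hc : IsConnected Ω) {T : KinematicFunction n}
    (hT : IsConservedDensity F Ω T)
    (hβ : (stateRing n hΩ hpos F hF hF_ne).D .t ((stateRing n hΩ hpos F hF hF_ne).energyCoeff
      (restrictSmooth T.onState hT.contDiffOn)) = 0) : ∃ b, HasNormalForm F Ω T b := by
  have h := hT.isNull hΩ hpos hF hF_ne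
  obtain ⟨⟨p₀, ρ₀⟩, h₀⟩ := hc.nonempty
  have hpc := hc.isPreconnected
  set S := stateRing n hΩ hpos F hF hF_ne with hS
  set G := restrictSmooth T.onState hT.contDiffOn with hG
  have hconst : ∀ f : smoothAlgebra (stateDomain n Ω), (∀ a, S.D a f = 0) → ∃ c : ℝ,
      f = algebraMap ℝ _ c := fun f hf =>
    ⟨_, eq_algebraMap_of_D_eq_zero hΩ hpos hF hF_ne hpc f hf ⟨(0, 0, 0, ρ₀, p₀), h₀⟩⟩
  have hu : ∀ j q, (S.u j).1 q = q.1.2.2.1 j := fun j q => rfl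
  obtain ⟨b, hb⟩ := hconst (S.energyCoeff G) (fun a => by
    cases a with
    | t => exact hβ
    | x i => exact h.energyCoeff_x hn i
    | u i => exact h.energyCoeff_u hn i
    | r => exact h.energyCoeff_r hn
    | p => exact h.energyCoeff_p hn)
  have htx : ∀ j k, S.D (.x k) (S.D .t (S.specificMomentum G j)) = 0 := fun j k =>
    StateRing.eq_zero_of_two_mul (by rw [h.momentum_t_x hn, hβ]; simp)
  -- Once `β` is a constant `b`, all derivatives of `∂ₖνⱼ` and of `∂ₜνⱼ` vanish too, so `ν` is
  -- affine in `(t, x, u)`.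
  have hM : ∀ j k, ∃ c : ℝ, S.D (.x k) (S.specificMomentum G j) = algebraMap ℝ _ c := by
    refine fun j k => hconst _ fun a => ?_
    cases a with
    | t => rw [S.comm]; exact htx j k
    | x i => exact h.momentum_x_x hn j k i
    | u i => rw [S.comm, h.momentum_u]; split_ifs <;> simp [hb]
    | r => rw [S.comm, h.momentum_r, map_zero]
    | p => rw [S.comm, h.momentum_p hn, map_zero]
  choose M hM using hM
  have hg : ∀ j, ∃ c : ℝ, S.D .t (S.specificMomentum G j) = algebraMap ℝ _ c := by
    refine fun j => hconst _ fun a => ?_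
    cases a with
    | t => rw [h.momentum_t_t hn, hβ]; simp
    | x i => exact htx j i
    | u i => rw [S.comm, h.momentum_u]; split_ifs <;> simp [hb]
    | r => rw [S.comm, h.momentum_r, map_zero]
    | p => rw [S.comm, h.momentum_p hn, map_zero]
  choose g hg using hg
  have hanti : ∀ j k, algebraMap ℝ (smoothAlgebra (stateDomain n Ω)) (M j k) =
      -algebraMap ℝ _ (M k j) := by
    intro j k
    have := h.momentum_x_symm hn j k
    rw [hM, hM, hβ] at this
    simp only [neg_zero, ite_self] at this
    linear_combination this
  have hanti' : ∀ j k, M j k = -M k j := by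
    intro j k
    have := congrArg (fun f : smoothAlgebra (stateDomain n Ω) =>
      f.1 ⟨(0, 0, 0, ρ₀, p₀), h₀⟩) (hanti j k)
    exact this
  -- The part with `a = 0` already has all the first derivatives of `νⱼ`. The constant left over is
  -- the coefficient of linear momentum.
  have ha : ∀ j, ∃ c : ℝ, S.specificMomentum G j
      - S.D (.u j) (momentumPart S b (fun _ => 0) M g) = algebraMap ℝ _ c := by
    refine fun j => hconst _ fun a => ?_
    rw [momentumPart_u hΩ hpos hF hF_ne hS]
    simp only [map_sub, map_add, map_sum, Derivation.leibniz, smul_eq_mul, Derivation.map_algebraMap,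
      D_posElt hΩ hpos hF hF_ne S hS, D_timeElt hΩ hpos hF hF_ne S hS]
    cases a with
    | t => simp [hg]
    | x i => simp [hM]
    | u i => rw [h.momentum_u]; simp [hb, eq_comm]
    | r => simp [h.momentum_r]
    | p => simp [h.momentum_p hn]
  choose a ha using ha
  have hν : ∀ j, S.specificMomentum G j = S.D (.u j) (momentumPart S b a M g) := by
    intro j
    have := ha j
    rw [momentumPart_u hΩ hpos hF hF_ne hS] at this ⊢
    rw [map_zero] at this
    linear_combination this
  set P := momentumPart S b a M g with hP
  have Pr : S.D .r P = 0 := momentumPart_r hΩ hpos hF hF_ne hS b a M g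
  have Pp : S.D .p P = 0 := momentumPart_p hΩ hpos hF hF_ne hS b a M g
  have Pt : S.D .t P = _ := momentumPart_t hΩ hpos hF hF_ne hS b a M g
  have Px : ∀ i, S.D (.x i) P = _ := momentumPart_x hΩ hpos hF hF_ne hS b a M g
  -- `ρ P` carries all of the `u`-dependence, and it also matches the mixed derivatives of `G` in
  -- `(t, x)` and `(ρ, p)`. Hence `K` satisfies the hypotheses of `separation_of_variables`.
  set K := G - S.r * P with hK
  -- `ρ P` is homogeneous of degree one in `ρ` and free of `p`, so `ρ ∂_ρ + F ∂_p - 1` annihilates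
  -- it.
  have hleg : S.legendre K = S.legendre G := by
    simp only [StateRing.legendre, StateRing.thermal, hK, map_sub, Derivation.leibniz, smul_eq_mul,
      Pr, Pp, StateRing.D_r_r, StateRing.D_p_r]
    ring
  have sep := fun {ρ p : ℝ} (hp : (p, ρ) ∈ Ω) => separation_of_variables hΩ hpos hF hF_ne hpc K
    (fun i => by
      rw [← hS, hK, map_sub, Derivation.leibniz, StateRing.D_u_r, ← hν, StateRing.D_u_eq]
      simp)
    (by
      have := h.D_r_t_eq hn
      rw [hβ] at this
      rw [← hS]
      apply StateRing.eq_zero_of_two_mul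
      simp only [hK, map_sub, Derivation.leibniz, smul_eq_mul, StateRing.D_t_r, Pt, mul_zero,
        add_zero, StateRing.D_r_r, map_sum, Derivation.map_algebraMap, StateRing.D_r_u,
        Finset.sum_const_zero]
      simp only [hg] at this
      rw [mul_sub, this]
      simp only [mul_comm]
      ring)
    (by
      have := h.D_p_t hn
      rw [hβ] at this
      rw [← hS]
      apply StateRing.eq_zero_of_two_mul
      simp only [hK, map_sub, Derivation.leibniz, smul_eq_mul, StateRing.D_t_r, Pt, mul_zero,
        add_zero, StateRing.D_p_r, map_sum, Derivation.map_algebraMap, StateRing.D_p_u,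
        Finset.sum_const_zero]
      rw [mul_sub, this]
      simp)
    (fun i => by
      have := h.D_r_x i
      simp only [hg, hM, hanti i] at this
      rw [← hS]
      simp only [hK, map_sub, Derivation.leibniz, smul_eq_mul, StateRing.D_x_r, Px, mul_zero,
        add_zero, StateRing.D_r_r, map_sum, Derivation.map_algebraMap, StateRing.D_r_u,
        Finset.sum_const_zero, this]
      rw [sum_mul_neg]
      simp only [mul_comm]
      ring)
    (fun i => by
      rw [← hS]
      simp only [hK, map_sub, Derivation.leibniz, smul_eq_mul, StateRing.D_x_r, Px, mul_zero,
        add_zero, StateRing.D_p_r, map_sum, Derivation.map_algebraMap, StateRing.D_p_u,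
        Finset.sum_const_zero, h.D_p_x hn]
      simp)
    hp h₀
  -- At `t = 0`, `x = 0` the function `legendre G - b p` takes this one value for all fluid states.
  set k : ℝ := (S.legendre G).1 ⟨(0, 0, 0, ρ₀, p₀), h₀⟩ - b * p₀ with hk
  have hthermo : ∀ {ρ p : ℝ} (hp : (p, ρ) ∈ Ω),
      ρ * (S.D .r K).1 ⟨(0, 0, 0, ρ, p), hp⟩ + F (p, ρ) * (S.D .p K).1 ⟨(0, 0, 0, ρ, p), hp⟩
        - K.1 ⟨(0, 0, 0, ρ, p), hp⟩ = b * p + k := by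
    intro ρ p hp
    have := eq_of_D_fluid_eq_zero hΩ hpos hF hF_ne hpc
      (S.legendre G - algebraMap ℝ _ b * pressureElt n Ω)
      (fun i => by
        rw [← hS]; simp [h.legendre_u hn, D_pressureElt hΩ hpos hF hF_ne S hS])
      (by rw [← hS]; simp [h.legendre_r hn, D_pressureElt hΩ hpos hF hF_ne S hS])
      (by
        rw [← hS, map_sub, ← StateRing.energyCoeff, hb]
        simp [D_pressureElt hΩ hpos hF hF_ne S hS]) 0 0
      (w := (0, ρ, p)) (w' := (0, ρ₀, p₀)) hp h₀
    have e1 : (S.legendre G).1 ⟨(0, 0, 0, ρ, p), hp⟩ - b * p =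
      (S.legendre G).1 ⟨(0, 0, 0, ρ₀, p₀), h₀⟩ - b * p₀ := this
    have e2 : (S.legendre K).1 ⟨(0, 0, 0, ρ, p), hp⟩ =
      ρ * (S.D .r K).1 ⟨(0, 0, 0, ρ, p), hp⟩ + F (p, ρ) * (S.D .p K).1 ⟨(0, 0, 0, ρ, p), hp⟩
        - K.1 ⟨(0, 0, 0, ρ, p), hp⟩ := rfl
    rw [← e2, hleg]
    linarith
  have hD := isOpen_stateDomain (n := n) hΩ
  have hKs := smoothAlgebra_contDiffOn K
  -- Adding `k` to `K` removes the constant from the equation for `s`, and `c` compensates for it.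
  -- Summing over all `(i, j)` counts each angular momentum twice, hence `M / 2` for the
  -- antisymmetric `M`.
  refine ⟨b, a, fun i j => M i j / 2, g, fun s => (extendZero K.1 (0, 0, 0, s.2, s.1) + k) / s.2,
    fun y => extendZero K.1 (y.1, y.2, 0, ρ₀, p₀) - extendZero K.1 (0, 0, 0, ρ₀, p₀) - k,
    ?_, ?_, ?_, ?_⟩
  · refine ((hKs.comp (f := fun s : ℝ × ℝ => ((0, 0, 0, s.2, s.1) : State n)) (by fun_prop)
      (fun s hs => hs)).add contDiffOn_const).div contDiffOn_snd fun s hs => (hpos _ _ hs).ne'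
  · intro p ρ hp
    have hρ := (hpos p ρ hp).ne'
    have hdiff := smoothAlgebra_differentiableAt hD K ⟨(0, 0, 0, ρ, p), hp⟩
    have d1 := ((hasDerivAt_state_r hdiff).add_const k).div (hasDerivAt_id ρ) hρ
    have d2 := ((hasDerivAt_state_p hdiff).add_const k).div_const ρ
    have d1' : deriv (fun r => (extendZero K.1 (0, 0, 0, r, p) + k) / r) ρ = _ := d1.deriv
    have d2' : deriv (fun q => (extendZero K.1 (0, 0, 0, ρ, q) + k) / ρ) p = _ := d2.deriv
    have e := hthermo hp
    have e1 : (S.D .r K).1 ⟨(0, 0, 0, ρ, p), hp⟩ =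
      fderiv ℝ (extendZero K.1) (0, 0, 0, ρ, p) Direction.r.vec := rfl
    have e2 : (S.D .p K).1 ⟨(0, 0, 0, ρ, p), hp⟩ =
      fderiv ℝ (extendZero K.1) (0, 0, 0, ρ, p) Direction.p.vec := rfl
    rw [e1, e2] at e
    rw [d1', d2', extendZero_of_mem K.1 (q := (0, 0, 0, ρ, p)) hp]
    simp only [id]
    field_simp
    linear_combination e
  · refine ((hKs.comp_contDiff (f := fun y : ℝ × Space n => ((y.1, y.2, 0, ρ₀, p₀) : State n))
      (by fun_prop) fun y => h₀).sub contDiff_const).sub contDiff_const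
  · intro t x u ρ p hp
    have hρ := (hpos p ρ hp).ne'
    have e := sep hp t x u
    have e1 : K.1 ⟨(t, x, u, ρ, p), hp⟩ = T t x u ρ p - ρ * P.1 ⟨(t, x, u, ρ, p), hp⟩ := rfl
    rw [e1, momentumPart_apply b a M g hu t x u ρ p hp] at e
    beta_reduce
    rw [extendZero_of_mem K.1 (q := (0, 0, 0, ρ, p)) hp,
      extendZero_of_mem K.1 (q := (0, 0, 0, ρ₀, p₀)) h₀,
      extendZero_of_mem K.1 (q := (t, x, 0, ρ₀, p₀)) h₀]
    have e2 : ∑ i, a i * momentum i t x u ρ p = ρ * ∑ j, a j * u j := by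
      rw [Finset.mul_sum]
      exact Finset.sum_congr rfl fun i _ => by simp only [momentum]; ring
    have e3 : ∑ i, g i * galileanMomentum i t x u ρ p = ρ * ∑ j, g j * (t * u j - x j) := by
      rw [Finset.mul_sum]
      exact Finset.sum_congr rfl fun i _ => by simp only [galileanMomentum]; ring
    have e4 : ∑ i, ∑ j, M i j / 2 * angularMomentum i j t x u ρ p =
        ρ * ∑ j, ∑ k, M j k * (u j * x k) := by
      have f1 : ∑ i, ∑ j, M i j / 2 * angularMomentum i j t x u ρ p =
          ∑ i, ∑ j, ρ * (M i j / 2 * (u i * x j)) + ∑ i, ∑ j, ρ * (M j i / 2 * (u j * x i)) := by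
        simp only [← Finset.sum_add_distrib]
        refine Finset.sum_congr rfl fun i _ => Finset.sum_congr rfl fun j _ => ?_
        rw [hanti' j i]
        simp only [angularMomentum]
        ring
      rw [f1, Finset.sum_comm (f := fun i j => ρ * (M j i / 2 * (u j * x i)))]
      simp only [← Finset.sum_add_distrib, Finset.mul_sum]
      refine Finset.sum_congr rfl fun i _ => Finset.sum_congr rfl fun j _ => ?_
      ring
    rw [e2, e3, e4, mul_add ρ, mul_div_cancel₀ _ hρ]
    linear_combination e

end NormalForm

/-! ### Fluxes -/

namespace StateRing

variable {n : ℕ} {A : Type*} [CommRing A] [Algebra ℝ A] (S : StateRing n A)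

/-- `Y` is a flux of order zero of the density `G`. -/
structure IsFlux (G : A) (Y : Fin n → A) : Prop where
  u : ∀ i j, S.D (.u j) (Y i) = -S.coeffU G i j
  r : ∀ i, S.D .r (Y i) = -S.coeffR G i
  p : ∀ i, S.D .p (Y i) = -S.coeffP G i
  t : S.D .t G = -∑ i, S.D (.x i) (Y i)

/-- The flux of a density with specific momentum `βu + μ`. -/
lemma isFlux_of_momentum {G β π : A} {μ : Fin n → A}
    (hβu : ∀ i, S.D (.u i) β = 0) (hβr : S.D .r β = 0) (hβp : S.D .p β = 0)
    (hβx : ∀ i, S.D (.x i) β = 0)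
    (hμu : ∀ i j, S.D (.u i) (μ j) = 0) (hμr : ∀ j, S.D .r (μ j) = 0)
    (hμp : ∀ j, S.D .p (μ j) = 0)
    (hπu : ∀ i, S.D (.u i) π = 0) (hπr : S.D .r π = 0) (hπp : S.D .p π = 1)
    (hπx : ∀ i, S.D (.x i) π = 0)
    (hu : ∀ i, S.D (.u i) G = S.r * (β * S.u i + μ i))
    (hth : S.thermal G = G + β * π)
    (ht : S.D .t G + ∑ i, S.u i * S.D (.x i) G + π * ∑ i, S.D (.x i) (μ i) = 0) :
    S.IsFlux G fun i => (G + β * π) * S.u i + π * μ i where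
  -- The flux is the transport `G u` plus the pressure work `π (β u + μ)`. By `hth` the sum has the
  -- divergence coefficient `thermal G`.
  u i j := by
    simp only [map_add, Derivation.leibniz, smul_eq_mul, hβu, hμu, hπu, hu, D_u_u, coeffU, hth,
      eq_comm (a := i)]
    split_ifs <;> ring
  r i := by
    simp only [map_add, Derivation.leibniz, smul_eq_mul, hβr, hμr, hπr, D_r_u, coeffR]
    ring
  p i := by
    simp only [map_add, Derivation.leibniz, smul_eq_mul, hβp, hμp, hπp, D_p_u, coeffP, hu]
    linear_combination -(β * S.u i + μ i) * S.r_mul_rinv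
  t := by
    simp only [map_add, Derivation.leibniz, smul_eq_mul, hβx, hπx, D_x_u, Finset.sum_add_distrib,
      mul_zero, add_zero, zero_add, ← Finset.mul_sum]
    linear_combination ht

end StateRing

/-! ### Conservation laws from fluxes of order zero -/

section Flux

variable {n : ℕ} {Ω : Set (ℝ × ℝ)}

/-- The state `(t, x, u, ρ, p)` underlying `(t, x, J)` for a jet `J`. -/
def jetState (n k : ℕ) : ℝ × Space n × Jet n k →L[ℝ] State n :=
  (ContinuousLinearMap.fst ℝ ℝ (Space n × Jet n k)).prod
    ((ContinuousLinearMap.fst ℝ (Space n) (Jet n k) ∘L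
        ContinuousLinearMap.snd ℝ ℝ (Space n × Jet n k)).prod
      (ContinuousMultilinearMap.apply ℝ (fun _ : Fin ((0 : Fin (k + 1)) : ℕ) => Space n)
          (Space n × ℝ × ℝ) (fun _ => 0) ∘L
        ContinuousLinearMap.proj (R := ℝ)
          (φ := fun j : Fin (k + 1) => (Space n) [×(j : ℕ)]→L[ℝ] (Space n × ℝ × ℝ)) 0 ∘L
        ContinuousLinearMap.snd ℝ (Space n) (Jet n k) ∘L
        ContinuousLinearMap.snd ℝ ℝ (Space n × Jet n k)))

lemma jetState_apply (k : ℕ) (t : ℝ) (x : Space n) (J : Jet n k) :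
    jetState n k (t, x, J) = (t, x, J.base) := rfl

lemma jetState_jet (k : ℕ) (φ : FluidField n Ω) (t : ℝ) (x : Space n) :
    jetState n k (t, x, φ.jet k x) = φ.state t x := by
  rw [jetState_apply, FluidField.jet_base]
  rfl

lemma hasFDerivAt_comp_state (φ : FluidField n Ω) (t : ℝ) (x : Space n) {f : State n → ℝ}
    (hf : DifferentiableAt ℝ f (φ.state t x)) :
    HasFDerivAt (fun y => f (φ.state t y)) (fderiv ℝ f (φ.state t x) ∘L
      ((0 : Space n →L[ℝ] ℝ).prod ((ContinuousLinearMap.id ℝ (Space n)).prod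
        ((fderiv ℝ φ.u x).prod ((fderiv ℝ φ.ρ x).prod (fderiv ℝ φ.p x)))))) x := by
  have du := (φ.smooth_u.differentiable (by simp) x).hasFDerivAt
  have dr := (φ.smooth_ρ.differentiable (by simp) x).hasFDerivAt
  have dp := (φ.smooth_p.differentiable (by simp) x).hasFDerivAt
  have d2 := (hasFDerivAt_id (𝕜 := ℝ) x).prodMk (du.prodMk (dr.prodMk dp))
  have d1 := (hasFDerivAt_const (𝕜 := ℝ) t x).prodMk d2
  exact HasFDerivAt.comp (g := f) x hf.hasFDerivAt d1

variable (hΩ : IsOpen Ω) (hpos : ∀ p ρ : ℝ, (p, ρ) ∈ Ω → 0 < ρ) {F : ℝ × ℝ → ℝ}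
  (hF : ContDiffOn ℝ ∞ F Ω)
  (hF_ne : ∀ W : Set (ℝ × ℝ), W ⊆ Ω → IsOpen W → W.Nonempty → ∃ q ∈ W, F q ≠ 0)

/-- A density with a flux of order zero satisfies the conservation law. -/
lemma isFlux_divergence {G : smoothAlgebra (stateDomain n Ω)}
    {Y : Fin n → smoothAlgebra (stateDomain n Ω)}
    (h : (stateRing n hΩ hpos F hF hF_ne).IsFlux G Y) (φ : FluidField n Ω) (t : ℝ) (x : Space n) :
    fderiv ℝ (extendZero G.1) (φ.state t x) Direction.t.vec
      + ∑ i, gradCoeff F (extendZero G.1) (fderiv ℝ φ.u x (EuclideanSpace.single i 1),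
          fderiv ℝ φ.ρ x (EuclideanSpace.single i 1), fderiv ℝ φ.p x (EuclideanSpace.single i 1)) i
          (φ.state t x)
      + ∑ i, fderiv ℝ (fun y => extendZero (Y i).1 (φ.state t y)) x (EuclideanSpace.single i 1)
      = 0 := by
  set S := stateRing n hΩ hpos F hF hF_ne with hS
  have hD := isOpen_stateDomain (n := n) hΩ
  set q : stateDomain n Ω := ⟨φ.state t x, φ.state_mem t x⟩ with hq
  have ev : ∀ {a b : smoothAlgebra (stateDomain n Ω)}, a = b → a.1 q = b.1 q :=
    fun h => by rw [h]
  have hDv : ∀ a (f : smoothAlgebra (stateDomain n Ω)),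
      fderiv ℝ (extendZero f.1) (φ.state t x) a.vec = (S.D a f).1 q := fun a f => rfl
  have hYi : ∀ i, fderiv ℝ (fun y => extendZero (Y i).1 (φ.state t y)) x (EuclideanSpace.single i 1)
      = (S.D (.x i) (Y i)).1 q + ∑ j, fderiv ℝ φ.u x (EuclideanSpace.single i 1) j
          * (S.D (.u j) (Y i)).1 q
        + fderiv ℝ φ.ρ x (EuclideanSpace.single i 1) * (S.D .r (Y i)).1 q
        + fderiv ℝ φ.p x (EuclideanSpace.single i 1) * (S.D .p (Y i)).1 q := by
    intro i
    have e := clm_state_apply (fderiv ℝ (extendZero (Y i).1) (φ.state t x)) 0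
      (EuclideanSpace.single i 1) (fderiv ℝ φ.u x (EuclideanSpace.single i 1))
      (fderiv ℝ φ.ρ x (EuclideanSpace.single i 1)) (fderiv ℝ φ.p x (EuclideanSpace.single i 1))
    rw [(hasFDerivAt_comp_state φ t x (smoothAlgebra_differentiableAt hD (Y i) q)).fderiv]
    refine Eq.trans e ?_
    simp [hDv]
  have hGi : ∀ i, gradCoeff F (extendZero G.1) (fderiv ℝ φ.u x (EuclideanSpace.single i 1),
          fderiv ℝ φ.ρ x (EuclideanSpace.single i 1), fderiv ℝ φ.p x (EuclideanSpace.single i 1)) i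
          (φ.state t x) =
      ∑ j, fderiv ℝ φ.u x (EuclideanSpace.single i 1) j * (S.coeffU G i j).1 q
        + fderiv ℝ φ.ρ x (EuclideanSpace.single i 1) * (S.coeffR G i).1 q
        + fderiv ℝ φ.p x (EuclideanSpace.single i 1) * (S.coeffP G i).1 q := by
    intro i
    have e := clm_state_apply (fderiv ℝ (extendZero G.1) (φ.state t x)) 0
      0 (fderiv ℝ φ.u x (EuclideanSpace.single i 1))
      (fderiv ℝ φ.ρ x (EuclideanSpace.single i 1)) (fderiv ℝ φ.p x (EuclideanSpace.single i 1))
    simp only [hDv] at e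
    have eU : ∀ j, (S.coeffU G i j).1 q = -(φ.u x i * (S.D (.u j) G).1 q)
        - if i = j then (φ.ρ x * (S.D .r G).1 q + F (φ.p x, φ.ρ x) * (S.D .p G).1 q) else 0 := by
      intro j
      by_cases hij : i = j
      · subst hij
        simp only [StateRing.coeffU, if_true]; rfl
      · simp only [StateRing.coeffU, if_neg hij]; rfl
    have eR : (S.coeffR G i).1 q = -(φ.u x i * (S.D .r G).1 q) := rfl
    have eP : (S.coeffP G i).1 q = -(φ.u x i * (S.D .p G).1 q)
        - (φ.ρ x)⁻¹ * (S.D (.u i) G).1 q := rfl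
    simp only [gradCoeff, hDv, e, eU, eR, eP]
    simp only [mul_sub, mul_ite, mul_zero, Finset.sum_sub_distrib, Finset.sum_ite_eq,
      Finset.mem_univ, if_true, mul_neg, Finset.sum_neg_distrib, mul_left_comm _ (φ.u x i),
      ← Finset.mul_sum]
    simp [FluidField.state]
    ring
  simp only [hYi, hGi, hDv]
  have e1 : (S.D .t G).1 q = -∑ i, (S.D (.x i) (Y i)).1 q := by
    rw [ev h.t, Subalgebra.coe_neg, Pi.neg_apply, coe_sum_apply]
  have e2 : ∀ i j, (S.D (.u j) (Y i)).1 q = -(S.coeffU G i j).1 q := fun i j => ev (h.u i j)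
  have e3 : ∀ i, (S.D .r (Y i)).1 q = -(S.coeffR G i).1 q := fun i => ev (h.r i)
  have e4 : ∀ i, (S.D .p (Y i)).1 q = -(S.coeffP G i).1 q := fun i => ev (h.p i)
  simp only [e1, e2, e3, e4, Finset.sum_add_distrib, mul_neg, Finset.sum_neg_distrib]
  ring

/-- Adding a density with a flux of order zero preserves conserved densities. -/
lemma IsConservedDensity.add_of_isFlux {T T₀ : KinematicFunction n}
    (hT₀ : IsConservedDensity F Ω T₀) {G : smoothAlgebra (stateDomain n Ω)}
    {Y : Fin n → smoothAlgebra (stateDomain n Ω)}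
    (h : (stateRing n hΩ hpos F hF hF_ne).IsFlux G Y)
    (hT : ∀ q : stateDomain n Ω, T.onState q = T₀.onState q + G.1 q) :
    IsConservedDensity F Ω T := by
  have hD := isOpen_stateDomain (n := n) hΩ
  have hsT : ContDiffOn ℝ ∞ T.onState (stateDomain n Ω) :=
    (hT₀.contDiffOn.add (smoothAlgebra_contDiffOn G)).congr fun q hq => by
      rw [extendZero_of_mem _ hq]
      exact hT ⟨q, hq⟩
  refine ⟨hsT, ?_⟩
  obtain ⟨h0, k, X, hX, hdiv⟩ := id hT₀
  -- The additional flux sees only the order-zero part of a jet, so it can be read off from jets of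
  -- the order `k` used by `X`.
  have hY : ContDiffOn ℝ ∞ (fun z : ℝ × Space n × Jet n k =>
      WithLp.toLp 2 fun i => extendZero (Y i).1 (jetState n k z)) (jetDomain n k Ω) := by
    rw [contDiffOn_euclidean]
    intro i
    exact (smoothAlgebra_contDiffOn (Y i)).comp (jetState n k).contDiff.contDiffOn fun z hz => hz
  refine ⟨k, fun z => X z + WithLp.toLp 2 fun i => extendZero (Y i).1 (jetState n k z),
    hX.add hY, fun φ t x => ?_⟩
  have d1 : DifferentiableAt ℝ (fun y => X (t, y, φ.jet k y)) x :=
    (contDiff_flux_jet hX φ t).differentiable (by simp) x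
  have d2 : DifferentiableAt ℝ (fun y => WithLp.toLp 2 fun i =>
      extendZero (Y i).1 (jetState n k (t, y, φ.jet k y)) : Space n → Space n) x :=
    (contDiff_flux_jet hY φ t).differentiable (by simp) x
  have d3 : ∀ i, fderiv ℝ (fun y => WithLp.toLp 2 fun i =>
      extendZero (Y i).1 (jetState n k (t, y, φ.jet k y)) : Space n → Space n) x
        (EuclideanSpace.single i 1) i =
      fderiv ℝ (fun y => extendZero (Y i).1 (φ.state t y)) x (EuclideanSpace.single i 1) := by
    intro i
    have a1 := (EuclideanSpace.proj i : Space n →L[ℝ] ℝ).hasFDerivAt.comp x d2.hasFDerivAt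
    have a2 : fderiv ℝ (fun y => extendZero (Y i).1 (jetState n k (t, y, φ.jet k y))) x = _ :=
      a1.fderiv
    simp only [jetState_jet] at a2
    rw [a2]
    rfl
  have hq := φ.state_mem t x
  have dT0 : DifferentiableAt ℝ T₀.onState (φ.state t x) :=
    (hT₀.contDiffOn.contDiffAt (hD.mem_nhds hq)).differentiableAt (by simp)
  have dG := smoothAlgebra_differentiableAt hD G ⟨_, hq⟩
  have dT : fderiv ℝ T.onState (φ.state t x) =
      fderiv ℝ T₀.onState (φ.state t x) + fderiv ℝ (extendZero G.1) (φ.state t x) := by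
    have : T.onState =ᶠ[nhds (φ.state t x)] T₀.onState + extendZero G.1 := by
      filter_upwards [hD.mem_nhds hq] with z hz
      rw [Pi.add_apply, extendZero_of_mem _ hz]
      exact hT ⟨z, hz⟩
    rw [this.fderiv_eq, fderiv_add dT0 dG]
  have hsplit : ∀ v i, gradCoeff F T.onState v i (φ.state t x) =
      gradCoeff F T₀.onState v i (φ.state t x)
        + gradCoeff F (extendZero G.1) v i (φ.state t x) := by
    intro v i
    simp only [gradCoeff, dT, _root_.add_apply]
    ring
  have h1 := hdiv φ t x
  rw [totalTimeDeriv_eq hpos F T₀ φ t x dT0] at h1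
  rw [totalTimeDeriv_eq hpos F T φ t x
    ((hsT.contDiffAt (hD.mem_nhds hq)).differentiableAt (by simp))]
  have h2 := isFlux_divergence hΩ hpos hF hF_ne h φ t x
  simp only [divergence] at h1 ⊢
  rw [fderiv_fun_add d1 d2]
  simp only [_root_.add_apply, PiLp.add_apply, d3, hsplit, dT,
    Finset.sum_add_distrib]
  linarith

end Flux

/-! ### Trivial densities -/

section Trivial

open MeasureTheory

/-- The integral is a convolution with the indicator of `(0, 1]`, evaluated at zero. The bump
function equals one on `[-1, 1]`, so it leaves the value unchanged while giving the kernel compact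
support uniformly in the parameter. -/
lemma contDiff_intervalIntegral_param {P : Type*} [NormedAddCommGroup P] [NormedSpace ℝ P]
    {k : P × ℝ → ℝ} (hk : ContDiff ℝ ∞ k) : ContDiff ℝ ∞ fun y => ∫ s in (0 : ℝ)..1, k (y, s) := by
  let χ : ContDiffBump (0 : ℝ) := ⟨1, 2, one_pos, one_lt_two⟩
  have hloc : LocallyIntegrable (Set.indicator (Set.Ioc (0 : ℝ) 1) fun _ => (1 : ℝ)) volume :=
    (locallyIntegrable_const 1).indicator measurableSet_Ioc
  have h := contDiffOn_convolution_right_with_param (μ := (volume : Measure ℝ)) (n := ⊤)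
    (ContinuousLinearMap.mul ℝ ℝ) (g := fun (y : P) (s : ℝ) => χ s * k (y, -s)) (s := Set.univ)
    isOpen_univ χ.hasCompactSupport.isCompact
    (fun y s _ hs => by rw [image_eq_zero_of_notMem_tsupport hs, zero_mul]) hloc
    (ContDiff.contDiffOn (by
      have : ContDiff ℝ ∞ fun q : P × ℝ => χ q.2 * k (q.1, -q.2) :=
        (χ.contDiff.comp contDiff_snd).mul (hk.comp (by fun_prop))
      exact this))
  rw [Set.univ_prod_univ, contDiffOn_univ] at h
  have h2 := h.comp (contDiff_id.prodMk (contDiff_const (c := (0 : ℝ))))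
  convert h2 using 1
  ext y
  simp only [Function.comp_apply, convolution, ContinuousLinearMap.mul_apply', id]
  rw [intervalIntegral.integral_of_le zero_le_one, ← integral_indicator measurableSet_Ioc]
  congr 1
  ext s
  by_cases hs : s ∈ Set.Ioc (0 : ℝ) 1
  · have : χ (-s) = 1 := by
      apply χ.one_of_mem_closedBall
      simp only [Metric.mem_closedBall, dist_zero_right, norm_neg, Real.norm_eq_abs]
      rw [abs_of_pos hs.1]
      exact hs.2
    simp [hs, this]
  · simp [hs]

/-- A smooth function has a smooth primitive in a given coordinate direction. -/
lemma exists_partial_primitive {n : ℕ} (i : Fin n) {h : ℝ × Space n → ℝ} (hh : ContDiff ℝ ∞ h) :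
    ∃ H : ℝ × Space n → ℝ, ContDiff ℝ ∞ H ∧
      ∀ t x, fderiv ℝ (fun y => H (t, y)) x (EuclideanSpace.single i 1) = h (t, x) := by
  set e : Space n := EuclideanSpace.single i 1 with he
  -- The integral of `h` over the `i`-th coordinate from `0` to `xⁱ`, rescaled to the fixed interval
  -- `[0, 1]` so that smoothness in the parameters applies.
  set H : ℝ × Space n → ℝ := fun y =>
    y.2 i * ∫ s in (0 : ℝ)..1, h (y.1, y.2 + ((s - 1) * y.2 i) • e) with hH
  have hHs : ContDiff ℝ ∞ H := by
    refine ContDiff.mul (by fun_prop) ?_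
    exact contDiff_intervalIntegral_param (P := ℝ × Space n)
      (k := fun z => h (z.1.1, z.1.2 + ((z.2 - 1) * z.1.2 i) • e)) (by fun_prop)
  refine ⟨H, hHs, fun t x => ?_⟩
  have h1 : ∀ δ : ℝ, H (t, x + δ • e) = ∫ σ in (0 : ℝ)..(x i + δ), h (t, x + (σ - x i) • e) := by
    intro δ
    have hei : (x + δ • e) i = x i + δ := by simp [he]
    have hs := intervalIntegral.smul_integral_comp_mul_right (a := 0) (b := 1)
      (fun σ => h (t, x + (σ - x i) • e)) (x i + δ)
    rw [zero_mul, one_mul] at hs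
    rw [← hs]
    simp only [hH, hei, smul_eq_mul]
    congr 2
    ext s
    congr 2
    rw [add_assoc, ← add_smul]
    congr 2
    ring
  have hd : DifferentiableAt ℝ (fun y => H (t, y)) x :=
    (hHs.comp (contDiff_const.prodMk contDiff_id)).differentiable (by simp) x
  have h2 : HasDerivAt (fun δ : ℝ => x + δ • e) e 0 := by
    simpa using ((hasDerivAt_id (0 : ℝ)).smul_const e).const_add x
  have h3 : HasDerivAt (fun δ : ℝ => H (t, x + δ • e)) (fderiv ℝ (fun y => H (t, y)) x e) 0 := by
    have hd' : HasFDerivAt (fun y => H (t, y)) (fderiv ℝ (fun y => H (t, y)) x)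
        (x + (0 : ℝ) • e) := by
      simpa using hd.hasFDerivAt
    exact HasFDerivAt.comp_hasDerivAt (0 : ℝ) hd' h2
  have hc : Continuous fun σ : ℝ => h (t, x + (σ - x i) • e) :=
    hh.continuous.comp (by fun_prop)
  have h4 : HasDerivAt (fun b : ℝ => ∫ σ in (0 : ℝ)..b, h (t, x + (σ - x i) • e))
      (h (t, x)) (x i + 0) := by
    have := intervalIntegral.integral_hasDerivAt_right (hc.intervalIntegrable 0 (x i + 0))
      (hc.stronglyMeasurableAtFilter _ _) hc.continuousAt
    simpa using this
  have h5 : HasDerivAt (fun δ : ℝ => H (t, x + δ • e)) (h (t, x)) 0 := by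
    simp only [h1]
    have := HasDerivAt.comp (0 : ℝ) h4 ((hasDerivAt_id (0 : ℝ)).const_add (x i))
    rw [mul_one] at this
    exact this
  exact h3.unique h5

/-- Any `c_t` is a spatial divergence: a primitive in the first coordinate, placed along that axis,
serves as the flux up to sign. -/
lemma isConservedDensity_of_spacetime {n : ℕ} (hn : 0 < n) {Ω : Set (ℝ × ℝ)} (F : ℝ × ℝ → ℝ)
    {c : ℝ × Space n → ℝ} (hc : ContDiff ℝ ∞ c) :
    IsConservedDensity F Ω (fun t x _ _ _ => c (t, x)) := by
  have hct : ContDiff ℝ ∞ fun y : ℝ × Space n => fderiv ℝ c y (1, 0) :=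
    (hc.fderiv_right (by simp)).clm_apply contDiff_const
  obtain ⟨H, hH, hHd⟩ := exists_partial_primitive ⟨0, hn⟩ hct
  refine ⟨?_, 0, fun z => -H (z.1, z.2.1) • EuclideanSpace.single (⟨0, hn⟩ : Fin n) (1 : ℝ), ?_,
    fun φ t x => ?_⟩
  · exact (hc.comp (by fun_prop : ContDiff ℝ ∞ fun q : State n => (q.1, q.2.1))).contDiffOn
  · exact ContDiff.contDiffOn (((hH.comp (by fun_prop)).neg).smul contDiff_const)
  · have h1 : deriv (fun s => c (s, x)) t = fderiv ℝ c (t, x) (1, 0) :=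
      HasDerivAt.deriv (HasFDerivAt.comp_hasDerivAt (f := fun s => (s, x)) t
        (hc.differentiable (by simp) (t, x)).hasFDerivAt
        ((hasDerivAt_id t).prodMk (hasDerivAt_const t x)))
    have hd : DifferentiableAt ℝ (fun y => -H (t, y)) x :=
      ((hH.comp (contDiff_const.prodMk contDiff_id)).neg).differentiable (by simp) x
    simp only [totalTimeDeriv, divergence]
    rw [fderiv_smul_const hd, h1, fderiv_fun_neg]
    simp [hHd]

end Trivial

/-! ### Densities in normal form are conserved -/

section Sufficiency

variable {n : ℕ} {Ω : Set (ℝ × ℝ)} (hΩ : IsOpen Ω) (hpos : ∀ p ρ : ℝ, (p, ρ) ∈ Ω → 0 < ρ)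
  {F : ℝ × ℝ → ℝ} (hF : ContDiffOn ℝ ∞ F Ω)
  (hF_ne : ∀ W : Set (ℝ × ℝ), W ⊆ Ω → IsOpen W → W.Nonempty → ∃ q ∈ W, F q ≠ 0)

section ThermoPartial

variable {s : ℝ × ℝ → ℝ} {p ρ : ℝ} (hs : DifferentiableAt ℝ s (p, ρ))
include hs

lemma hasDerivAt_thermo_r : HasDerivAt (fun r => s (p, r)) (fderiv ℝ s (p, ρ) (0, 1)) ρ :=
  HasFDerivAt.comp_hasDerivAt (f := fun r => (p, r)) ρ hs.hasFDerivAt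
    ((hasDerivAt_const ρ p).prodMk (hasDerivAt_id ρ))

lemma hasDerivAt_thermo_p : HasDerivAt (fun q => s (q, ρ)) (fderiv ℝ s (p, ρ) (1, 0)) p :=
  HasFDerivAt.comp_hasDerivAt (f := fun q => (q, ρ)) p hs.hasFDerivAt
    ((hasDerivAt_id p).prodMk (hasDerivAt_const p ρ))

end ThermoPartial

lemma D_thermoFun (s : ℝ × ℝ → ℝ) (hs : ContDiffOn ℝ ∞ s Ω) (a : Direction n)
    (ha : thermoProj n a.vec = 0) :
    (stateRing n hΩ hpos F hF hF_ne).D a (thermoFun s hs) = 0 := by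
  ext q
  refine (smoothDeriv_thermoFun hΩ s hs a.vec q).trans ?_
  rw [ha, map_zero]
  rfl

/-- `StateRing.isFlux_of_momentum` applies with `β = b` constant and `π = p`. The equation for `s`
is its thermal condition, and antisymmetry of `M` removes both `div μ` and the quadratic form in
`u`. -/
lemma isFlux_normalForm {s : ℝ × ℝ → ℝ} (hs : ContDiffOn ℝ ∞ s Ω) {b : ℝ}
    (hse : ∀ p ρ : ℝ, (p, ρ) ∈ Ω → ρ * deriv (fun r => s (p, r)) ρ
      + F (p, ρ) * deriv (fun q => s (q, ρ)) p = b * (p / ρ))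
    (a : Fin n → ℝ) {M : Fin n → Fin n → ℝ} (hM : ∀ i j, M i j = -M j i) (g : Fin n → ℝ) :
    ∃ Y, (stateRing n hΩ hpos F hF hF_ne).IsFlux
      ((stateRing n hΩ hpos F hF hF_ne).r *
        (momentumPart (stateRing n hΩ hpos F hF hF_ne) b a M g + thermoFun s hs)) Y := by
  set S := stateRing n hΩ hpos F hF hF_ne with hS
  set P := momentumPart S b a M g with hP
  have Pr : S.D .r P = 0 := momentumPart_r hΩ hpos hF hF_ne hS b a M g
  have Pp : S.D .p P = 0 := momentumPart_p hΩ hpos hF hF_ne hS b a M g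
  have Pt : S.D .t P = _ := momentumPart_t hΩ hpos hF hF_ne hS b a M g
  have Px : ∀ i, S.D (.x i) P = _ := momentumPart_x hΩ hpos hF hF_ne hS b a M g
  have Pu : ∀ i, S.D (.u i) P = _ := momentumPart_u hΩ hpos hF hF_ne hS b a M g
  have st : S.D .t (thermoFun s hs) = 0 := D_thermoFun hΩ hpos hF hF_ne s hs _ rfl
  have sx : ∀ i, S.D (.x i) (thermoFun s hs) = 0 :=
    fun i => D_thermoFun hΩ hpos hF hF_ne s hs _ rfl
  have su : ∀ i, S.D (.u i) (thermoFun s hs) = 0 :=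
    fun i => D_thermoFun hΩ hpos hF hF_ne s hs _ rfl
  have hC : ∀ i j, algebraMap ℝ (smoothAlgebra (stateDomain n Ω)) (M i j) =
      -algebraMap ℝ _ (M j i) := fun i j => by rw [hM i j, map_neg]
  have hth : S.r * (S.r * S.D .r (thermoFun s hs) + S.F * S.D .p (thermoFun s hs)) =
      algebraMap ℝ _ b * pressureElt n Ω := by
    ext ⟨⟨t, x, u, ρ, p⟩, hq⟩
    have hd := (hs.contDiffAt (hΩ.mem_nhds hq)).differentiableAt (by simp)
    have e := hse p ρ hq
    rw [(hasDerivAt_thermo_r hd).deriv, (hasDerivAt_thermo_p hd).deriv] at e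
    have e1 : (S.D .r (thermoFun s hs)).1 ⟨(t, x, u, ρ, p), hq⟩ = fderiv ℝ s (p, ρ) (0, 1) :=
      smoothDeriv_thermoFun hΩ s hs _ _
    have e2 : (S.D .p (thermoFun s hs)).1 ⟨(t, x, u, ρ, p), hq⟩ = fderiv ℝ s (p, ρ) (1, 0) :=
      smoothDeriv_thermoFun hΩ s hs _ _
    have e3 : ρ * (ρ * (S.D .r (thermoFun s hs)).1 ⟨(t, x, u, ρ, p), hq⟩
        + F (p, ρ) * (S.D .p (thermoFun s hs)).1 ⟨(t, x, u, ρ, p), hq⟩) = b * p := by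
      rw [e1, e2, e]
      have := (hpos p ρ hq).ne'
      field_simp
    exact e3
  have dp := fun a => D_pressureElt hΩ hpos hF hF_ne S hS a
  have dt := fun a => D_timeElt hΩ hpos hF hF_ne S hS a
  have dx := fun a k => D_posElt hΩ hpos hF hF_ne S hS a k
  refine ⟨_, S.isFlux_of_momentum (β := algebraMap ℝ _ b) (π := pressureElt n Ω)
    (μ := fun i => algebraMap ℝ _ (a i) + ∑ k, algebraMap ℝ _ (M i k) * posElt Ω k
      + algebraMap ℝ _ (g i) * timeElt n Ω)
    (fun i => by simp) (by simp) (by simp) (fun i => by simp)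
    (fun i j => by simp [dt, dx]) (fun j => by simp [dt, dx]) (fun j => by simp [dt, dx])
    (fun i => by simp [dp]) (by simp [dp]) (by simp [dp]) (fun i => by simp [dp]) ?_ ?_ ?_⟩
  · intro i
    simp only [Derivation.leibniz, smul_eq_mul, map_add, StateRing.D_u_r, Pu, su]
    ring
  · simp only [StateRing.thermal, Derivation.leibniz, smul_eq_mul, map_add, StateRing.D_r_r,
      StateRing.D_p_r, Pr, Pp]
    linear_combination hth
  · have h1 : ∀ i, S.D (.x i) (algebraMap ℝ _ (a i) + ∑ k, algebraMap ℝ _ (M i k) * posElt Ω k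
        + algebraMap ℝ _ (g i) * timeElt n Ω) = 0 := by
      intro i
      have : M i i = 0 := by linarith [hM i i]
      simp [dt, dx, this]
    have h2 : ∑ i, ∑ j, S.u i * (algebraMap ℝ (smoothAlgebra (stateDomain n Ω)) (M j i) * S.u j)
        = 0 := by
      apply StateRing.eq_zero_of_two_mul
      have : ∑ i, ∑ j, S.u i * (algebraMap ℝ (smoothAlgebra (stateDomain n Ω)) (M j i) * S.u j)
        = -∑ i, ∑ j, S.u i * (algebraMap ℝ (smoothAlgebra (stateDomain n Ω)) (M j i) * S.u j) := by
        conv_lhs => rw [Finset.sum_comm]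
        simp only [← Finset.sum_neg_distrib]
        refine Finset.sum_congr rfl fun i _ => Finset.sum_congr rfl fun j _ => ?_
        rw [hC i j]
        ring
      linear_combination this
    simp only [h1, Finset.sum_const_zero, mul_zero, add_zero, Derivation.leibniz, smul_eq_mul,
      map_add, StateRing.D_t_r, StateRing.D_x_r, Pt, Px, st, sx]
    have h3 : ∑ i, S.u i * (S.r * (∑ j, algebraMap ℝ _ (M j i) * S.u j - algebraMap ℝ _ (g i))) =
        S.r * ∑ i, ∑ j, S.u i * (algebraMap ℝ _ (M j i) * S.u j)
          - S.r * ∑ i, algebraMap ℝ _ (g i) * S.u i := by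
      rw [Finset.mul_sum, Finset.mul_sum, ← Finset.sum_sub_distrib]
      refine Finset.sum_congr rfl fun i _ => ?_
      rw [← Finset.mul_sum]
      ring
    rw [h3, h2]
    ring

include hΩ hpos hF hF_ne in
/-- Every density in normal form is conserved. -/
lemma HasNormalForm.isConservedDensity (hn : 0 < n) {T : KinematicFunction n} {b : ℝ}
    (h : HasNormalForm F Ω T b) : IsConservedDensity F Ω T := by
  obtain ⟨a, A, g, s, c, hs, hse, hc, hT⟩ := h
  -- Only the antisymmetrization of `A` matters: `Σ A_ij (u_i x_j - u_j x_i) = Σ (A_ij - A_ji) u_i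
  -- x_j`.
  obtain ⟨Y, hY⟩ := isFlux_normalForm hΩ hpos hF hF_ne hs hse a
    (M := fun i j => A i j - A j i) (fun i j => by ring) g
  refine (isConservedDensity_of_spacetime hn F hc).add_of_isFlux hΩ hpos hF hF_ne hY ?_
  rintro ⟨⟨t, x, u, ρ, p⟩, hq⟩
  refine (hT t x u ρ p hq).trans ?_
  have e : ((stateRing n hΩ hpos F hF hF_ne).r *
        (momentumPart (stateRing n hΩ hpos F hF hF_ne) b a (fun i j => A i j - A j i) g
          + thermoFun s hs)).1 ⟨(t, x, u, ρ, p), hq⟩ =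
      ρ * ((momentumPart (stateRing n hΩ hpos F hF hF_ne) b a (fun i j => A i j - A j i) g).1
        ⟨(t, x, u, ρ, p), hq⟩ + s (p, ρ)) := rfl
  rw [e, momentumPart_apply (S := stateRing n hΩ hpos F hF hF_ne) b a _ g (fun j q => rfl)
    t x u ρ p hq]
  have e2 : ∑ i, a i * momentum i t x u ρ p = ρ * ∑ j, a j * u j := by
    rw [Finset.mul_sum]
    exact Finset.sum_congr rfl fun i _ => by simp only [momentum]; ring
  have e3 : ∑ i, g i * galileanMomentum i t x u ρ p = ρ * ∑ j, g j * (t * u j - x j) := by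
    rw [Finset.mul_sum]
    exact Finset.sum_congr rfl fun i _ => by simp only [galileanMomentum]; ring
  have e4 : ∑ i, ∑ j, A i j * angularMomentum i j t x u ρ p =
      ρ * ∑ j, ∑ k, (A j k - A k j) * (u j * x k) := by
    simp only [sub_mul, Finset.sum_sub_distrib]
    rw [Finset.sum_comm (f := fun j k => A k j * (u j * x k)), mul_sub]
    simp only [Finset.mul_sum, ← Finset.sum_sub_distrib]
    refine Finset.sum_congr rfl fun i _ => Finset.sum_congr rfl fun j _ => ?_
    simp only [angularMomentum]
    ring
  rw [e2, e3, e4]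
  simp only [KinematicFunction.onState]
  ring

end Sufficiency

/-! ### Normal forms and combinations of the basic densities -/

section Combinations

variable {n : ℕ} {Ω : Set (ℝ × ℝ)} (hΩ : IsOpen Ω) (hpos : ∀ p ρ : ℝ, (p, ρ) ∈ Ω → 0 < ρ)
  {F : ℝ × ℝ → ℝ}
include hΩ

/-- Mass, entropy and internal energy merge into `s = S + b e + m`. For `b = 0` nothing is known
about `e`, not even smoothness, so it is left out of `s`. -/
lemma IsBasicCombination.hasNormalForm {e : ℝ × ℝ → ℝ} {T : KinematicFunction n}
    (h : IsBasicCombination F Ω e T) : ∃ b, HasNormalForm F Ω T b := by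
  obtain ⟨m, a, A, g, b, S, c, he, hS, hc, hT⟩ := h
  by_cases hb : b = 0
  · subst hb
    refine ⟨0, a, A, g, fun s => S s + m, c, hS.1.add contDiffOn_const, fun p ρ hp => ?_, hc,
      fun t x u ρ p hp => ?_⟩
    · rw [deriv_add_const, deriv_add_const, hS.2 p ρ hp, zero_mul]
    · rw [hT t x u ρ p hp]
      simp only [mass, volumetricEntropy]
      ring
  · have he := he hb
    refine ⟨b, a, A, g, fun s => (S s + b * e s) + m, c,
      (hS.1.add (contDiffOn_const.mul he.1)).add contDiffOn_const, fun p ρ hp => ?_, hc,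
      fun t x u ρ p hp => ?_⟩
    · have h1 := (hS.1.contDiffAt (hΩ.mem_nhds hp)).differentiableAt (by simp)
      have h2 := (he.1.contDiffAt (hΩ.mem_nhds hp)).differentiableAt (by simp)
      have e1 := hS.2 p ρ hp
      have e2 := he.2 p ρ hp
      rw [(hasDerivAt_thermo_r h1).deriv, (hasDerivAt_thermo_p h1).deriv] at e1
      rw [(hasDerivAt_thermo_r h2).deriv, (hasDerivAt_thermo_p h2).deriv] at e2
      rw [(((hasDerivAt_thermo_r h1).fun_add ((hasDerivAt_thermo_r h2).const_mul b)).add_const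
        m).deriv, (((hasDerivAt_thermo_p h1).fun_add
          ((hasDerivAt_thermo_p h2).const_mul b)).add_const m).deriv]
      linear_combination e1 + b * e2
    · rw [hT t x u ρ p hp]
      simp only [mass, volumetricEntropy, energy]
      ring

/-- A density in normal form, written with a prescribed internal energy. -/
lemma HasNormalForm.isBasicCombination {e : ℝ × ℝ → ℝ} {T : KinematicFunction n} {b : ℝ}
    (h : HasNormalForm F Ω T b) (he : IsInternalEnergy F Ω e) : IsBasicCombination F Ω e T := by
  obtain ⟨a, A, g, s, c, hs, hse, hc, hT⟩ := h
  -- Solutions of the inhomogeneous equation with the same right-hand side differ by an entropy. The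
  -- mass coefficient can be zero because constants are entropies.
  refine ⟨0, a, A, g, b, fun q => s q - b * e q, c, fun _ => he,
    ⟨hs.sub (contDiffOn_const.mul he.1), fun p ρ hp => ?_⟩, hc, fun t x u ρ p hp => ?_⟩
  · have h1 := (hs.contDiffAt (hΩ.mem_nhds hp)).differentiableAt (by simp)
    have h2 := (he.1.contDiffAt (hΩ.mem_nhds hp)).differentiableAt (by simp)
    have e1 := hse p ρ hp
    have e2 := he.2 p ρ hp
    rw [(hasDerivAt_thermo_r h1).deriv, (hasDerivAt_thermo_p h1).deriv] at e1
    rw [(hasDerivAt_thermo_r h2).deriv, (hasDerivAt_thermo_p h2).deriv] at e2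
    rw [((hasDerivAt_thermo_r h1).fun_sub ((hasDerivAt_thermo_r h2).const_mul b)).deriv,
      ((hasDerivAt_thermo_p h1).fun_sub ((hasDerivAt_thermo_p h2).const_mul b)).deriv]
    linear_combination e1 - b * e2
  · rw [hT t x u ρ p hp]
    simp only [energy, volumetricEntropy]
    ring

/-- For `b ≠ 0` the function `s / b` is itself an internal energy. For `b = 0` the function `s` is
an entropy and no internal energy is needed. -/
lemma HasNormalForm.exists_isBasicCombination {T : KinematicFunction n} {b : ℝ}
    (h : HasNormalForm F Ω T b) : ∃ e, IsBasicCombination F Ω e T := by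
  by_cases hb : b = 0
  · obtain ⟨a, A, g, s, c, hs, hse, hc, hT⟩ := h
    subst hb
    refine ⟨0, 0, a, A, g, 0, s, c, fun h => absurd rfl h, ⟨hs, fun p ρ hp => ?_⟩, hc,
      fun t x u ρ p hp => ?_⟩
    · rw [hse p ρ hp, zero_mul]
    · rw [hT t x u ρ p hp]
      simp only [volumetricEntropy]
      ring
  · obtain ⟨a, A, g, s, c, hs, hse, hc, hT⟩ := id h
    refine ⟨fun q => b⁻¹ * s q, h.isBasicCombination hΩ ⟨contDiffOn_const.mul hs,
      fun p ρ hp => ?_⟩⟩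
    have h1 := (hs.contDiffAt (hΩ.mem_nhds hp)).differentiableAt (by simp)
    have e1 := hse p ρ hp
    rw [(hasDerivAt_thermo_r h1).deriv, (hasDerivAt_thermo_p h1).deriv] at e1
    rw [((hasDerivAt_thermo_r h1).const_mul _).deriv, ((hasDerivAt_thermo_p h1).const_mul _).deriv]
    have hb' : b⁻¹ * b = 1 := inv_mul_cancel₀ hb
    linear_combination b⁻¹ * e1 + p / ρ * hb'

end Combinations

/-! ### The special polytropic state function -/

section Polytropic

variable {n : ℕ} {Ω : Set (ℝ × ℝ)} (hΩ : IsOpen Ω) (hpos : ∀ p ρ : ℝ, (p, ρ) ∈ Ω → 0 < ρ)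
  {F : ℝ × ℝ → ℝ} (hF : ContDiffOn ℝ ∞ F Ω)
  (hF_ne : ∀ W : Set (ℝ × ℝ), W ⊆ Ω → IsOpen W → W.Nonempty → ∃ q ∈ W, F q ≠ 0)

section Elements

variable (n Ω)

/-- The energy coefficient `b₁ t + b₂ t²`. -/
def polytropicCoeff (b₁ b₂ : ℝ) : smoothAlgebra (stateDomain n Ω) :=
  algebraMap ℝ _ b₁ * timeElt n Ω + algebraMap ℝ _ b₂ * timeElt n Ω ^ 2

/-- The specific momentum `-(½ b₁ + b₂ t) x` at zero velocity. -/
def polytropicMomentum (b₁ b₂ : ℝ) (i : Fin n) : smoothAlgebra (stateDomain n Ω) :=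
  -((algebraMap ℝ _ (b₁ / 2) + algebraMap ℝ _ b₂ * timeElt n Ω) * posElt Ω i)

/-- The pressure counted from `p₀`. -/
def shiftedPressure (p₀ : ℝ) : smoothAlgebra (stateDomain n Ω) :=
  pressureElt n Ω - algebraMap ℝ _ p₀

variable {n Ω}

/-- The combination `b₁` similarity energy `+ b₂` dilational energy. -/
def polytropicElt (S : StateRing n (smoothAlgebra (stateDomain n Ω))) (p₀ b₁ b₂ : ℝ) :
    smoothAlgebra (stateDomain n Ω) :=
  polytropicCoeff n Ω b₁ b₂ * (algebraMap ℝ _ (1 / 2) * (S.r * ∑ i, S.u i ^ 2)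
      + algebraMap ℝ _ (n / 2 : ℝ) * shiftedPressure n Ω p₀)
    + S.r * ∑ i, S.u i * polytropicMomentum n Ω b₁ b₂ i
    + algebraMap ℝ _ (b₂ / 2) * (S.r * ∑ i, posElt Ω i ^ 2)

lemma polytropicElt_apply (S : StateRing n (smoothAlgebra (stateDomain n Ω)))
    (hr : ∀ q, S.r.1 q = q.1.2.2.2.1) (hu : ∀ j q, (S.u j).1 q = q.1.2.2.1 j)
    (p₀ b₁ b₂ t : ℝ) (x u : Space n) (ρ p : ℝ) (h : (p, ρ) ∈ Ω) :
    (polytropicElt S p₀ b₁ b₂).1 ⟨(t, x, u, ρ, p), h⟩ =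
      b₁ * similarityEnergy p₀ t x u ρ p + b₂ * dilationalEnergy p₀ t x u ρ p := by
  have hC : ∀ (c : ℝ) q, (algebraMap ℝ (smoothAlgebra (stateDomain n Ω)) c).1 q = c :=
    fun c q => rfl
  have hN : ∀ (f : smoothAlgebra (stateDomain n Ω)) q, (-f).1 q = -f.1 q := fun f q => rfl
  have hi : inner ℝ u x = ∑ i, u i * x i := by
    simp [PiLp.inner_apply, mul_comm]
  have e : ∑ i, u i * -((b₁ / 2 + b₂ * t) * x i) = -(b₁ / 2 + b₂ * t) * inner ℝ u x := by
    rw [hi, Finset.mul_sum]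
    exact Finset.sum_congr rfl fun i _ => by ring
  simp only [polytropicElt, polytropicCoeff, polytropicMomentum, shiftedPressure,
    Subalgebra.coe_add, Pi.add_apply, coe_sum_apply, Subalgebra.coe_mul, hN,
    Pi.mul_apply, hC, hu, hr, Subalgebra.coe_sub, Pi.sub_apply, linearElt_apply, positionProj_apply,
    Subalgebra.coe_pow, Pi.pow_apply, ContinuousLinearMap.coe_fst', e, similarityEnergy,
    dilationalEnergy, polytropicEnergy, norm_sq_eq_sum, ContinuousLinearMap.comp_apply,
    thermoProj_apply]
  ring

variable {S : StateRing n (smoothAlgebra (stateDomain n Ω))}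
  (hS : S = stateRing n hΩ hpos F hF hF_ne) (p₀ b₁ b₂ : ℝ)
include hS

lemma D_polytropicCoeff (a : Direction n) : S.D a (polytropicCoeff n Ω b₁ b₂) =
    match a with
    | .t => algebraMap ℝ _ b₁ + algebraMap ℝ _ (2 * b₂) * timeElt n Ω
    | _ => 0 := by
  have e : algebraMap ℝ (smoothAlgebra (stateDomain n Ω)) (2 * b₂) = 2 * algebraMap ℝ _ b₂ := by
    rw [map_mul, map_ofNat]
  simp only [polytropicCoeff, map_add, Derivation.leibniz, Derivation.leibniz_pow, smul_eq_mul,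
    Derivation.map_algebraMap, D_timeElt hΩ hpos hF hF_ne S hS]
  cases a <;> simp [e]
  ring

lemma D_polytropicMomentum (a : Direction n) (k : Fin n) :
    S.D a (polytropicMomentum n Ω b₁ b₂ k) =
    match a with
    | .t => -(algebraMap ℝ _ b₂ * posElt Ω k)
    | .x i => if i = k then -(algebraMap ℝ _ (b₁ / 2) + algebraMap ℝ _ b₂ * timeElt n Ω) else 0
    | _ => 0 := by
  simp only [polytropicMomentum, map_add, map_neg, Derivation.leibniz, smul_eq_mul,
    Derivation.map_algebraMap, D_timeElt hΩ hpos hF hF_ne S hS, D_posElt hΩ hpos hF hF_ne S hS]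
  cases a with
  | t => simp; ring
  | x i => by_cases h : i = k <;> simp [h]
  | _ => simp

lemma D_shiftedPressure (a : Direction n) : S.D a (shiftedPressure n Ω p₀) =
    match a with
    | .p => 1
    | _ => 0 := by
  cases a <;> simp [shiftedPressure, D_pressureElt hΩ hpos hF hF_ne S hS]

lemma polytropicElt_u (i : Fin n) : S.D (.u i) (polytropicElt S p₀ b₁ b₂) =
    S.r * (polytropicCoeff n Ω b₁ b₂ * S.u i + polytropicMomentum n Ω b₁ b₂ i) := by
  have e : (algebraMap ℝ (smoothAlgebra (stateDomain n Ω)) (1 / 2)) * (2 * S.u i) = S.u i := by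
    rw [← mul_assoc, ← map_ofNat (algebraMap ℝ (smoothAlgebra (stateDomain n Ω))) 2, ← map_mul]
    norm_num
  have e2 : S.D (.u i) (∑ j, S.u j ^ 2) = 2 * S.u i := by
    simp only [map_sum, Derivation.leibniz_pow, smul_eq_mul, StateRing.D_u_u]
    simp
  have e3 : S.D (.u i) (∑ j, S.u j * polytropicMomentum n Ω b₁ b₂ j) =
      polytropicMomentum n Ω b₁ b₂ i := by
    simp only [map_sum, Derivation.leibniz, smul_eq_mul, StateRing.D_u_u,
      D_polytropicMomentum hΩ hpos hF hF_ne hS]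
    simp
  have e4 : S.D (.u i) (∑ j, posElt Ω j ^ 2) = 0 := by
    simp [Derivation.leibniz_pow, D_posElt hΩ hpos hF hF_ne S hS]
  simp only [polytropicElt, map_add, Derivation.leibniz, smul_eq_mul, e2, e3, e4,
    D_polytropicCoeff hΩ hpos hF hF_ne hS, StateRing.D_u_r, Derivation.map_algebraMap,
    D_shiftedPressure hΩ hpos hF hF_ne hS]
  linear_combination polytropicCoeff n Ω b₁ b₂ * S.r * e

/-- The transport condition `ht` of `StateRing.isFlux_of_momentum`. The kinetic terms cancel against
the dilation part of `μ`, and the pressure terms because the factor `n/2` in the energy matches `div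
μ = -n (b₁/2 + b₂ t)`. No condition on `F` enters. -/
lemma polytropicElt_t_add :
    S.D .t (polytropicElt S p₀ b₁ b₂) + ∑ i, S.u i * S.D (.x i) (polytropicElt S p₀ b₁ b₂)
      + shiftedPressure n Ω p₀ * ∑ i, S.D (.x i) (polytropicMomentum n Ω b₁ b₂ i) = 0 := by
  set C := algebraMap ℝ (smoothAlgebra (stateDomain n Ω)) with hC
  have et : S.D .t (polytropicElt S p₀ b₁ b₂) = (C b₁ + C (2 * b₂) * timeElt n Ω) *
      (C (1 / 2) * (S.r * ∑ i, S.u i ^ 2) + C (n / 2 : ℝ) * shiftedPressure n Ω p₀)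
        - S.r * (C b₂ * ∑ i, S.u i * posElt Ω i) := by
    have e1 : S.D .t (∑ i, S.u i ^ 2) = 0 := by simp [Derivation.leibniz_pow]
    have e2 : S.D .t (∑ i, posElt Ω i ^ 2) = 0 := by
      simp [Derivation.leibniz_pow, D_posElt hΩ hpos hF hF_ne S hS]
    have e3 : S.D .t (∑ i, S.u i * polytropicMomentum n Ω b₁ b₂ i) =
        -(C b₂ * ∑ i, S.u i * posElt Ω i) := by
      rw [map_sum, Finset.mul_sum, ← Finset.sum_neg_distrib]
      refine Finset.sum_congr rfl fun i _ => ?_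
      rw [Derivation.leibniz, D_polytropicMomentum hΩ hpos hF hF_ne hS, StateRing.D_t_u]
      simp only [smul_eq_mul]
      ring
    simp only [polytropicElt, map_add, Derivation.leibniz, smul_eq_mul, e1, e2, e3,
      D_polytropicCoeff hΩ hpos hF hF_ne hS, StateRing.D_t_r, Derivation.map_algebraMap,
      D_shiftedPressure hΩ hpos hF hF_ne hS, hC]
    ring
  have ex : ∀ i, S.D (.x i) (polytropicElt S p₀ b₁ b₂) =
      S.r * (C (b₂ / 2) * (2 * posElt Ω i) - S.u i * (C (b₁ / 2) + C b₂ * timeElt n Ω)) := by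
    intro i
    have e1 : S.D (.x i) (∑ i, S.u i ^ 2) = 0 := by simp [Derivation.leibniz_pow]
    have e2 : S.D (.x i) (∑ i, posElt Ω i ^ 2) = 2 * posElt Ω i := by
      simp [Derivation.leibniz_pow, D_posElt hΩ hpos hF hF_ne S hS]
    have e3 : S.D (.x i) (∑ j, S.u j * polytropicMomentum n Ω b₁ b₂ j) =
        S.u i * -(C (b₁ / 2) + C b₂ * timeElt n Ω) := by
      simp only [map_sum, Derivation.leibniz, smul_eq_mul, StateRing.D_x_u,
        D_polytropicMomentum hΩ hpos hF hF_ne hS, mul_ite, mul_zero, add_zero]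
      simp [hC]
    simp only [polytropicElt, map_add, Derivation.leibniz, smul_eq_mul, e1, e2, e3,
      D_polytropicCoeff hΩ hpos hF hF_ne hS, StateRing.D_x_r, Derivation.map_algebraMap,
      D_shiftedPressure hΩ hpos hF hF_ne hS, hC]
    ring
  have esum : ∑ i, S.u i * S.D (.x i) (polytropicElt S p₀ b₁ b₂) =
      S.r * (C b₂ * ∑ i, S.u i * posElt Ω i)
        - S.r * ((C (b₁ / 2) + C b₂ * timeElt n Ω) * ∑ i, S.u i ^ 2) := by
    have e2 : C b₂ = C (b₂ / 2) * 2 := by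
      rw [← map_ofNat C 2, ← map_mul]; congr 1; ring
    simp only [Finset.mul_sum, ← Finset.sum_sub_distrib]
    refine Finset.sum_congr rfl fun i _ => ?_
    rw [ex]
    linear_combination -S.r * S.u i * posElt Ω i * e2
  have ediv : ∑ i, S.D (.x i) (polytropicMomentum n Ω b₁ b₂ i) =
      -(C n * (C (b₁ / 2) + C b₂ * timeElt n Ω)) := by
    simp only [D_polytropicMomentum hΩ hpos hF hF_ne hS, if_true, Finset.sum_const,
      Finset.card_univ, Fintype.card_fin, nsmul_eq_mul, hC, map_natCast]
    ring
  have c1 : C b₁ = C 2 * C (b₁ / 2) := by rw [← map_mul]; congr 1; ring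
  have c2 : C (2 * b₂) = C 2 * C b₂ := by rw [map_mul]
  have c3 : C 2 * C (1 / 2) = 1 := by rw [← map_mul]; norm_num
  have c4 : C 2 * C (n / 2 : ℝ) = C n := by rw [← map_mul]; congr 1; ring
  rw [et, esum, ediv, c1, c2]
  linear_combination (C (b₁ / 2) + C b₂ * timeElt n Ω) * (S.r * ∑ i, S.u i ^ 2) * c3
    + (C (b₁ / 2) + C b₂ * timeElt n Ω) * shiftedPressure n Ω p₀ * c4

variable {p₀}

/-- Here the special form of `F` is needed: the pressure term `(n/2) π` must be sent to `(n/2) π +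
π`, which for `F = γ π` is the relation `γ n/2 = n/2 + 1`. -/
lemma polytropicElt_thermal (hsp : IsSpecialPolytropic n F Ω p₀) (hn : 0 < n) :
    S.thermal (polytropicElt S p₀ b₁ b₂) =
      polytropicElt S p₀ b₁ b₂ + polytropicCoeff n Ω b₁ b₂ * shiftedPressure n Ω p₀ := by
  have hFe : S.F = algebraMap ℝ _ (1 + 2 / (n : ℝ)) * shiftedPressure n Ω p₀ := by
    subst hS
    ext ⟨⟨t, x, u, ρ, p⟩, hq⟩
    exact hsp p ρ hq
  have hcoef : algebraMap ℝ (smoothAlgebra (stateDomain n Ω)) (1 + 2 / (n : ℝ)) *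
      algebraMap ℝ _ (n / 2 : ℝ) = algebraMap ℝ _ (n / 2 : ℝ) + 1 := by
    rw [← map_mul, ← (algebraMap ℝ (smoothAlgebra (stateDomain n Ω))).map_one, ← map_add]
    congr 1
    have : (n : ℝ) ≠ 0 := by exact_mod_cast hn.ne'
    field_simp
  have e1 : ∀ a, a = Direction.r ∨ a = Direction.p → S.D a (∑ i, S.u i ^ 2) = 0 := by
    rintro a (rfl | rfl) <;> simp [Derivation.leibniz_pow]
  have e2 : ∀ a, a = Direction.r ∨ a = Direction.p → S.D a (∑ i, posElt Ω i ^ 2) = 0 := by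
    rintro a (rfl | rfl) <;> simp [Derivation.leibniz_pow, D_posElt hΩ hpos hF hF_ne S hS]
  have e3 : ∀ a, a = Direction.r ∨ a = Direction.p →
      S.D a (∑ i, S.u i * polytropicMomentum n Ω b₁ b₂ i) = 0 := by
    rintro a (rfl | rfl) <;> simp [D_polytropicMomentum hΩ hpos hF hF_ne hS]
  simp only [StateRing.thermal, polytropicElt, map_add, Derivation.leibniz, smul_eq_mul,
    e1 _ (.inl rfl), e1 _ (.inr rfl), e2 _ (.inl rfl), e2 _ (.inr rfl), e3 _ (.inl rfl),
    e3 _ (.inr rfl), D_polytropicCoeff hΩ hpos hF hF_ne hS, StateRing.D_r_r, StateRing.D_p_r,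
    Derivation.map_algebraMap, D_shiftedPressure hΩ hpos hF hF_ne hS, hFe]
  rw [map_add] at hcoef
  linear_combination polytropicCoeff n Ω b₁ b₂ * shiftedPressure n Ω p₀ * hcoef

lemma exists_isFlux_polytropicElt (hsp : IsSpecialPolytropic n F Ω p₀) (hn : 0 < n) :
    ∃ Y, S.IsFlux (polytropicElt S p₀ b₁ b₂) Y := by
  have dc := D_polytropicCoeff hΩ hpos hF hF_ne hS b₁ b₂
  have dm := D_polytropicMomentum hΩ hpos hF hF_ne hS b₁ b₂
  have dp := D_shiftedPressure hΩ hpos hF hF_ne hS p₀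
  exact ⟨_, S.isFlux_of_momentum (β := polytropicCoeff n Ω b₁ b₂) (π := shiftedPressure n Ω p₀)
    (μ := polytropicMomentum n Ω b₁ b₂) (fun i => dc _) (dc _) (dc _) (fun i => dc _)
    (fun i j => dm _ _) (fun j => dm _ _) (fun j => dm _ _) (fun i => dp _) (dp _) (dp _)
    (fun i => dp _) (polytropicElt_u hΩ hpos hF hF_ne hS p₀ b₁ b₂)
    (polytropicElt_thermal hΩ hpos hF hF_ne hS b₁ b₂ hsp hn)
    (polytropicElt_t_add hΩ hpos hF hF_ne hS p₀ b₁ b₂)⟩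

/-- Allows the time-dependent part of the energy coefficient of a general density to be cancelled by
a choice of `b₁` and `b₂`. -/
lemma energyCoeff_polytropicElt (hsp : IsSpecialPolytropic n F Ω p₀) (hn : 0 < n) :
    S.energyCoeff (polytropicElt S p₀ b₁ b₂) = polytropicCoeff n Ω b₁ b₂ := by
  rw [StateRing.energyCoeff, StateRing.legendre,
    polytropicElt_thermal hΩ hpos hF hF_ne hS b₁ b₂ hsp hn, add_sub_cancel_left,
    Derivation.leibniz, D_polytropicCoeff hΩ hpos hF hF_ne hS,
    D_shiftedPressure hΩ hpos hF hF_ne hS]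
  simp

end Elements

include hΩ hpos hF hF_ne in
/-- Adding similarity and dilational energies preserves conserved densities. -/
lemma IsConservedDensity.add_polytropic (hn : 0 < n) {p₀ : ℝ} (hsp : IsSpecialPolytropic n F Ω p₀)
    {T T₀ : KinematicFunction n} (hT₀ : IsConservedDensity F Ω T₀) (b₁ b₂ : ℝ)
    (hT : ∀ (t : ℝ) (x u : Space n) (ρ p : ℝ), (p, ρ) ∈ Ω → T t x u ρ p = T₀ t x u ρ p
      + b₁ * similarityEnergy p₀ t x u ρ p + b₂ * dilationalEnergy p₀ t x u ρ p) :
    IsConservedDensity F Ω T := by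
  obtain ⟨Y, hY⟩ := exists_isFlux_polytropicElt hΩ hpos hF hF_ne rfl b₁ b₂ hsp hn
  refine hT₀.add_of_isFlux hΩ hpos hF hF_ne hY ?_
  rintro ⟨⟨t, x, u, ρ, p⟩, hq⟩
  rw [polytropicElt_apply (stateRing n hΩ hpos F hF hF_ne) (fun q => rfl) (fun j q => rfl)
    p₀ b₁ b₂ t x u ρ p hq]
  refine (hT t x u ρ p hq).trans ?_
  simp only [KinematicFunction.onState]
  ring

include hpos hF hF_ne in
/-- A conserved density whose energy coefficient depends on time exists only for the special
polytropic state function. -/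
lemma exists_isSpecialPolytropic (hn : 1 < n) (hc : IsConnected Ω) {T : KinematicFunction n}
    (hT : IsConservedDensity F Ω T)
    (hβ : (stateRing n hΩ hpos F hF hF_ne).D .t ((stateRing n hΩ hpos F hF hF_ne).energyCoeff
      (restrictSmooth T.onState hT.contDiffOn)) ≠ 0) : ∃ p₀, IsSpecialPolytropic n F Ω p₀ := by
  have h := hT.isNull hΩ hpos hF hF_ne
  set S := stateRing n hΩ hpos F hF hF_ne with hS
  set G := restrictSmooth T.onState hT.contDiffOn with hG
  obtain ⟨⟨⟨t, x, u, ρ, p⟩, hq⟩, hne⟩ : ∃ q, (S.D .t (S.energyCoeff G)).1 q ≠ 0 := by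
    by_contra! hz
    exact hβ (Subtype.ext (funext hz))
  -- `β_t` does not depend on the fluid variables, so at this `(t, x)` it is nonzero over all of `Ω`
  -- and can be divided out.
  have hall : ∀ {p' ρ' : ℝ} (hq' : (p', ρ') ∈ Ω),
      (S.D .t (S.energyCoeff G)).1 ⟨(t, x, u, ρ', p'), hq'⟩ ≠ 0 := by
    intro p' ρ' hq'
    rw [eq_of_D_fluid_eq_zero hΩ hpos hF hF_ne hc.isPreconnected (S.D .t (S.energyCoeff G))
      (fun i => by rw [S.comm, h.energyCoeff_u hn, map_zero])
      (by rw [S.comm, h.energyCoeff_r hn, map_zero])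
      (by rw [S.comm, h.energyCoeff_p hn, map_zero]) t x (w := (u, ρ', p')) (w' := (u, ρ, p))
      hq' hq]
    exact hne
  have hn' : (n : ℝ) ≠ 0 := by exact_mod_cast (by omega : n ≠ 0)
  have hder : ∀ q' ∈ Ω, fderiv ℝ F q' (0, 1) = 0 ∧ n * fderiv ℝ F q' (1, 0) = n + 2 := by
    rintro ⟨p', ρ'⟩ hq'
    have e1 : (S.D .t (S.energyCoeff G)).1 ⟨(t, x, u, ρ', p'), hq'⟩ *
        (S.D .r S.F).1 ⟨(t, x, u, ρ', p'), hq'⟩ = 0 :=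
      congrArg (fun f : smoothAlgebra (stateDomain n Ω) => f.1 ⟨(t, x, u, ρ', p'), hq'⟩)
        (h.stateFunction_r hn)
    have e2 : n * (S.D .t (S.energyCoeff G)).1 ⟨(t, x, u, ρ', p'), hq'⟩ *
        (S.D .p S.F).1 ⟨(t, x, u, ρ', p'), hq'⟩ =
          (n + 2) * (S.D .t (S.energyCoeff G)).1 ⟨(t, x, u, ρ', p'), hq'⟩ :=
      congrArg (fun f : smoothAlgebra (stateDomain n Ω) => f.1 ⟨(t, x, u, ρ', p'), hq'⟩)
        (h.stateFunction_p hn)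
    have f1 : (S.D .r S.F).1 ⟨(t, x, u, ρ', p'), hq'⟩ = fderiv ℝ F (p', ρ') (0, 1) :=
      smoothDeriv_thermoFun hΩ F hF _ _
    have f2 : (S.D .p S.F).1 ⟨(t, x, u, ρ', p'), hq'⟩ = fderiv ℝ F (p', ρ') (1, 0) :=
      smoothDeriv_thermoFun hΩ F hF _ _
    rw [f1] at e1
    rw [f2] at e2
    refine ⟨(mul_eq_zero.1 e1).resolve_left (hall hq'), mul_left_cancel₀ (hall hq') ?_⟩
    linear_combination e2
  obtain ⟨κ, hκ⟩ := hΩ.exists_is_const_of_fderiv_eq_zero hc.isPreconnected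
    (f := fun q => F q - (1 + 2 / (n : ℝ)) * q.1)
    ((hF.differentiableOn (by simp)).sub (by fun_prop))
    (fun q hq => by
      have dF := (hF.contDiffAt (hΩ.mem_nhds hq)).differentiableAt (by simp)
      obtain ⟨e1, e2⟩ := hder q hq
      have h3 : fderiv ℝ (fun q : ℝ × ℝ => F q - (1 + 2 / (n : ℝ)) * q.1) q = _ :=
        (dF.hasFDerivAt.sub ((hasFDerivAt_fst (𝕜 := ℝ)).const_mul _)).fderiv
      rw [h3]
      have e3 : fderiv ℝ F q (1, 0) = 1 + 2 / (n : ℝ) := by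
        field_simp
        linear_combination e2
      ext <;> simp [e1, e3])
  -- `κ` is the constant value of `F - (1 + 2/n) p` on `Ω`.
  refine ⟨-κ / (1 + 2 / (n : ℝ)), fun p' ρ' hq' => ?_⟩
  have hpos' : (1 + 2 / (n : ℝ)) ≠ 0 := by positivity
  have := hκ (p', ρ') hq'
  rw [mul_sub, mul_div_cancel₀ _ hpos']
  linarith

include hΩ hpos hF hF_ne in
lemma IsConservedDensity.hasNormalForm_of_not_special (hn : 1 < n) (hc : IsConnected Ω)
    (hsp : ¬ ∃ p₀, IsSpecialPolytropic n F Ω p₀) {T : KinematicFunction n}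
    (hT : IsConservedDensity F Ω T) : ∃ b, HasNormalForm F Ω T b :=
  hT.hasNormalForm hΩ hpos hF hF_ne hn hc (by
    by_contra hβ
    exact hsp (exists_isSpecialPolytropic hΩ hpos hF hF_ne hn hc hT hβ))

include hΩ hpos hF hF_ne in
/-- For the special polytropic state function a conserved density has the normal form up to the
similarity and dilational energies. -/
lemma IsConservedDensity.exists_hasNormalForm_sub (hn : 1 < n) (hc : IsConnected Ω) {p₀ : ℝ}
    (hsp : IsSpecialPolytropic n F Ω p₀) {T : KinematicFunction n}
    (hT : IsConservedDensity F Ω T) : ∃ b₁ b₂ b : ℝ, HasNormalForm F Ω (fun t x u ρ p =>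
      T t x u ρ p - b₁ * similarityEnergy p₀ t x u ρ p - b₂ * dilationalEnergy p₀ t x u ρ p) b := by
  have hn0 : 0 < n := by omega
  have h := hT.isNull hΩ hpos hF hF_ne
  set S := stateRing n hΩ hpos F hF hF_ne with hS
  set G := restrictSmooth T.onState hT.contDiffOn with hG
  set β := S.energyCoeff G with hβ
  have hβ0 : ∀ a, a ≠ .t → S.D a β = 0 := by
    intro a ha
    cases a with
    | t => exact absurd rfl ha
    | x i => exact h.energyCoeff_x hn i
    | u i => exact h.energyCoeff_u hn i
    | r => exact h.energyCoeff_r hn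
    | p => exact h.energyCoeff_p hn
  obtain ⟨⟨p₁, ρ₁⟩, h₁⟩ := hc.nonempty
  have hconst : ∀ f : smoothAlgebra (stateDomain n Ω), (∀ a, S.D a f = 0) → ∃ c : ℝ,
      f = algebraMap ℝ _ c := fun f hf =>
    ⟨_, eq_algebraMap_of_D_eq_zero hΩ hpos hF hF_ne hc.isPreconnected f hf
      ⟨(0, 0, 0, ρ₁, p₁), h₁⟩⟩
  -- Since `β_ttt = 0`, `β` is a constant plus `b₁ t + (d/2) t²`, and the last two terms are the
  -- energy coefficient of `b₁` times the similarity energy plus `d/2` times the dilational energy.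
  obtain ⟨d, hd⟩ := hconst (S.D .t (S.D .t β)) (fun a => by
    by_cases ha : a = .t
    · subst ha; exact h.energyCoeff_t_t_t hn
    · rw [S.comm a, S.comm a, hβ0 a ha, map_zero, map_zero])
  obtain ⟨b₁, hb₁⟩ := hconst (S.D .t β - algebraMap ℝ _ d * timeElt n Ω) (fun a => by
    by_cases ha : a = .t
    · subst ha
      simp [hd, D_timeElt hΩ hpos hF hF_ne S hS]
    · rw [map_sub, S.comm a, hβ0 a ha, Derivation.leibniz, D_timeElt hΩ hpos hF hF_ne S hS]
      cases a <;> first | exact absurd rfl ha | simp)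
  refine ⟨b₁, d / 2, ?_⟩
  set T' : KinematicFunction n := fun t x u ρ p => T t x u ρ p
    - b₁ * similarityEnergy p₀ t x u ρ p - d / 2 * dilationalEnergy p₀ t x u ρ p with hT'
  have hc' : IsConservedDensity F Ω T' := by
    refine hT.add_polytropic hΩ hpos hF hF_ne hn0 hsp (-b₁) (-(d / 2)) fun t x u ρ p _ => ?_
    simp only [hT']
    ring
  -- It remains to check that the subtraction made the energy coefficient stationary, which follows
  -- from its additivity.
  refine hc'.hasNormalForm hΩ hpos hF hF_ne hn hc ?_
  have hG' : restrictSmooth T'.onState hc'.contDiffOn =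
      G + polytropicElt S p₀ (-b₁) (-(d / 2)) := by
    ext ⟨⟨t, x, u, ρ, p⟩, hq⟩
    rw [Subalgebra.coe_add, Pi.add_apply,
      polytropicElt_apply S (fun q => rfl) (fun j q => rfl) p₀ (-b₁) (-(d / 2)) t x u ρ p hq]
    simp only [hG, restrictSmooth_apply, KinematicFunction.onState, hT']
    ring
  have hadd : ∀ f g, S.energyCoeff (f + g) = S.energyCoeff f + S.energyCoeff g := by
    intro f g
    simp only [StateRing.energyCoeff, StateRing.legendre, StateRing.thermal, ← map_add]
    congr 1
    simp only [map_add]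
    ring
  rw [← hS, hG', hadd, energyCoeff_polytropicElt hΩ hpos hF hF_ne hS _ _ hsp hn0, map_add,
    D_polytropicCoeff hΩ hpos hF hF_ne hS, ← hβ]
  have e : algebraMap ℝ (smoothAlgebra (stateDomain n Ω)) (2 * -(d / 2)) = -algebraMap ℝ _ d := by
    rw [← map_neg]; congr 1; ring
  simp only [e, map_neg]
  linear_combination hb₁

/-- The similarity energy is not a combination of the basic densities. -/
lemma not_isBasicCombination_similarityEnergy (hn : 0 < n) (hne : Ω.Nonempty)
    (hpos : ∀ p ρ : ℝ, (p, ρ) ∈ Ω → 0 < ρ) (p₀ : ℝ) (e : ℝ × ℝ → ℝ) :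
    ¬ IsBasicCombination F Ω e (similarityEnergy (n := n) p₀) := by
  rintro ⟨m, a, A, g, b, S, c, -, -, -, hT⟩
  obtain ⟨⟨p, ρ⟩, hq⟩ := hne
  have hρ := hpos p ρ hq
  set v : Space n := EuclideanSpace.single ⟨0, hn⟩ 1 with hv
  have hv1 : ‖v‖ = 1 := by simp [hv]
  -- The second difference in the velocity at `x = 0` isolates the kinetic energy, whose coefficient
  -- is `t` for the similarity energy but the constant `b` for a basic combination.
  have key : ∀ t : ℝ, t = b := by
    intro t
    have h0 := hT t 0 0 ρ p hq
    have h1 := hT t 0 v ρ p hq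
    have h2 := hT t 0 (-v) ρ p hq
    simp only [similarityEnergy, polytropicEnergy, mass, momentum, angularMomentum,
      galileanMomentum, energy, volumetricEntropy, norm_neg, hv1, inner_zero_right, PiLp.neg_apply,
      PiLp.zero_apply, norm_zero, mul_neg, mul_zero, sub_zero, Finset.sum_neg_distrib,
      Finset.sum_const_zero] at h0 h1 h2
    have : ρ * (t - b) = 0 := by linear_combination h1 + h2 - 2 * h0
    linarith [(mul_eq_zero.1 this).resolve_left hρ.ne']
  linarith [key 0, key 1]

end Polytropic

end GasDynamics

end

theorem theorem3 (n : ℕ) (hn : 1 < n)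
    (Ω : Set (ℝ × ℝ)) (hΩ_open : IsOpen Ω) (hΩ_conn : IsConnected Ω)
    (hΩ_pos : ∀ p ρ : ℝ, (p, ρ) ∈ Ω → 0 < ρ)
    (F : ℝ × ℝ → ℝ) (hF_smooth : ContDiffOn ℝ ∞ F Ω)
    (hF_ne : ∀ W : Set (ℝ × ℝ), W ⊆ Ω → IsOpen W → W.Nonempty → ∃ q ∈ W, F q ≠ 0) :
    -- the basic densities are conserved for every state function, with every choice of `e`, `S`
    (∀ (e : ℝ × ℝ → ℝ) (T : GasDynamics.KinematicFunction n),
      GasDynamics.IsBasicCombination F Ω e T → GasDynamics.IsConservedDensity F Ω T) ∧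
    -- for a general state function there are no others, and any solution `e` may be used
    ((¬ ∃ p₀ : ℝ, GasDynamics.IsSpecialPolytropic n F Ω p₀) →
      ∀ T : GasDynamics.KinematicFunction n, GasDynamics.IsConservedDensity F Ω T →
        (∃ e : ℝ × ℝ → ℝ, GasDynamics.IsBasicCombination F Ω e T) ∧
        (∀ e : ℝ × ℝ → ℝ, GasDynamics.IsInternalEnergy F Ω e →
          GasDynamics.IsBasicCombination F Ω e T)) ∧
    -- additional conserved densities exist exactly for the special polytropic state function
    ((∃ T : GasDynamics.KinematicFunction n, GasDynamics.IsConservedDensity F Ω T ∧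
        ¬ ∃ e : ℝ × ℝ → ℝ, GasDynamics.IsBasicCombination F Ω e T) ↔
      ∃ p₀ : ℝ, GasDynamics.IsSpecialPolytropic n F Ω p₀) ∧
    -- in that case they are the similarity energy and the dilational energy
    (∀ p₀ : ℝ, GasDynamics.IsSpecialPolytropic n F Ω p₀ →
      ∀ e : ℝ × ℝ → ℝ, GasDynamics.IsInternalEnergy F Ω e →
      ∀ T : GasDynamics.KinematicFunction n,
        GasDynamics.IsConservedDensity F Ω T ↔
          ∃ (b₁ b₂ : ℝ) (T₀ : GasDynamics.KinematicFunction n),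
            GasDynamics.IsBasicCombination F Ω e T₀ ∧
            ∀ (t : ℝ) (x u : GasDynamics.Space n) (ρ p : ℝ), (p, ρ) ∈ Ω →
              T t x u ρ p = T₀ t x u ρ p
                + b₁ * GasDynamics.similarityEnergy p₀ t x u ρ p
                + b₂ * GasDynamics.dilationalEnergy p₀ t x u ρ p) := by
  have conserved_of_normal : ∀ {b : ℝ} {T : GasDynamics.KinematicFunction n}, GasDynamics.HasNormalForm F Ω T b →
      GasDynamics.IsConservedDensity F Ω T := fun h =>
    h.isConservedDensity hΩ_open hΩ_pos hF_smooth hF_ne (by omega)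
  have basic : ∀ (e : ℝ × ℝ → ℝ) (T : GasDynamics.KinematicFunction n),
      GasDynamics.IsBasicCombination F Ω e T → GasDynamics.IsConservedDensity F Ω T := by
    intro e T h
    obtain ⟨b, hb⟩ := h.hasNormalForm hΩ_open
    exact conserved_of_normal hb
  have general : (¬ ∃ p₀ : ℝ, GasDynamics.IsSpecialPolytropic n F Ω p₀) →
      ∀ T : GasDynamics.KinematicFunction n, GasDynamics.IsConservedDensity F Ω T →
        (∃ e : ℝ × ℝ → ℝ, GasDynamics.IsBasicCombination F Ω e T) ∧
        (∀ e : ℝ × ℝ → ℝ, GasDynamics.IsInternalEnergy F Ω e →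
          GasDynamics.IsBasicCombination F Ω e T) := by
    intro hsp T hT
    obtain ⟨b, hb⟩ := hT.hasNormalForm_of_not_special hΩ_open hΩ_pos hF_smooth hF_ne hn hΩ_conn hsp
    exact ⟨hb.exists_isBasicCombination hΩ_open, fun e he => hb.isBasicCombination hΩ_open he⟩
  refine ⟨basic, general, ⟨?_, ?_⟩, fun p₀ hsp e he T => ⟨fun hT => ?_, ?_⟩⟩
  · rintro ⟨T, hT, hne⟩
    by_contra hsp
    exact hne (general hsp T hT).1
  · rintro ⟨p₀, hsp⟩
    refine ⟨GasDynamics.similarityEnergy p₀, ?_, fun ⟨e, he⟩ =>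
      GasDynamics.not_isBasicCombination_similarityEnergy (by omega) hΩ_conn.nonempty hΩ_pos p₀ e
        he⟩
    -- The similarity energy is built on the trivial density zero with `b₁ = 1` and `b₂ = 0`.
    refine GasDynamics.IsConservedDensity.add_polytropic hΩ_open hΩ_pos hF_smooth hF_ne (by omega)
      hsp (T₀ := fun _ _ _ _ _ => 0) ?_ 1 0 fun t x u ρ p _ => by ring
    exact GasDynamics.isConservedDensity_of_spacetime (by omega) F
      (contDiff_const (c := (0 : ℝ)))
  · obtain ⟨b₁, b₂, b, hb⟩ :=
      hT.exists_hasNormalForm_sub hΩ_open hΩ_pos hF_smooth hF_ne hn hΩ_conn hsp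
    exact ⟨b₁, b₂, _, hb.isBasicCombination hΩ_open he, fun t x u ρ p _ => by ring⟩
  · rintro ⟨b₁, b₂, T₀, hT₀, hT⟩
    exact (basic e T₀ hT₀).add_polytropic hΩ_open hΩ_pos hF_smooth hF_ne (by omega) hsp b₁ b₂ hT
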